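/- **Setup.** Let $\mathcal A=\{\left[{k\atop d}\right] : k\ge 1,\ d\ge 0\}$ and let $\mathbb Q\langle\mathcal A\rangle$ be the space of $\mathbb Q$-linear combinations of words in the letters of $\mathcal A$; write $\left[{k_1,\dots,k_r\atop d_1,\dots,d_r}\right]$ for the word $\left[{k_1\atop d_1}\right]\cdots\left[{k_r\atop d_r}\right]$. The stuffle product $\ast$ on $\mathbb Q\langle\mathcal A\rangle$ is the $\mathbb Q$-bilinear product for which the empty word is the unit and $$aw\ast bv=a(w\ast bv)+b(aw\ast v)+(a\diamond b)(w\ast v)$$ for letters $a,b$ and words $w,v$, where $\left[{k_1\atop d_1}\right]\diamond\left[{k_2\atop d_2}\right]=\left[{k_1+k_2\atop d_1+d_2}\right]$. It makes $\mathbb Q\langle\mathcal A\rangle$ a commutative $\mathbb Q$-algebra. Put $\mathfrak A_0=1$ and $$\mathfrak A_r=\sum_{k_i\ge1,\,d_i\ge0}\left[{k_1,\dots,k_r\atop d_1,\dots,d_r}\right]X_1^{k_1-1}\cdots X_r^{k_r-1}\frac{Y_1^{d_1}}{d_1!}\cdots\frac{Y_r^{d_r}}{d_r!}.$$ An operator $\rho$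 on families $(f_r)_{r\ge0}$ of power series $f_r\in\mathbb Q\langle\mathcal A\rangle[[X_1,Y_1,\dots,X_r,Y_r]]$ induces the linear map $\rho:\mathbb Q\langle\mathcal A\rangle\to\mathbb Q\langle\mathcal A\rangle$ that sends $\left[{k_1,\dots,k_r\atop d_1,\dots,d_r}\right]$ to the coefficient of $X_1^{k_1-1}\cdots X_r^{k_r-1}\frac{Y_1^{d_1}}{d_1!}\cdots\frac{Y_r^{d_r}}{d_r!}$ in the depth-$r$ component of $\rho\mathfrak A$. In this way one defines on $\mathbb Q\langle\mathcal A\rangle$ the linear maps given by - the swap: $\sigma f_r(X_1,\dots,X_r;Y_1,\dots,Y_r)=f_r(Y_1+\dots+Y_r,\dots,Y_1+Y_2,Y_1;\,X_r,X_{r-1}-X_r,\dots,X_1-X_2)$; - $D f_r=\sum_{j=1}^r\frac{\partial}{\partial X_j}\frac{\partial}{\partial Y_j}f_r$ and $W f_r=\sum_{j=1}^r\bigl(\frac{\partial}{\partial X_j}X_j+Y_j\frac{\partial}{\partial Y_j}\bigr)f_r$; - $\delta f_r=\Bigl(\sum_{j=1}^r X_jY_j\Bigr)f_r+\sum_{j=1}^r\Bigl(-(X_j-X_{j+1}+Y_j)\frac{\varphi_j^+}{2}-(X_{j-1}-X_j+Y_j)\frac{\varphi_j^-}{2}+\bigl(\frac{\varphi_j^+}{2}\bigr)^2-\bigl(\frac{\varphi_j^-}{2}\bigr)^2\Bigr)f_r$,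 with $X_{r+1}=0$. Here $\varphi_j^+f_r$ (for $1\le j\le r$) is $f_{r-1}$ evaluated at $X_1,\dots,X_r$ with $X_j$ removed and at $Y_1,\dots,Y_{j-1},Y_j+Y_{j+1},Y_{j+2},\dots,Y_r$ (at $Y_1,\dots,Y_{r-1}$ if $j=r$); $\varphi_j^-f_r$ (for $2\le j\le r$) is $f_{r-1}$ evaluated at $X_1,\dots,X_r$ with $X_j$ removed and at $Y_1,\dots,Y_{j-2},Y_{j-1}+Y_j,Y_{j+1},\dots,Y_r$; for all other $j$ both are $0$. Let $\mathcal I$ be the ideal of $(\mathbb Q\langle\mathcal A\rangle,\ast)$ generated by all $\sigma(w)-w$, let $\mathrm{FMES}=(\mathbb Q\langle\mathcal A\rangle,\ast)/\mathcal I$, let $G^f(w)$ be the class of a word $w$, and put $G^f(k_1,\dots,k_r)=G^f\left[{k_1,\dots,k_r\atop 0,\dots,0}\right]$. Let $\mathrm{Fil}^{\mathrm{lwt}}_0\,\mathrm{FMES}$ be the $\mathbb Q$-span of the $G^f(w)$ over all words $w=\left[{k_1,\dots,k_r\atop d_1,\dots,d_r}\right]$ with $d_1+\dots+d_r\le 0$,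 i.e. of all $G^f(k_1,\dots,k_r)$ with $r\ge0$. Finally let $\mathfrak H^1=\mathbb Q\langle z_k: k\ge1\rangle$, with the stuffle product $\ast$ (for which $z_i\diamond z_j=z_{i+j}$) and the shuffle product $\sqcup\!\sqcup$, which is the restriction of the shuffle product of $\mathbb Q\langle x,y\rangle$ under $z_k=x^{k-1}y$; extend $z_{k_1}\cdots z_{k_r}\mapsto G^f(k_1,\dots,k_r)$ to a linear map $G^f:\mathfrak H^1\to\mathrm{FMES}$. **Statement.** The maps $D,W,\delta$ on $\mathbb Q\langle\mathcal A\rangle$ induce derivations $D,W,\delta$ of the $\mathbb Q$-algebra $\mathrm{FMES}$, and these satisfy $[W,D]=2D$, $[W,\delta]=-2\delta$, $[\delta,D]=W$. The subspace $\mathrm{Fil}^{\mathrm{lwt}}_0\,\mathrm{FMES}$ is an $\mathfrak{sl}_2$-subalgebra of $\mathrm{FMES}$: it is a subalgebra and is closed under $D$, $W$ and $\delta$. Explicitly, for all $r\ge0$ and $k_1,\dots,k_r\ge1$, $$\begin{aligned}\delta\,G^f(k_1,\dots,k_r)={}&-\tfrac12\,\mathbf 1_{k_1=2}\,G^f(k_2,\dots,k_r)+\tfrac14\,\mathbf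 1_{k_1=k_2=1}\,G^f(k_3,\dots,k_r)\\&+\tfrac12\sum_{j=1}^{r-1}\mathbf 1_{k_j=1,\ k_{j+1}>1}\,G^f(k_1,\dots,k_{j-1},k_{j+1}-1,k_{j+2},\dots,k_r)\\&-\tfrac12\sum_{j=2}^{r}\mathbf 1_{k_j=1,\ k_{j-1}>1}\,G^f(k_1,\dots,k_{j-2},k_{j-1}-1,k_{j+1},\dots,k_r)\end{aligned}$$ (a condition on an index $k_i$ with $i>r$ counts as false), and, for $w=z_{k_1}\cdots z_{k_r}$, $$D\,G^f(w)=G^f\bigl(z_2\ast w-z_2\mathbin{\sqcup\!\sqcup}w\bigr).$$ -/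

import Mathlib

/-! # Formal multiple Eisenstein series and their `sl_2`-action -/

namespace FormalMES

noncomputable section

/-! ### Words and quasi-shuffle algebras -/

/-- `ℚ⟨L⟩`: the `ℚ`-vector space of finite linear combinations of words in the letters `L`. -/
def Words (L : Type*) : Type _ := List L →₀ ℚ

instance instAddCommGroupWords (L : Type*) : AddCommGroup (Words L) :=
  inferInstanceAs (AddCommGroup (List L →₀ ℚ))

instance instModuleWords (L : Type*) : Module ℚ (Words L) :=
  inferInstanceAs (Module ℚ (List L →₀ ℚ))

/-- A word, as a basis element of `ℚ⟨L⟩`. -/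
def word {L : Type*} (w : List L) : Words L := Finsupp.single w (1 : ℚ)

/-- The linear map out of `ℚ⟨L⟩` with prescribed values on words. -/
def wordLift {L M : Type*} [AddCommGroup M] [Module ℚ M] (f : List L → M) : Words L →ₗ[ℚ] M :=
  Finsupp.linearCombination ℚ f

theorem wordLift_word {L M : Type*} [AddCommGroup M] [Module ℚ M] (f : List L → M) (w : List L) :
    wordLift f (word w) = f w := by
  unfold wordLift word
  exact (Finsupp.linearCombination_single ℚ (1 : ℚ) w).trans (one_smul ℚ _)

theorem words_hom_ext {L M : Type*} [AddCommGroup M] [Module ℚ M] {f g : Words L →ₗ[ℚ] M}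
    (h : ∀ w, f (word w) = g (word w)) : f = g :=
  Finsupp.lhom_ext' fun w => LinearMap.ext_ring (h w)

/-- Prepending a letter to every word. -/
def consL {L : Type*} (a : L) : Words L →ₗ[ℚ] Words L := wordLift fun w => word (a :: w)

theorem consL_word {L : Type*} (a : L) (w : List L) : consL a (word w) = word (a :: w) :=
  wordLift_word _ w

/-- The quasi-shuffle product of two words, for the product `+` on the letters:
`a w * b v = a (w * b v) + b (a w * v) + (a + b) (w * v)`. -/
def stuffleWord {L : Type*} [AddCommSemigroup L] : List L → List L → Words L
  | [], v => word v
  | a :: w, [] => word (a :: w)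
  | a :: w, b :: v =>
      consL a (stuffleWord w (b :: v)) + consL b (stuffleWord (a :: w) v)
        + consL (a + b) (stuffleWord w v)
  termination_by w v => w.length + v.length

/-- The bilinear extension of `stuffleWord`. -/
def stuffle {L : Type*} [AddCommSemigroup L] : Words L →ₗ[ℚ] Words L →ₗ[ℚ] Words L :=
  wordLift fun w => wordLift fun v => stuffleWord w v

section StuffleRing

variable {L : Type*} [AddCommSemigroup L]

theorem stuffle_word (w v : List L) : stuffle (word w) (word v) = stuffleWord w v := by
  simp [stuffle, wordLift_word]

theorem stuffleWord_nil_left (v : List L) : stuffleWord [] v = word v := by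
  simp [stuffleWord]

theorem stuffleWord_nil_right (v : List L) : stuffleWord v [] = word v := by
  cases v <;> simp [stuffleWord]

theorem stuffle_one_left (f : Words L) : stuffle (word []) f = f := by
  have : stuffle (word ([] : List L)) = LinearMap.id :=
    words_hom_ext fun w => by rw [stuffle_word, stuffleWord_nil_left]; rfl
  rw [this]; rfl

theorem stuffle_one_right (f : Words L) : stuffle f (word []) = f := by
  have : (stuffle (L := L)).flip (word []) = LinearMap.id :=
    words_hom_ext fun w => by
      rw [LinearMap.flip_apply, stuffle_word, stuffleWord_nil_right]; rfl
  exact LinearMap.congr_fun this f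

theorem stuffle_cons_cons (a b : L) (f g : Words L) :
    stuffle (consL a f) (consL b g) =
      consL a (stuffle f (consL b g)) + consL b (stuffle (consL a f) g)
        + consL (a + b) (stuffle f g) := by
  have : (stuffle.compl₁₂ (consL a) (consL b) : Words L →ₗ[ℚ] Words L →ₗ[ℚ] Words L) =
      (stuffle.compl₁₂ LinearMap.id (consL b)).compr₂ (consL a)
        + (stuffle.compl₁₂ (consL a) LinearMap.id).compr₂ (consL b)
        + stuffle.compr₂ (consL (a + b)) := by
    refine words_hom_ext fun w => words_hom_ext fun v => ?_
    simp [consL_word, stuffle_word, stuffleWord]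
  simpa using LinearMap.congr_fun (LinearMap.congr_fun this f) g

theorem stuffleWord_comm : ∀ w v : List L, stuffleWord w v = stuffleWord v w
  | [], v => by rw [stuffleWord_nil_left, stuffleWord_nil_right]
  | a :: w, [] => by rw [stuffleWord_nil_left, stuffleWord_nil_right]
  | a :: w, b :: v => by
      rw [stuffleWord, stuffleWord, stuffleWord_comm w (b :: v), stuffleWord_comm (a :: w) v,
        stuffleWord_comm w v, add_comm b a]
      abel
  termination_by w v => w.length + v.length

theorem stuffle_comm (f g : Words L) : stuffle f g = stuffle g f := by
  have : (stuffle : Words L →ₗ[ℚ] Words L →ₗ[ℚ] Words L) = stuffle.flip := by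
    refine words_hom_ext fun w => words_hom_ext fun v => ?_
    rw [LinearMap.flip_apply, stuffle_word, stuffle_word, stuffleWord_comm]
  exact LinearMap.congr_fun (LinearMap.congr_fun this f) g

theorem stuffle_assoc_word : ∀ w v u : List L,
    stuffle (stuffle (word w) (word v)) (word u) = stuffle (word w) (stuffle (word v) (word u))
  | [], v, u => by rw [stuffle_one_left, stuffle_one_left]
  | a :: w, [], u => by rw [stuffle_one_left, stuffle_one_right]
  | a :: w, b :: v, [] => by rw [stuffle_one_right, stuffle_one_right]
  | a :: w, b :: v, c :: u => by
      have h1 := stuffle_assoc_word w (b :: v) (c :: u)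
      have h2 := stuffle_assoc_word (a :: w) v (c :: u)
      have h3 := stuffle_assoc_word (a :: w) (b :: v) u
      have h4 := stuffle_assoc_word w v (c :: u)
      have h5 := stuffle_assoc_word w (b :: v) u
      have h6 := stuffle_assoc_word (a :: w) v u
      have h7 := stuffle_assoc_word w v u
      simp only [← consL_word] at *
      generalize word w = w at *
      generalize word v = v at *
      generalize word u = u at *
      simp only [stuffle_cons_cons, map_add, LinearMap.add_apply] at *
      simp only [h1, h2, h4, h5, h6, h7, ← h3, add_assoc, map_add]
      abel
  termination_by w v u => w.length + v.length + u.length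

theorem stuffle_assoc (f g h : Words L) :
    stuffle (stuffle f g) h = stuffle f (stuffle g h) := by
  have e1 : ∀ w v : List L,
      stuffle (stuffle (word w) (word v)) = (stuffle (word w)).comp (stuffle (word v)) :=
    fun w v => words_hom_ext fun u => stuffle_assoc_word w v u
  have e2 : ∀ w : List L, (stuffle.flip h).comp (stuffle (word w)) =
      (stuffle (word w)).comp (stuffle.flip h) :=
    fun w => words_hom_ext fun v => LinearMap.congr_fun (e1 w v) h
  have e3 : (stuffle.flip h).comp (stuffle.flip g) = stuffle.flip (stuffle g h) :=
    words_hom_ext fun w => LinearMap.congr_fun (e2 w) g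
  exact LinearMap.congr_fun e3 f

end StuffleRing

/-- `(ℚ⟨L⟩, *)` is a commutative ring, with the empty word as unit. -/
instance instCommRingWords (L : Type*) [AddCommSemigroup L] : CommRing (Words L) where
  __ := instAddCommGroupWords L
  mul f g := stuffle f g
  one := word []
  mul_assoc := stuffle_assoc
  mul_comm := stuffle_comm
  one_mul := stuffle_one_left
  mul_one := stuffle_one_right
  left_distrib f g h := map_add (stuffle f) g h
  right_distrib f g h := LinearMap.map_add₂ stuffle f g h
  zero_mul g := LinearMap.map_zero₂ stuffle g
  mul_zero f := map_zero (stuffle f)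

instance instAlgebraWords (L : Type*) [AddCommSemigroup L] : Algebra ℚ (Words L) :=
  Algebra.ofModule (fun r f g => LinearMap.map_smul₂ stuffle r f g)
    (fun r f g => map_smul (stuffle f) r g)

theorem words_mul_def {L : Type*} [AddCommSemigroup L] (f g : Words L) : f * g = stuffle f g := rfl

theorem words_one_def {L : Type*} [AddCommSemigroup L] : (1 : Words L) = word [] := rfl

/-! ### The shuffle product -/

/-- The shuffle product of two words: `a w ⧢ b v = a (w ⧢ b v) + b (a w ⧢ v)`. -/
def shuffleWord {L : Type*} : List L → List L → Words L
  | [], v => word v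
  | a :: w, [] => word (a :: w)
  | a :: w, b :: v => consL a (shuffleWord w (b :: v)) + consL b (shuffleWord (a :: w) v)
  termination_by w v => w.length + v.length

/-- The bilinear extension of `shuffleWord`. -/
def shuffle {L : Type*} : Words L →ₗ[ℚ] Words L →ₗ[ℚ] Words L :=
  wordLift fun w => wordLift fun v => shuffleWord w v

/-- `ℌ¹`: words in the letters `z_k`, `k ≥ 1`. The letter `z_k` is represented by `k : ℕ+`, so the
ring structure on `ℌ¹` is the stuffle product, `z_i ⋄ z_j = z_{i+j}`. -/
abbrev H1 : Type := Words ℕ+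

/-- The letters `x`, `y`. -/
inductive XY : Type
  | x
  | y

/-- The word `z_{k_1} ⋯ z_{k_r}` as a word in `x` and `y`, through `z_k = x^{k-1} y`. -/
def zToXY : List ℕ+ → List XY
  | [] => []
  | k :: ks => List.replicate ((k : ℕ) - 1) XY.x ++ XY.y :: zToXY ks

/-- The embedding `ℌ¹ → ℌ = ℚ⟨x, y⟩`, `z_k ↦ x^{k-1} y`. -/
def toXY : H1 →ₗ[ℚ] Words XY := wordLift fun ks => word (zToXY ks)

/-- `xyToZ n u` reads `x^n u` as a word in the letters `z_k`; the value is `none` if `x^n u` is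
non-empty and does not end in `y`. -/
def xyToZ : ℕ → List XY → Option (List ℕ+)
  | 0, [] => some []
  | _ + 1, [] => none
  | n, XY.x :: u => xyToZ (n + 1) u
  | n, XY.y :: u => (xyToZ 0 u).map fun ks => n.succPNat :: ks

/-- The left inverse of `toXY` that kills the words which do not lie in `ℌ¹`. -/
def ofXY : Words XY →ₗ[ℚ] H1 := wordLift fun u => (xyToZ 0 u).elim 0 word

/-- The shuffle product on `ℌ¹`, i.e. the restriction to `ℌ¹` of the shuffle product on `ℚ⟨x, y⟩`;
see `toXY_shuffleH1`. -/
def shuffleH1 (u v : H1) : H1 := ofXY (shuffle (toXY u) (toXY v))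

theorem xyToZ_replicate (m : ℕ) (u : List XY) :
    ∀ n, xyToZ n (List.replicate m XY.x ++ u) = xyToZ (n + m) u := by
  induction m with
  | zero => intro n; simp
  | succ m ih =>
    intro n
    rw [List.replicate_succ, List.cons_append]
    cases n <;> (rw [xyToZ, ih]; congr 1; omega)

theorem xyToZ_zToXY (ks : List ℕ+) : xyToZ 0 (zToXY ks) = some ks := by
  induction ks with
  | nil => rfl
  | cons k ks ih =>
    rw [zToXY, xyToZ_replicate]
    have : ∀ n, xyToZ n (XY.y :: zToXY ks) = some (n.succPNat :: ks) := by
      intro n; cases n <;> simp [xyToZ, ih]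
    rw [this]
    simp only [Option.some.injEq, List.cons.injEq, and_true]
    apply PNat.eq
    have := k.pos
    simp [Nat.succPNat_coe]
    omega

theorem ofXY_toXY (u : H1) : ofXY (toXY u) = u := by
  have : ofXY.comp toXY = LinearMap.id := words_hom_ext fun ks => by
    simp [toXY, ofXY, wordLift_word, xyToZ_zToXY]
  exact LinearMap.congr_fun this u

/-- The span of the non-empty words ending in `y`. -/
def endY : Submodule ℚ (Words XY) := Submodule.span ℚ {f | ∃ u, f = word (u ++ [XY.y])}

theorem consL_mem_endY (a : XY) {f : Words XY} (hf : f ∈ endY) : consL a f ∈ endY := by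
  have : endY ≤ endY.comap (consL a) := by
    refine Submodule.span_le.2 ?_
    rintro _ ⟨u, rfl⟩
    exact Submodule.subset_span ⟨a :: u, by rw [consL_word]; rfl⟩
  exact this hf

theorem exists_zToXY_append (u : List XY) : ∀ n : ℕ,
    ∃ ks, List.replicate n XY.x ++ (u ++ [XY.y]) = zToXY ks := by
  induction u with
  | nil => intro n; exact ⟨[n.succPNat], by simp [zToXY]⟩
  | cons a u ih =>
    intro n
    cases a with
    | x =>
      obtain ⟨ks, h⟩ := ih (n + 1)
      refine ⟨ks, ?_⟩
      rw [← h, List.replicate_succ']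
      simp
    | y =>
      obtain ⟨ks, h⟩ := ih 0
      exact ⟨n.succPNat :: ks, by simpa [zToXY] using h⟩

theorem endY_le_range : endY ≤ LinearMap.range toXY := by
  refine Submodule.span_le.2 ?_
  rintro _ ⟨u, rfl⟩
  obtain ⟨ks, h⟩ := exists_zToXY_append u 0
  exact ⟨word ks, by simpa [toXY, wordLift_word] using congrArg word h.symm⟩

theorem shuffleWord_mem_endY : ∀ w v : List XY, (w = [] ∨ ∃ u, w = u ++ [XY.y]) →
    (v = [] ∨ ∃ u, v = u ++ [XY.y]) → (w ≠ [] ∨ v ≠ []) → shuffleWord w v ∈ endY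
  | [], v, _, hv, h => by
      rw [shuffleWord]
      rcases hv with rfl | ⟨u, rfl⟩
      · simp at h
      · exact Submodule.subset_span ⟨u, rfl⟩
  | a :: w, [], hw, _, _ => by
      rw [shuffleWord]
      rcases hw with hw | ⟨u, hu⟩
      · simp at hw
      · exact Submodule.subset_span ⟨u, by rw [hu]⟩
  | a :: w, b :: v, hw, hv, _ => by
      have key : ∀ (c : XY) (t : List XY), (c :: t = [] ∨ ∃ u, c :: t = u ++ [XY.y]) →
          (t = [] ∨ ∃ u, t = u ++ [XY.y]) := by
        rintro c t (h | ⟨u, h⟩)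
        · simp at h
        · cases u with
          | nil => left; simpa using (List.cons.inj h).2
          | cons d u => right; exact ⟨u, (List.cons.inj h).2⟩
      rw [shuffleWord]
      exact add_mem
        (consL_mem_endY a (shuffleWord_mem_endY w (b :: v) (key a w hw) hv (by simp)))
        (consL_mem_endY b (shuffleWord_mem_endY (a :: w) v hw (key b v hv) (by simp)))
  termination_by w v => w.length + v.length

theorem zToXY_eq_nil_or (ks : List ℕ+) : zToXY ks = [] ∨ ∃ u, zToXY ks = u ++ [XY.y] := by
  induction ks with
  | nil => left; rfl
  | cons k ks ih =>
    right
    rcases ih with h | ⟨u, h⟩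
    · exact ⟨List.replicate ((k : ℕ) - 1) XY.x, by rw [zToXY, h]⟩
    · exact ⟨List.replicate ((k : ℕ) - 1) XY.x ++ XY.y :: u, by rw [zToXY, h]; simp⟩

/-- `ℌ¹` is closed under the shuffle product of `ℚ⟨x, y⟩`, which restricts to `shuffleH1`. -/
theorem toXY_shuffleH1 (u v : H1) : toXY (shuffleH1 u v) = shuffle (toXY u) (toXY v) := by
  have hword : ∀ ks ls : List ℕ+, toXY (ofXY (shuffle (toXY (word ks)) (toXY (word ls)))) =
      shuffle (toXY (word ks)) (toXY (word ls)) := by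
    intro ks ls
    suffices h : shuffle (toXY (word ks)) (toXY (word ls)) ∈ LinearMap.range toXY by
      obtain ⟨f, hf⟩ := h
      rw [← hf, ofXY_toXY]
    simp only [toXY, wordLift_word, shuffle]
    by_cases h : zToXY ks = [] ∧ zToXY ls = []
    · refine ⟨word [], ?_⟩
      rw [h.1, h.2, shuffleWord, wordLift_word]; rfl
    · exact endY_le_range (shuffleWord_mem_endY _ _ (zToXY_eq_nil_or ks) (zToXY_eq_nil_or ls)
        (by tauto))
  have : (shuffle.compl₁₂ toXY toXY).compr₂ (toXY.comp ofXY) =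
      (shuffle.compl₁₂ toXY toXY : H1 →ₗ[ℚ] H1 →ₗ[ℚ] Words XY) :=
    words_hom_ext fun ks => words_hom_ext fun ls => hword ks ls
  exact LinearMap.congr_fun (LinearMap.congr_fun this u) v

/-! ### Generating series -/

/-- The letters `[k; d]` with `k ≥ 1` and `d ≥ 0`, with
`[k₁; d₁] ⋄ [k₂; d₂] = [k₁ + k₂; d₁ + d₂]` (the componentwise addition). -/
abbrev Letter : Type := ℕ+ × ℕ

/-- The commutative `ℚ`-algebra `(ℚ⟨A⟩, *)`. -/
abbrev QA : Type := Words Letter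

/-- `ℚ⟨A⟩⟦X_1, Y_1, …, X_r, Y_r⟧`; `Sum.inl i` stands for `X_{i+1}`, `Sum.inr i` for `Y_{i+1}`. -/
abbrev Series (r : ℕ) : Type := MvPowerSeries (Fin r ⊕ Fin r) QA

/-- Families `(f_r)_{r ≥ 0}` of power series. -/
abbrev Bimould : Type := (r : ℕ) → Series r

/-- The variable `X_j` in depth `r`, for `1 ≤ j ≤ r`, and `0` for other `j`. -/
def varX (r j : ℕ) : Series r :=
  if h : 1 ≤ j ∧ j ≤ r then MvPowerSeries.X (Sum.inl ⟨j - 1, by omega⟩) else 0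

/-- The variable `Y_j` in depth `r`, for `1 ≤ j ≤ r`, and `0` for other `j`. -/
def varY (r j : ℕ) : Series r :=
  if h : 1 ≤ j ∧ j ≤ r then MvPowerSeries.X (Sum.inr ⟨j - 1, by omega⟩) else 0

/-- `f(P_1, …, P_s; Q_1, …, Q_s)` -/
def Series.substXY {s r : ℕ} (f : Series s) (P Q : ℕ → Series r) : Series r :=
  MvPowerSeries.subst (Sum.elim (fun i : Fin s => P (i + 1)) (fun i : Fin s => Q (i + 1))) f

theorem constantCoeff_varX (r j : ℕ) : MvPowerSeries.constantCoeff (varX r j) = 0 := by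
  unfold varX; split_ifs <;> simp

theorem constantCoeff_varY (r j : ℕ) : MvPowerSeries.constantCoeff (varY r j) = 0 := by
  unfold varY; split_ifs <;> simp

/-- A substitution without constant terms is legitimate. -/
theorem hasSubst_substXY {s r : ℕ} (P Q : ℕ → Series r)
    (hP : ∀ i, MvPowerSeries.constantCoeff (P i) = 0)
    (hQ : ∀ i, MvPowerSeries.constantCoeff (Q i) = 0) :
    MvPowerSeries.HasSubst
      (Sum.elim (fun i : Fin s => P (i + 1)) (fun i : Fin s => Q (i + 1))) :=
  MvPowerSeries.hasSubst_of_constantCoeff_zero (by rintro (i | i) <;> simp [hP, hQ])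

/-- The generating series `𝔄_r` of all words of length `r`, with coefficient
`[k_1, …, k_r; d_1, …, d_r]` at `X_1^{k_1-1} ⋯ X_r^{k_r-1} Y_1^{d_1}/d_1! ⋯ Y_r^{d_r}/d_r!`. -/
def genSeries : Bimould := fun r n =>
  (∏ j : Fin r, ((n (Sum.inr j)).factorial : ℚ))⁻¹ •
    word (List.ofFn fun j : Fin r => ((n (Sum.inl j)).succPNat, n (Sum.inr j)))

/-- The exponent of the monomial `X_1^{k_1-1} ⋯ X_r^{k_r-1} Y_1^{d_1} ⋯ Y_r^{d_r}` that belongs to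
the word `[k_1, …, k_r; d_1, …, d_r]`. -/
def exponent (w : List Letter) : Fin w.length ⊕ Fin w.length →₀ ℕ :=
  Finsupp.equivFunOnFinite.symm
    (Sum.elim (fun j => ((w.get j).1 : ℕ) - 1) (fun j => (w.get j).2))

/-- The linear map `ℚ⟨A⟩ → ℚ⟨A⟩` induced by an operator `ρ` on families of power series:
`[k_1, …, k_r; d_1, …, d_r]` is mapped to the coefficient of
`X_1^{k_1-1} ⋯ X_r^{k_r-1} Y_1^{d_1}/d_1! ⋯ Y_r^{d_r}/d_r!` in `ρ 𝔄_r`. -/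
def onWords (ρ : Bimould → Bimould) : QA →ₗ[ℚ] QA :=
  wordLift fun w =>
    (∏ j : Fin w.length, ((w.get j).2.factorial : ℚ)) •
      MvPowerSeries.coeff (exponent w) (ρ genSeries w.length)

/-- The swap: `f_r(X_1, …, X_r; Y_1, …, Y_r)` becomes
`f_r(Y_1 + ⋯ + Y_r, …, Y_1 + Y_2, Y_1; X_r, X_{r-1} - X_r, …, X_1 - X_2)`. -/
def swap (f : Bimould) : Bimould := fun r =>
  (f r).substXY (fun i => ∑ l ∈ Finset.Icc 1 (r + 1 - i), varY r l)
    (fun i => varX r (r + 1 - i) - varX r (r + 2 - i))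

/-- `φ_j^+ f_r = f_{r-1}(X without X_j; Y_1, …, Y_j + Y_{j+1}, …, Y_r)` for `1 ≤ j ≤ r`, where for
`j = r` the second row is `Y_1, …, Y_{r-1}`; and `0` otherwise. -/
def phiPlus (j : ℕ) (f : Bimould) : Bimould := fun r =>
  if 1 ≤ j ∧ j ≤ r then
    (f (r - 1)).substXY (fun i => if i < j then varX r i else varX r (i + 1))
      (fun i => if i < j then varY r i else if i = j then varY r j + varY r (j + 1)
        else varY r (i + 1))
  else 0

/-- `φ_j^- f_r = f_{r-1}(X without X_j; Y_1, …, Y_{j-1} + Y_j, …, Y_r)` for `2 ≤ j ≤ r`, and `0`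
otherwise. -/
def phiMinus (j : ℕ) (f : Bimould) : Bimould := fun r =>
  if 2 ≤ j ∧ j ≤ r then
    (f (r - 1)).substXY (fun i => if i < j then varX r i else varX r (i + 1))
      (fun i => if i < j - 1 then varY r i else if i = j - 1 then varY r (j - 1) + varY r j
        else varY r (i + 1))
  else 0

/-- `D f_r = ∑_j ∂/∂X_j ∂/∂Y_j f_r`. -/
def opD (f : Bimould) : Bimould := fun r =>
  ∑ j : Fin r, MvPowerSeries.pderiv QA (Sum.inl j) (MvPowerSeries.pderiv QA (Sum.inr j) (f r))

/-- `W f_r = ∑_j (∂/∂X_j X_j + Y_j ∂/∂Y_j) f_r`. -/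
def opW (f : Bimould) : Bimould := fun r =>
  ∑ j : Fin r, (MvPowerSeries.pderiv QA (Sum.inl j) (MvPowerSeries.X (Sum.inl j) * f r)
    + MvPowerSeries.X (Sum.inr j) * MvPowerSeries.pderiv QA (Sum.inr j) (f r))

/-- `δ f_r = (X_1 Y_1 + ⋯ + X_r Y_r) f_r
  + ∑_j (-(X_j - X_{j+1} + Y_j) φ_j^+ / 2 - (X_{j-1} - X_j + Y_j) φ_j^- / 2
    + (φ_j^+ / 2)^2 - (φ_j^- / 2)^2) f_r`, where `X_{r+1} = 0`. -/
def opDelta (f : Bimould) : Bimould := fun r =>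
  (∑ j ∈ Finset.Icc 1 r, varX r j * varY r j) * f r
    + ∑ j ∈ Finset.Icc 1 r,
      (-((varX r j - varX r (j + 1) + varY r j) * ((1 / 2 : ℚ) • phiPlus j f r))
        - (varX r (j - 1) - varX r j + varY r j) * ((1 / 2 : ℚ) • phiMinus j f r)
        + (1 / 4 : ℚ) • phiPlus j (phiPlus j f) r
        - (1 / 4 : ℚ) • phiMinus j (phiMinus j f) r)

/-! ### Formal multiple Eisenstein series -/

/-- The ideal of `(ℚ⟨A⟩, *)` generated by all `σ(w) - w`. -/
def swapIdeal : Ideal QA := Ideal.span (Set.range fun u : QA => onWords swap u - u)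

/-- The `ℚ`-algebra of formal multiple Eisenstein series. -/
abbrev FMES : Type := QA ⧸ swapIdeal

/-- The projection `(ℚ⟨A⟩, *) → FMES`. -/
def proj : QA →ₐ[ℚ] FMES := Ideal.Quotient.mkₐ ℚ swapIdeal

/-- The formal multiple Eisenstein series of a word. -/
def eisWord (w : List Letter) : FMES := proj (word w)

/-- The single-indexed `G^f(k_1, …, k_r) = G^f[k_1, …, k_r; 0, …, 0]`. -/
def eis (ks : List ℕ+) : FMES := eisWord (ks.map fun k => (k, 0))

/-- The linear map `ℌ¹ → FMES`, `z_{k_1} ⋯ z_{k_r} ↦ G^f(k_1, …, k_r)`. -/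
def eisLin : H1 →ₗ[ℚ] FMES := wordLift eis

/-- The lower weight `d_1 + ⋯ + d_r` of a word. -/
def lwt (w : List Letter) : ℕ := (w.map Prod.snd).sum

/-- The lower weight filtration `Fil^lwt_d FMES`. -/
def filLwt (d : ℕ) : Submodule ℚ FMES :=
  Submodule.span ℚ {g | ∃ w : List Letter, lwt w ≤ d ∧ g = eisWord w}

end

end FormalMES

open FormalMES

/-! A derivation of (ℚ⟨A⟩, *) that commutes with the swap σ preserves `swapIdeal`: it maps σ(u) - u
to σ(du) - du, and the Leibniz rule does the rest. So the sl_2-action on FMES reduces to three facts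
on ℚ⟨A⟩: D, W and δ are derivations of the stuffle product, they satisfy the commutation relations,
and they commute with σ.

The first two facts are visible on words. Each operator is local, a sum over positions of
modifications of at most three consecutive letters. For such an operator the Leibniz rule amounts to
finitely many identities between letters (`LocalData.IsDer`), and its commutator with an operator
that changes one letter at a time can also be tested on letters (`LocalData.localOp_commutator`).
The third fact is visible on generating series. There σ is a linear substitution that exchanges
deleting an X with merging two neighbouring Y (`swap_phi`), and ∑ X_j Y_j, ∑ ∂/∂X_j ∂/∂Y_j and the
Euler operator are invariant under it. The two pictures are joined by extracting coefficients
(`onWords_opDelta`, `onWords_opD`, `onWords_opW`) and by naturality in the coefficients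
(`onWords_swap_comm`).

In lower weight zero, Fil^lwt_0 is the range of the algebra homomorphism `eisHom`, W multiplies by
the weight, and the terms of δ telescope to the stated formula. The operator D raises the d_i, so it
does not preserve the words with all d_i = 0, and closure holds only modulo the swap. It follows
from the identity `letter_mul_swapH1` in ℚ⟨A⟩: for f in ℌ¹, [1; 1] * σ(f) = σ(z_2 ⧢ f) + D σ(f).
Modulo the ideal σ disappears; f = 1 gives G^f[1; 1] = G^f(2), and then the identity is the formula
for D.

That identity is proved by removing last letters, by induction on the depth. Only words [1, …, 1;
d_1, …, d_r] occur in σ(f). Up to the factor d!, removing the last letter [1; d] from σ(f) gives σ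
of `dropFirst d f`, because σ puts X_1 - X_2 in place of Y_r. In terms of x and y, `dropFirst d` is
an iterated commutator of the removal of a leading y with the removal of a leading x, hence a
derivation of ⧢, and it lowers the depth by one. On the other side, merging a last letter with [1;
1] and raising it by D produce the same letters, with coefficients that agree for k = 1. -/

namespace FormalMES

noncomputable section

/-! ### Local operators on words -/

section LocalOperators

variable {L : Type*}

/-- The operator that sends `a f` to `h a f` for each letter `a`, and the empty word to `e`. -/
def headOp (h : L → Words L →ₗ[ℚ] Words L) (e : Words L) : Words L →ₗ[ℚ] Words L :=
  wordLift fun w => match w with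
    | [] => e
    | a :: w => h a (word w)

theorem headOp_nil (h : L → Words L →ₗ[ℚ] Words L) (e : Words L) : headOp h e (word []) = e :=
  wordLift_word _ _

theorem headOp_consL (h : L → Words L →ₗ[ℚ] Words L) (e : Words L) (a : L) (f : Words L) :
    headOp h e (consL a f) = h a f := by
  have : (headOp h e).comp (consL a) = h a := words_hom_ext fun w => by
    rw [LinearMap.comp_apply, consL_word]
    exact wordLift_word _ _
  exact LinearMap.congr_fun this f

/-- The values on words of `localOp`. -/
def localWord (P : Words L →ₗ[ℚ] Words L) : List L → Words L
  | [] => 0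
  | a :: w => consL a (localWord P w) + P (word (a :: w))

/-- The operator `a_1 ⋯ a_r ↦ ∑_j a_1 ⋯ a_{j-1} P(a_j ⋯ a_r)`. -/
def localOp (P : Words L →ₗ[ℚ] Words L) : Words L →ₗ[ℚ] Words L := wordLift (localWord P)

theorem localOp_nil (P : Words L →ₗ[ℚ] Words L) : localOp P (word []) = 0 :=
  wordLift_word _ _

theorem localOp_consL (P : Words L →ₗ[ℚ] Words L) (a : L) (f : Words L) :
    localOp P (consL a f) = consL a (localOp P f) + P (consL a f) := by
  have : (localOp P).comp (consL a) = (consL a).comp (localOp P) + P.comp (consL a) :=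
    words_hom_ext fun w => by simp [localOp, consL_word, wordLift_word, localWord]
  exact LinearMap.congr_fun this f

/-- Prepending a linear combination of letters. -/
def prepend : (L →₀ ℚ) →ₗ[ℚ] Words L →ₗ[ℚ] Words L := Finsupp.linearCombination ℚ consL

theorem prepend_single (a : L) (c : ℚ) : prepend (Finsupp.single a c) = c • consL a :=
  Finsupp.linearCombination_single ℚ c a

variable [AddCommSemigroup L]

/-- The product `⋄` with the letter `b`, on linear combinations of letters. -/
def diamond (b : L) : (L →₀ ℚ) →ₗ[ℚ] (L →₀ ℚ) := Finsupp.lmapDomain ℚ ℚ (· + b)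

theorem diamond_single (a b : L) (c : ℚ) :
    diamond b (Finsupp.single a c) = Finsupp.single (a + b) c := by
  simp [diamond]

theorem consL_mul_consL (a b : L) (f g : Words L) :
    consL a f * consL b g = consL a (f * consL b g) + consL b (consL a f * g)
      + consL (a + b) (f * g) :=
  stuffle_cons_cons a b f g

theorem prepend_mul_consL (l : L →₀ ℚ) (b : L) (f g : Words L) :
    prepend l f * consL b g = prepend l (f * consL b g) + consL b (prepend l f * g)
      + prepend (diamond b l) (f * g) := by
  induction l using Finsupp.induction_linear with
  | zero => simp
  | add l m hl hm =>
    simp only [map_add, LinearMap.add_apply, add_mul, hl, hm]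
    abel
  | single a c =>
    simp only [prepend_single, diamond_single, LinearMap.smul_apply, smul_mul_assoc,
      consL_mul_consL, smul_add, map_smul]

theorem headOp_mul (h : L → Words L →ₗ[ℚ] Words L) (e : Words L) (a b : L) (f g : Words L) :
    headOp h e (consL a f * consL b g) = h a (f * consL b g) + h b (consL a f * g)
      + h (a + b) (f * g) := by
  rw [consL_mul_consL, map_add, map_add, headOp_consL, headOp_consL, headOp_consL]

/-- The letters produced by a local operator from at most three consecutive letters, and the
numbers that it produces from the last letter and from the last two letters. -/
structure LocalData (L : Type*) where
  one : L → L →₀ ℚ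
  two : L → L → L →₀ ℚ
  three : L → L → L → L →₀ ℚ
  endOne : L → ℚ
  endTwo : L → L → ℚ

/-- The contribution of the initial letters. -/
def LocalData.head (X : LocalData L) : Words L →ₗ[ℚ] Words L :=
  headOp (fun a => prepend (X.one a) + headOp (fun b => prepend (X.two a b) +
    headOp (fun c => prepend (X.three a b c)) (X.endTwo a b • 1)) (X.endOne a • 1)) 0

/-- The identities between letters that make a local operator a derivation. -/
structure LocalData.IsDer (X : LocalData L) : Prop where
  one_one : ∀ a b, X.one (a + b) + X.two a b + X.two b a
    = diamond b (X.one a) + diamond a (X.one b)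
  one_two : ∀ a b c, X.two (a + b) c + X.two b (a + c) + X.three a b c + X.three b a c
    + X.three b c a = diamond a (X.two b c)
  one_three : ∀ a b c d, X.three (a + b) c d + X.three b (a + c) d + X.three b c (a + d)
    = diamond a (X.three b c d)
  two_two : ∀ a b c d, X.two (a + c) (b + d) + X.three (a + c) b d + X.three (a + c) d b
    + X.three a (b + c) d + X.three c (a + d) b + X.three a c (b + d) + X.three c a (b + d) = 0
  two_three : ∀ a b c d e, X.three (a + c) (b + d) e + X.three (a + c) d (b + e)
    + X.three c (a + d) (b + e) = 0
  three_three : ∀ a b c d e f, X.three (a + d) (b + e) (c + f) = 0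
  end_one_one : ∀ a b, X.endOne (a + b) + X.endTwo a b + X.endTwo b a = 0
  end_one_two : ∀ a b c, X.endTwo (a + b) c + X.endTwo b (a + c) = 0
  end_two_two : ∀ a b c d, X.endTwo (a + c) (b + d) = 0

end LocalOperators

/-! ### Leibniz rule and commutators of local operators -/

section LocalDerivations

variable {L : Type*}

theorem prepend_congr {l m : L →₀ ℚ} (h : l = m) (f : Words L) : prepend l f = prepend m f := by
  rw [h]

variable [AddCommSemigroup L]

theorem headOp_one (h : L → Words L →ₗ[ℚ] Words L) (e : Words L) : headOp h e 1 = e :=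
  headOp_nil h e

theorem consL_mul_prepend (l : L →₀ ℚ) (b : L) (f g : Words L) :
    consL b g * prepend l f = prepend l (consL b g * f) + consL b (g * prepend l f)
      + prepend (diamond b l) (g * f) := by
  rw [mul_comm, prepend_mul_consL, mul_comm f, mul_comm _ g, mul_comm f]

-- Let d = `localOp X.head` and P = `X.head`, so d(a w) = a d(w) + P(a w). Expanding d(a w * b v) by
-- the stuffle recursion and applying the Leibniz rule to shorter words leaves exactly this identity
-- for P; the subtracted terms are those already produced behind a leading letter. It splits
-- according to the number of initial letters consumed from each word, and each piece is one field
-- of `LocalData.IsDer`.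
set_option maxHeartbeats 1600000 in
theorem LocalData.IsDer.head_mul {X : LocalData L} (hX : X.IsDer) (a b : L) (w v : List L) :
    X.head (consL a (word w) * consL b (word v)) =
      X.head (consL a (word w)) * consL b (word v) - consL b (X.head (consL a (word w)) * word v)
      + (consL a (word w) * X.head (consL b (word v))
        - consL a (word w * X.head (consL b (word v)))) := by
  have e11 := prepend_congr (hX.one_one a b)
  have e12 := fun b' => prepend_congr (hX.one_two a b b')
  have e21 := fun a' => prepend_congr (hX.one_two b a a')
  have e13 := fun b' b'' => prepend_congr (hX.one_three a b b' b'')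
  have e31 := fun a' a'' => prepend_congr (hX.one_three b a a' a'')
  have e22 := fun a' b' => prepend_congr (hX.two_two a a' b b')
  have e23 := fun a' b' b'' => prepend_congr (hX.two_three a a' b b' b'')
  have e32 := fun b' a' a'' => prepend_congr (hX.two_three b b' a a' a'')
  have e33 := fun a' a'' b' b'' => prepend_congr (hX.three_three a a' a'' b b' b'')
  have z11 := congrArg (· • (1 : Words L)) (hX.end_one_one a b)
  have z12 := fun b' => congrArg (· • (1 : Words L)) (hX.end_one_two a b b')
  have z21 := fun a' => congrArg (· • (1 : Words L)) (hX.end_one_two b a a')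
  have z22 := fun a' b' => congrArg (· • (1 : Words L)) (hX.end_two_two a a' b b')
  simp only [map_add, LinearMap.add_apply, map_zero, LinearMap.zero_apply, add_comm b a,
    add_smul, zero_smul] at e11 e12 e21 e13 e31 e22 e23 e32 e33 z11 z12 z21 z22
  -- The head sees at most three letters, so only tails of length 0, 1 and at least 2 have to be
  -- distinguished.
  rcases w with _ | ⟨a', _ | ⟨a'', w⟩⟩ <;> rcases v with _ | ⟨b', _ | ⟨b'', v⟩⟩
  all_goals
    simp only [← consL_word, ← words_one_def]
    unfold LocalData.head
    simp only [headOp_mul, headOp_consL, headOp_one, LinearMap.add_apply, one_mul, mul_one,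
      add_mul, mul_add, prepend_mul_consL, consL_mul_prepend, map_add, map_smul, smul_mul_assoc,
      mul_smul_comm]
  · linear_combination (norm := module) e11 1 + z11
  · linear_combination (norm := module) e11 (consL b' 1) + e12 b' 1 + z12 b'
  · linear_combination (norm := module) e11 (consL b' (consL b'' (word v)))
      + e12 b' (consL b'' (word v)) + e13 b' b'' (word v)
  · have h2 := e21 a'
    have h3 := z21 a'
    simp only [add_comm b a'] at *
    linear_combination (norm := module) e11 (consL a' 1) + h2 1 + h3
  · have h2 := e21 a'
    have h3 := z21 a'
    have h4 := e22 a' b'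
    have h5 := z22 a' b'
    simp only [add_comm b a'] at *
    linear_combination (norm := module) e11 (consL a' 1 * consL b' 1) + e12 b' (consL a' 1)
       + h2 (consL b' 1) + h4 1 + h5
  · have h2 := e21 a'
    have h4 := e22 a' b'
    simp only [add_comm b a'] at *
    linear_combination (norm := module) e11 (consL a' 1 * consL b' (consL b'' (word v)))
       + e12 b' (consL a' 1 * consL b'' (word v)) + h2 (consL b' (consL b'' (word v)))
       + e13 b' b'' (consL a' 1 * word v) + h4 (consL b'' (word v)) + e23 a' b' b'' (word v)
  · have h2 := e21 a'
    have h3 := e31 a' a''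
    simp only [add_comm b a', add_comm b a''] at *
    linear_combination (norm := module) e11 (consL a' (consL a'' (word w)))
      + h2 (consL a'' (word w)) + h3 (word w)
  · have h2 := e21 a'
    have h3 := e31 a' a''
    have h4 := e22 a' b'
    have h5 := e32 b' a' a''
    simp only [add_comm b a', add_comm b a'', add_comm b' a', add_comm b' a''] at *
    linear_combination (norm := module) e11 (consL a' (consL a'' (word w)) * consL b' 1)
      + e12 b' (consL a' (consL a'' (word w))) + h2 (consL a'' (word w) * consL b' 1)
      + h3 (word w * consL b' 1) + h4 (consL a'' (word w)) + h5 (word w)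
  · have h2 := e21 a'
    have h3 := e31 a' a''
    have h4 := e22 a' b'
    have h5 := e32 b' a' a''
    simp only [add_comm b a', add_comm b a'', add_comm b' a', add_comm b' a''] at *
    linear_combination (norm := module)
      e11 (consL a' (consL a'' (word w)) * consL b' (consL b'' (word v)))
      + e12 b' (consL a' (consL a'' (word w)) * consL b'' (word v))
      + e13 b' b'' (consL a' (consL a'' (word w)) * word v)
      + h2 (consL a'' (word w) * consL b' (consL b'' (word v)))
      + h3 (word w * consL b' (consL b'' (word v))) + h4 (consL a'' (word w) * consL b'' (word v))
      + e23 a' b' b'' (consL a'' (word w) * word v) + h5 (word w * consL b'' (word v))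
      + e33 a' a'' b' b'' (word w * word v)

/-- A local operator whose local data satisfy the identities `LocalData.IsDer` is a derivation. -/
theorem LocalData.IsDer.localOp_mul_word {X : LocalData L} (hX : X.IsDer) : ∀ w v : List L,
    localOp X.head (word w * word v) =
      localOp X.head (word w) * word v + word w * localOp X.head (word v)
  | [], v => by rw [← words_one_def, one_mul, words_one_def, localOp_nil, ← words_one_def]; simp
  | a :: w, [] => by
      rw [← words_one_def, mul_one, words_one_def, localOp_nil, ← words_one_def]; simp
  | a :: w, b :: v => by
      have h1 := hX.localOp_mul_word w (b :: v)
      have h2 := hX.localOp_mul_word (a :: w) v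
      have h3 := hX.localOp_mul_word w v
      have h4 := hX.head_mul a b w v
      simp only [← consL_word] at *
      generalize word w = w at *
      generalize word v = v at *
      rw [consL_mul_consL] at h4 ⊢
      simp only [map_add, localOp_consL, h1, h2, h3, mul_add, add_mul, consL_mul_consL] at h4 ⊢
      linear_combination h4
  termination_by w v => w.length + v.length

theorem LocalData.IsDer.localOp_mul {X : LocalData L} (hX : X.IsDer) (f g : Words L) :
    localOp X.head (f * g) = localOp X.head f * g + f * localOp X.head g := by
  have : (stuffle.compr₂ (localOp X.head) : Words L →ₗ[ℚ] Words L →ₗ[ℚ] Words L) =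
      stuffle.compl₁₂ (localOp X.head) LinearMap.id
        + stuffle.compl₁₂ LinearMap.id (localOp X.head) :=
    words_hom_ext fun w => words_hom_ext fun v => hX.localOp_mul_word w v
  exact LinearMap.congr_fun (LinearMap.congr_fun this f) g

/-- The derivation of `(ℚ⟨L⟩, *)` with given local data. -/
def LocalData.IsDer.derivation {X : LocalData L} (hX : X.IsDer) :
    Derivation ℚ (Words L) (Words L) :=
  Derivation.mk' (localOp X.head) fun f g => by
    rw [hX.localOp_mul, smul_eq_mul, smul_eq_mul, add_comm, mul_comm g]

/-- The commutator of a local operator with a derivation that changes one letter at a time. -/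
theorem LocalData.localOp_commutator {X Y Z : LocalData L} (r : ℚ) (c : L → ℚ) (g : L → L)
    (y : (L →₀ ℚ) →ₗ[ℚ] (L →₀ ℚ)) (hy : ∀ a, y (Finsupp.single a 1) = c a • Finsupp.single (g a) 1)
    (hone : ∀ a, Y.one a = c a • Finsupp.single (g a) 1) (htwo : ∀ a b, Y.two a b = 0)
    (hthree : ∀ a b d, Y.three a b d = 0) (hend : ∀ a, Y.endOne a = 0)
    (hend' : ∀ a b, Y.endTwo a b = 0)
    (h1 : ∀ a, c a • X.one (g a) = y (X.one a) + r • Z.one a)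
    (h2 : ∀ a b, c a • X.two (g a) b + c b • X.two a (g b) = y (X.two a b) + r • Z.two a b)
    (h3 : ∀ a b d, c a • X.three (g a) b d + c b • X.three a (g b) d + c d • X.three a b (g d)
      = y (X.three a b d) + r • Z.three a b d)
    (h4 : ∀ a, c a * X.endOne (g a) = r * Z.endOne a)
    (h5 : ∀ a b, c a * X.endTwo (g a) b + c b * X.endTwo a (g b) = r * Z.endTwo a b)
    (f : Words L) :
    localOp X.head (localOp Y.head f) = localOp Y.head (localOp X.head f)
      + r • localOp Z.head f := by
  have hYh : ∀ (a : L) (f : Words L), Y.head (consL a f) = c a • consL (g a) f := by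
    intro a f
    have : (Y.head).comp (consL a) = c a • consL (g a) := words_hom_ext fun w => by
      rcases w with _ | ⟨b, _ | ⟨d, w⟩⟩ <;>
        simp [← consL_word, LocalData.head, headOp_consL, headOp_nil, hone, htwo, hthree, hend,
          hend', prepend_single]
    exact LinearMap.congr_fun this f
  have hYp : ∀ (l : L →₀ ℚ) (f : Words L), localOp Y.head (prepend l f) =
      prepend (y l) f + prepend l (localOp Y.head f) := by
    intro l f
    induction l using Finsupp.induction_linear with
    | zero => simp
    | add l m hl hm => simp only [map_add, LinearMap.add_apply, hl, hm]; abel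
    | single a q =>
      have : Finsupp.single a q = q • Finsupp.single a (1 : ℚ) := by simp
      rw [this]
      simp only [map_smul, hy, LinearMap.smul_apply, prepend_single, one_smul, localOp_consL, hYh]
      module
  have hY1 : localOp Y.head (1 : Words L) = 0 := localOp_nil _
  have hX1 : localOp X.head (1 : Words L) = 0 := localOp_nil _
  have hZ1 : localOp Z.head (1 : Words L) = 0 := localOp_nil _
  -- Behind the first letter the commutator is given by induction, so only the heads have to be
  -- compared; `h1`–`h5` do this according to the letters consumed.
  have key : ∀ (a : L) (w : List L), X.head (localOp Y.head (consL a (word w))) =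
      localOp Y.head (X.head (consL a (word w))) + r • Z.head (consL a (word w)) := by
    intro a w
    have k1 := fun a => prepend_congr (h1 a)
    have k2 := fun a b => prepend_congr (h2 a b)
    have k3 := fun a b d => prepend_congr (h3 a b d)
    have k4 := fun a => congrArg (· • (1 : Words L)) (h4 a)
    have k5 := fun a b => congrArg (· • (1 : Words L)) (h5 a b)
    simp only [map_add, map_smul, LinearMap.add_apply, LinearMap.smul_apply, add_smul,
      mul_smul] at k1 k2 k3 k4 k5
    have hYc := localOp_consL Y.head
    simp only [hYh] at hYc
    clear hX1 hZ1
    generalize localOp Y.head = E at *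
    rcases w with _ | ⟨b, _ | ⟨d, w⟩⟩ <;>
      simp only [← consL_word, ← words_one_def] <;> unfold LocalData.head <;>
      simp only [headOp_consL, headOp_one, LinearMap.add_apply, map_add, map_smul, hYp, hY1, hYc,
        smul_zero, map_zero, add_zero]
    · linear_combination (norm := module) k1 a 1 + k4 a
    · linear_combination (norm := module) k1 a (consL b 1) + k2 a b 1 + k5 a b
    · linear_combination (norm := module) k1 a (consL b (consL d (word w)))
        + k2 a b (consL d (word w)) + k3 a b d (word w)
  have hw : (localOp X.head).comp (localOp Y.head) = (localOp Y.head).comp (localOp X.head)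
      + r • localOp Z.head := by
    refine words_hom_ext fun w => ?_
    induction w with
    | nil => simp [← words_one_def, hX1, hY1, hZ1]
    | cons a w ih =>
      have hk := key a w
      simp only [← consL_word, LinearMap.comp_apply, LinearMap.add_apply,
        LinearMap.smul_apply] at ih ⊢
      generalize word w = f at *
      have e1 : localOp X.head (localOp Y.head (consL a f)) =
          consL a (localOp X.head (localOp Y.head f)) + c a • consL (g a) (localOp X.head f)
            + X.head (localOp Y.head (consL a f)) := by
        simp only [localOp_consL, hYh, map_add, map_smul]
        module
      rw [e1, hk, ih]
      simp only [localOp_consL, hYh, map_add, map_smul]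
      module
  exact LinearMap.congr_fun hw f

end LocalDerivations

/-! ### The derivations D, W, δ on words and their commutators -/

section ConcreteData

/-- The letter `[n + 1; d]`, as a linear combination of letters. -/
def letterAt (n d : ℕ) : Letter →₀ ℚ := Finsupp.single (n.succPNat, d) 1

/-- The letter `[n; d]`, which is `0` for `n = 0`. -/
def lowerAt (n d : ℕ) : Letter →₀ ℚ := if n = 0 then 0 else letterAt (n - 1) d

/-- The local data of `D`. -/
def dataD : LocalData Letter where
  one a := (a.1 : ℚ) • Finsupp.single (a.1 + 1, a.2 + 1) 1
  two _ _ := 0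
  three _ _ _ := 0
  endOne _ := 0
  endTwo _ _ := 0

/-- The local data of `W`. -/
def dataW : LocalData Letter where
  one a := ((a.1 : ℚ) + a.2) • Finsupp.single a 1
  two _ _ := 0
  three _ _ _ := 0
  endOne _ := 0
  endTwo _ _ := 0

/-- The local data of `δ`. -/
def dataDelta : LocalData Letter where
  one a := (a.2 : ℚ) • lowerAt a.1.natPred (a.2 - 1)
  -- Here `natPred` is k - 1. A factor equal to the deleted variable X requires k = 2 at the deleted
  -- place, any other factor requires k = 1. The first two summands are the terms X_j, X_{j+1}, Y_j
  -- in front of φ_j^+; the last two are X_{j+1}, then X_j and Y_{j+1}, in front of φ_{j+1}^-.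
  two a b :=
    (if a.1.natPred = 1 then -(1 / 2 : ℚ) • letterAt b.1.natPred (a.2 + b.2) else 0)
      + (if a.1.natPred = 0 then (1 / 2 : ℚ) • lowerAt b.1.natPred (a.2 + b.2)
          - (a.2 / 2 : ℚ) • letterAt b.1.natPred (a.2 - 1 + b.2) else 0)
      + (if b.1.natPred = 1 then (1 / 2 : ℚ) • letterAt a.1.natPred (a.2 + b.2) else 0)
      - (if b.1.natPred = 0 then (1 / 2 : ℚ) • lowerAt a.1.natPred (a.2 + b.2)
          + (b.2 / 2 : ℚ) • letterAt a.1.natPred (a.2 + (b.2 - 1)) else 0)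
  three a b c :=
    (if a.1.natPred = 0 ∧ b.1.natPred = 0 then
        (1 / 4 : ℚ) • letterAt c.1.natPred (a.2 + b.2 + c.2) else 0)
      - (if b.1.natPred = 0 ∧ c.1.natPred = 0 then
        (1 / 4 : ℚ) • letterAt a.1.natPred (a.2 + b.2 + c.2) else 0)
  -- φ_r^+ loses both X_r and Y_r, so the factor X_r + Y_r has to account for the whole last letter,
  -- which is [2; 0] or [1; 1].
  endOne a := if (a.1.natPred = 1 ∧ a.2 = 0) ∨ (a.1.natPred = 0 ∧ a.2 = 1) then -(1 / 2) else 0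
  endTwo a b := if (a.1.natPred = 0 ∧ a.2 = 0) ∧ (b.1.natPred = 0 ∧ b.2 = 0) then 1 / 4 else 0

theorem isDer_dataD : dataD.IsDer where
  one_one a b := by
    simp only [dataD, map_smul, diamond_single, add_zero, Prod.fst_add,
      Prod.snd_add, PNat.add_coe, Nat.cast_add]
    have : (b.1 + 1, b.2 + 1) + a = (a.1 + b.1 + 1, a.2 + b.2 + 1) := by
      ext <;> simp <;> ring
    rw [this]
    have : (a.1 + 1, a.2 + 1) + b = (a.1 + b.1 + 1, a.2 + b.2 + 1) := by
      ext <;> simp <;> ring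
    rw [this]
    module
  one_two _ _ _ := by simp [dataD]
  one_three _ _ _ _ := by simp [dataD]
  two_two _ _ _ _ := by simp [dataD]
  two_three _ _ _ _ _ := by simp [dataD]
  three_three _ _ _ _ _ _ := by simp [dataD]
  end_one_one _ _ := by simp [dataD]
  end_one_two _ _ _ := by simp [dataD]
  end_two_two _ _ _ _ := by simp [dataD]

theorem isDer_dataW : dataW.IsDer where
  one_one a b := by
    simp only [dataW, map_smul, diamond_single, add_zero, Prod.fst_add, Prod.snd_add,
      PNat.add_coe, Nat.cast_add, add_comm b a]
    module
  one_two _ _ _ := by simp [dataW]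
  one_three _ _ _ _ := by simp [dataW]
  two_two _ _ _ _ := by simp [dataW]
  two_three _ _ _ _ _ := by simp [dataW]
  three_three _ _ _ _ _ _ := by simp [dataW]
  end_one_one _ _ := by simp [dataW]
  end_one_two _ _ _ := by simp [dataW]
  end_two_two _ _ _ _ := by simp [dataW]

theorem natPred_add (a b : ℕ+) : (a + b).natPred = a.natPred + b.natPred + 1 := by
  have := PNat.natPred_add_one a
  have := PNat.natPred_add_one b
  have := PNat.natPred_add_one (a + b)
  have := PNat.add_coe a b
  omega

theorem diamond_letterAt (n d : ℕ) (b : Letter) :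
    diamond b (letterAt n d) = letterAt (n + b.1.natPred + 1) (d + b.2) := by
  unfold letterAt
  rw [diamond_single]
  congr 1
  refine Prod.ext (PNat.natPred_injective ?_) rfl
  simp [natPred_add]

theorem lowerAt_zero (d : ℕ) : lowerAt 0 d = 0 := rfl

theorem lowerAt_succ (n d : ℕ) : lowerAt (n + 1) d = letterAt n d := rfl

theorem dataDelta_one_one (a b : Letter) :
    dataDelta.one (a + b) + dataDelta.two a b + dataDelta.two b a
      = diamond b (dataDelta.one a) + diamond a (dataDelta.one b) := by
  obtain ⟨k, c⟩ := a
  obtain ⟨l, d⟩ := b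
  simp only [dataDelta, natPred_add, Prod.fst_add, Prod.snd_add, map_smul, lowerAt_succ]
  generalize hn : k.natPred = n
  generalize hm : l.natPred = m
  have h1 : ∀ n d, lowerAt (n + 2) d = letterAt (n + 1) d := fun _ _ => rfl
  have h2 : ∀ d, lowerAt 1 d = letterAt 0 d := fun _ => rfl
  -- The branches of `dataDelta` only distinguish k = 1, k = 2 and k ≥ 3, and the truncated d - 1
  -- only d = 0 and d > 0.
  rcases n with _ | _ | n <;> rcases m with _ | _ | m <;> rcases c with _ | c <;>
    rcases d with _ | d <;>
    simp [lowerAt_zero, h1, h2, diamond_letterAt, hn, hm] <;> ring_nf <;> module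

theorem dataDelta_one_two (a b c : Letter) :
    dataDelta.two (a + b) c + dataDelta.two b (a + c) + dataDelta.three a b c
      + dataDelta.three b a c + dataDelta.three b c a = diamond a (dataDelta.two b c) := by
  obtain ⟨k, x⟩ := a
  obtain ⟨l, y⟩ := b
  obtain ⟨q, z⟩ := c
  have h1 : ∀ n d, lowerAt (n + 2) d = letterAt (n + 1) d := fun _ _ => rfl
  have h2 : ∀ d, lowerAt 1 d = letterAt 0 d := fun _ => rfl
  simp only [dataDelta, natPred_add, Prod.fst_add, Prod.snd_add, map_smul, map_sub, map_add,
    apply_ite (diamond _), map_zero, diamond_letterAt, lowerAt_succ]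
  generalize hn : k.natPred = n
  generalize hm : l.natPred = m
  generalize hp : q.natPred = p
  generalize y - 1 = y'
  generalize z - 1 = z'
  rcases n with _ | _ | n <;> rcases m with _ | _ | m <;> rcases p with _ | _ | p <;>
    simp [lowerAt_zero, h1, h2, diamond_letterAt, hn] <;> ring_nf <;> module

theorem isDer_dataDelta : dataDelta.IsDer where
  one_one := dataDelta_one_one
  one_two := dataDelta_one_two
  one_three a b c d := by
    simp [dataDelta, natPred_add, apply_ite (diamond _), diamond_letterAt]
    split_ifs <;> (try ring_nf) <;> module
  two_two a b c d := by
    simp only [dataDelta, natPred_add, Prod.fst_add, Prod.snd_add]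
    generalize a.1.natPred = k
    generalize b.1.natPred = l
    generalize c.1.natPred = m
    generalize d.1.natPred = n
    rcases k with _ | k <;> rcases l with _ | l <;> rcases m with _ | m <;> rcases n with _ | n <;>
      simp <;> (try ring_nf) <;> module
  two_three _ _ _ _ _ := by simp [dataDelta, natPred_add]
  three_three _ _ _ _ _ _ := by simp [dataDelta, natPred_add]
  end_one_one a b := by
    simp only [dataDelta, natPred_add, Prod.fst_add, Prod.snd_add]
    generalize a.1.natPred = k
    generalize b.1.natPred = l
    rcases k with _ | k <;> rcases l with _ | l <;> rcases a.2 with _ | c <;>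
      rcases b.2 with _ | d <;> simp
    norm_num
  end_one_two _ _ _ := by simp [dataDelta, natPred_add]
  end_two_two _ _ _ _ := by simp [dataDelta, natPred_add]

/-- The derivation `D` of `(ℚ⟨A⟩, *)`. -/
def derD : Derivation ℚ QA QA := isDer_dataD.derivation

/-- The derivation `W` of `(ℚ⟨A⟩, *)`. -/
def derW : Derivation ℚ QA QA := isDer_dataW.derivation

/-- The derivation `δ` of `(ℚ⟨A⟩, *)`. -/
def derDelta : Derivation ℚ QA QA := isDer_dataDelta.derivation

/-- Raising both entries of a letter. -/
def raiseLetter : (Letter →₀ ℚ) →ₗ[ℚ] (Letter →₀ ℚ) :=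
  Finsupp.linearCombination ℚ fun a : Letter => (a.1 : ℚ) • Finsupp.single (a.1 + 1, a.2 + 1) 1

/-- Multiplying each letter with its weight. -/
def weightLetter : (Letter →₀ ℚ) →ₗ[ℚ] (Letter →₀ ℚ) :=
  Finsupp.linearCombination ℚ fun a : Letter => ((a.1 : ℚ) + a.2) • Finsupp.single a 1

theorem raiseLetter_letterAt (n d : ℕ) :
    raiseLetter (letterAt n d) = ((n : ℚ) + 1) • letterAt (n + 1) (d + 1) := by
  unfold raiseLetter letterAt
  rw [Finsupp.linearCombination_single, one_smul]
  simp
  rfl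

theorem weightLetter_letterAt (n d : ℕ) :
    weightLetter (letterAt n d) = ((n : ℚ) + 1 + d) • letterAt n d := by
  unfold weightLetter letterAt
  rw [Finsupp.linearCombination_single, one_smul]
  simp

theorem natPred_add_one_pnat (a : ℕ+) : (a + 1).natPred = a.natPred + 1 := by
  rw [natPred_add]; rfl

theorem cast_eq_natPred (a : ℕ+) : (a : ℚ) = a.natPred + 1 := by
  exact_mod_cast (PNat.natPred_add_one a).symm

theorem single_eq_letterAt (k : ℕ+) (d : ℕ) :
    (Finsupp.single (k, d) 1 : Letter →₀ ℚ) = letterAt k.natPred d := by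
  simp [letterAt]

theorem derW_derD (f : QA) : derW (derD f) = derD (derW f) + (2 : ℚ) • derD f :=
  LocalData.localOp_commutator (X := dataW) (Y := dataD) (Z := dataD) 2 (fun a => (a.1 : ℚ))
    (fun a => (a.1 + 1, a.2 + 1)) raiseLetter
    (fun a => by simp [raiseLetter]) (fun _ => rfl) (fun _ _ => rfl) (fun _ _ _ => rfl)
    (fun _ => rfl) (fun _ _ => rfl)
    (fun ⟨k, d⟩ => by
      simp only [dataW, dataD, single_eq_letterAt, natPred_add_one_pnat, map_smul,
        raiseLetter_letterAt, cast_eq_natPred, Nat.cast_add, Nat.cast_one]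
      module)
    (fun _ _ => by simp [dataW, dataD]) (fun _ _ _ => by simp [dataW, dataD])
    (fun _ => by simp [dataW, dataD]) (fun _ _ => by simp [dataW, dataD]) f

/-- In `LocalData.localOp_commutator` the operator applied first on the left side must change one
letter at a time. This is W here, so δ takes the role of the arbitrary local operator. -/
theorem derDelta_derW (f : QA) : derDelta (derW f) = derW (derDelta f) + (2 : ℚ) • derDelta f :=
  LocalData.localOp_commutator (X := dataDelta) (Y := dataW) (Z := dataDelta) 2
    (fun a => (a.1 : ℚ) + a.2) id weightLetter
    (fun a => by simp [weightLetter]) (fun _ => rfl) (fun _ _ => rfl) (fun _ _ _ => rfl)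
    (fun _ => rfl) (fun _ _ => rfl)
    (fun ⟨k, c⟩ => by
      simp only [dataDelta, id, map_smul, cast_eq_natPred]
      generalize k.natPred = n
      rcases n with _ | n <;> rcases c with _ | c <;>
        simp [lowerAt_zero, lowerAt_succ, weightLetter_letterAt]
      module)
    (fun ⟨k, c⟩ ⟨l, d⟩ => by
      have h1 : ∀ n d, lowerAt (n + 1 + 1) d = letterAt (n + 1) d := fun _ _ => rfl
      have h2 : ∀ d, lowerAt 1 d = letterAt 0 d := fun _ => rfl
      simp only [dataDelta, id, cast_eq_natPred]
      generalize k.natPred = n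
      generalize l.natPred = m
      rcases n with _ | _ | n <;> rcases m with _ | _ | m <;> rcases c with _ | c <;>
        rcases d with _ | d <;>
        simp [lowerAt_zero, h1, h2, weightLetter_letterAt] <;> module)
    (fun ⟨k, c⟩ ⟨l, d⟩ ⟨q, e⟩ => by
      simp only [dataDelta, id, cast_eq_natPred]
      generalize k.natPred = n
      generalize l.natPred = m
      generalize q.natPred = p
      rcases n with _ | n <;> rcases m with _ | m <;> rcases p with _ | p <;>
        simp [weightLetter_letterAt] <;> module)
    (fun ⟨k, c⟩ => by
      simp only [dataDelta, id, cast_eq_natPred]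
      split_ifs with h
      · rcases h with ⟨h, h'⟩ | ⟨h, h'⟩ <;> simp [h, h'] <;> norm_num
      · simp)
    (fun ⟨k, c⟩ ⟨l, d⟩ => by
      simp only [dataDelta, id, cast_eq_natPred]
      split_ifs with h
      · obtain ⟨⟨h, h'⟩, h1, h2⟩ := h
        simp [h, h', h1, h2]; norm_num
      · simp) f

theorem derDelta_derD (f : QA) : derDelta (derD f) = derD (derDelta f) + (1 : ℚ) • derW f :=
  LocalData.localOp_commutator (X := dataDelta) (Y := dataD) (Z := dataW) 1
    (fun a => (a.1 : ℚ)) (fun a => (a.1 + 1, a.2 + 1)) raiseLetter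
    (fun a => by simp [raiseLetter]) (fun _ => rfl) (fun _ _ => rfl) (fun _ _ _ => rfl)
    (fun _ => rfl) (fun _ _ => rfl)
    (fun ⟨k, c⟩ => by
      simp only [dataDelta, dataW, map_smul, cast_eq_natPred, single_eq_letterAt,
        natPred_add_one_pnat]
      generalize k.natPred = n
      rcases n with _ | n <;> rcases c with _ | c <;>
        simp [lowerAt_zero, lowerAt_succ, raiseLetter_letterAt] <;> module)
    (fun ⟨k, c⟩ ⟨l, d⟩ => by
      have h1 : ∀ n d, lowerAt (n + 1 + 1) d = letterAt (n + 1) d := fun _ _ => rfl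
      have h2 : ∀ d, lowerAt 1 d = letterAt 0 d := fun _ => rfl
      simp only [dataDelta, dataW, cast_eq_natPred, natPred_add_one_pnat]
      generalize k.natPred = n
      generalize l.natPred = m
      rcases n with _ | _ | n <;> rcases m with _ | _ | m <;> rcases c with _ | c <;>
        rcases d with _ | d <;>
        simp [lowerAt_zero, h1, h2, raiseLetter_letterAt] <;> (try ring_nf) <;> module)
    (fun ⟨k, c⟩ ⟨l, d⟩ ⟨q, e⟩ => by
      simp only [dataDelta, dataW, cast_eq_natPred, natPred_add_one_pnat]
      generalize k.natPred = n
      generalize l.natPred = m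
      generalize q.natPred = p
      rcases n with _ | n <;> rcases m with _ | m <;> rcases p with _ | p <;>
        simp [raiseLetter_letterAt] <;> (try ring_nf) <;> module)
    (fun _ => by simp [dataDelta, dataW, natPred_add_one_pnat])
    (fun _ _ => by simp [dataDelta, dataW]) f

end ConcreteData

/-! ### Chain rule, and coefficientwise linear maps on power series -/

section PowerSeries

open MvPowerSeries

/-- The chain rule on polynomials, from which `pderiv_subst` follows by density. -/
theorem pderiv_aeval {σ τ R : Type*} [CommRing R] [Fintype τ] (a : τ → MvPowerSeries σ R) (s : σ)
    (p : MvPolynomial τ R) : pderiv R s (MvPolynomial.aeval a p) =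
      ∑ t, pderiv R s (a t) * MvPolynomial.aeval a (MvPolynomial.pderiv t p) := by
  classical
  induction p using MvPolynomial.induction_on with
  | C r => simp [← MvPolynomial.algebraMap_eq]
  | add p q hp hq => simp only [map_add, hp, hq, mul_add, Finset.sum_add_distrib]
  | mul_X p t hp =>
    simp only [map_mul, MvPolynomial.aeval_X, Derivation.leibniz, hp, smul_eq_mul, map_add,
      MvPolynomial.pderiv_X, mul_add, Finset.sum_add_distrib, Finset.mul_sum]
    congr 1
    · rw [Finset.sum_eq_single t]
      · simp [mul_comm]
      · intro b _ hb; simp [hb.symm]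
      · simp
    · exact Finset.sum_congr rfl fun _ _ => by ring

open scoped MvPowerSeries.WithPiTopology in
theorem continuous_pderiv {σ R : Type*} [CommRing R] [TopologicalSpace R] [DiscreteTopology R]
    (i : σ) : Continuous (pderiv R i : MvPowerSeries σ R → MvPowerSeries σ R) := by
  refine continuous_pi fun d => ?_
  have : (fun f : MvPowerSeries σ R => pderiv R i f d) =
      fun f : MvPowerSeries σ R => coeff (d + Finsupp.single i 1) f * ((d i : R) + 1) :=
    funext fun f => coeff_pderiv f d
  rw [this]
  exact (continuous_of_discreteTopology (f := fun r : R => r * ((d i : R) + 1))).comp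
    (WithPiTopology.continuous_coeff R _)

open scoped MvPowerSeries.WithPiTopology in
/-- The chain rule for substitutions into multivariate power series. -/
theorem pderiv_subst {σ τ R : Type*} [CommRing R] [Fintype τ] {a : τ → MvPowerSeries σ R}
    (ha : HasSubst a) (s : σ) (f : MvPowerSeries τ R) :
    pderiv R s (subst a f) = ∑ t, pderiv R s (a t) * subst a (pderiv R t f) := by
  -- With discrete coefficients, substitution and differentiation are continuous and the polynomials
  -- are dense.
  let _ : UniformSpace R := ⊥
  have : DiscreteUniformity R := ⟨rfl⟩
  refine congrFun (g := fun f => ∑ t, pderiv R s (a t) * subst a (pderiv R t f))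
    (DenseRange.equalizer (f := (MvPolynomial.toMvPowerSeries : MvPolynomial τ R → _))
    WithPiTopology.denseRange_toMvPowerSeries
    ((continuous_pderiv s).comp (continuous_subst ha)) ?_ ?_) f
  · exact continuous_finsetSum _ fun t _ =>
      continuous_const.mul ((continuous_subst ha).comp (continuous_pderiv t))
  · funext p
    simp only [Function.comp, MvPowerSeries.pderiv_coe, subst_coe, pderiv_aeval]

/-- A power series is a linear form if it is a rational linear combination of the variables. -/
def IsLinForm {σ R : Type*} [CommRing R] [Algebra ℚ R] (g : MvPowerSeries σ R) : Prop :=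
  ∃ c : σ →₀ ℚ, g = c.sum fun s q => q • X s

section IsLinForm

variable {σ R : Type*} [CommRing R] [Algebra ℚ R] {g h : MvPowerSeries σ R}

theorem IsLinForm.zero : IsLinForm (0 : MvPowerSeries σ R) := ⟨0, by simp⟩

theorem IsLinForm.X (s : σ) : IsLinForm (X s : MvPowerSeries σ R) :=
  ⟨Finsupp.single s 1, by simp⟩

theorem IsLinForm.add (hg : IsLinForm g) (hh : IsLinForm h) : IsLinForm (g + h) := by
  obtain ⟨c, rfl⟩ := hg
  obtain ⟨d, rfl⟩ := hh
  exact ⟨c + d, by rw [Finsupp.sum_add_index'] <;> simp [add_smul]⟩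

theorem IsLinForm.smul (q : ℚ) (hg : IsLinForm g) : IsLinForm (q • g) := by
  obtain ⟨c, rfl⟩ := hg
  exact ⟨q • c, by rw [Finsupp.sum_smul_index'] <;> simp [mul_smul, Finsupp.smul_sum]⟩

theorem IsLinForm.sub (hg : IsLinForm g) (hh : IsLinForm h) : IsLinForm (g - h) := by
  have := hg.add (hh.smul (-1))
  rwa [neg_one_smul, ← sub_eq_add_neg] at this

theorem IsLinForm.sum {ι : Type*} (t : Finset ι) {g : ι → MvPowerSeries σ R}
    (hg : ∀ i ∈ t, IsLinForm (g i)) : IsLinForm (∑ i ∈ t, g i) := by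
  classical
  induction t using Finset.induction_on with
  | empty => simpa using IsLinForm.zero
  | insert i t hi ih =>
    rw [Finset.sum_insert hi]
    exact (hg i (by simp)).add (ih fun j hj => hg j (by simp [hj]))

theorem IsLinForm.constantCoeff (hg : IsLinForm g) : MvPowerSeries.constantCoeff g = 0 := by
  obtain ⟨c, rfl⟩ := hg
  rw [Finsupp.sum, map_sum]
  exact Finset.sum_eq_zero fun s _ => by
    rw [← coeff_zero_eq_constantCoeff_apply]
    change c s • MvPowerSeries.coeff 0 (MvPowerSeries.X s) = (0 : R)
    simp

theorem pderiv_ratSMul (s : σ) (q : ℚ) (f : MvPowerSeries σ R) :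
    pderiv R s (q • f) = q • pderiv R s f := by
  ext n
  rw [coeff_pderiv]
  change q • _ * _ = q • coeff n (pderiv R s f)
  rw [coeff_pderiv, smul_mul_assoc]
  rfl

theorem IsLinForm.exists_pderiv (hg : IsLinForm g) (s : σ) :
    ∃ q : ℚ, pderiv R s g = algebraMap ℚ _ q := by
  classical
  obtain ⟨c, rfl⟩ := hg
  refine ⟨c s, ?_⟩
  rw [Finsupp.sum, map_sum]
  simp only [pderiv_ratSMul, pderiv_X]
  by_cases h : s ∈ c.support
  · rw [Finset.sum_eq_single_of_mem s h fun b _ hb => by simp [hb]]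
    simp [Algebra.smul_def]
  · rw [Finset.sum_eq_zero fun b hb => ?_, Finsupp.notMem_support_iff.1 h, map_zero]
    have : b ≠ s := fun e => h (e ▸ hb)
    simp [this]

end IsLinForm

/-- The coefficientwise application of a linear map. -/
def mapCoeff {σ R : Type*} [CommRing R] [Algebra ℚ R] (T : R →ₗ[ℚ] R) (f : MvPowerSeries σ R) :
    MvPowerSeries σ R := fun n => T (f n)

section MapCoeff

variable {σ τ R : Type*} [CommRing R] [Algebra ℚ R] (T : R →ₗ[ℚ] R)

theorem coeff_mapCoeff (n : σ →₀ ℕ) (f : MvPowerSeries σ R) :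
    coeff n (mapCoeff T f) = T (coeff n f) := rfl

theorem mapCoeff_add (f g : MvPowerSeries σ R) :
    mapCoeff T (f + g) = mapCoeff T f + mapCoeff T g := by
  ext n; simp [coeff_mapCoeff]

theorem mapCoeff_sub (f g : MvPowerSeries σ R) :
    mapCoeff T (f - g) = mapCoeff T f - mapCoeff T g := by
  ext n; simp [coeff_mapCoeff]

theorem mapCoeff_zero : mapCoeff T (0 : MvPowerSeries σ R) = 0 := by
  ext n; simp [coeff_mapCoeff]

theorem mapCoeff_smul (q : ℚ) (f : MvPowerSeries σ R) :
    mapCoeff T (q • f) = q • mapCoeff T f := by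
  ext n; exact T.map_smul q _

theorem mapCoeff_sum {ι : Type*} (t : Finset ι) (f : ι → MvPowerSeries σ R) :
    mapCoeff T (∑ i ∈ t, f i) = ∑ i ∈ t, mapCoeff T (f i) := by
  ext n; simp [coeff_mapCoeff]

theorem mapCoeff_pderiv (s : σ) (f : MvPowerSeries σ R) :
    mapCoeff T (pderiv R s f) = pderiv R s (mapCoeff T f) := by
  ext n
  rw [coeff_mapCoeff, coeff_pderiv, coeff_pderiv, coeff_mapCoeff]
  have (r : R) : r * ((n s : R) + 1) = ((n s : ℚ) + 1) • r := by
    rw [Algebra.smul_def]; simp [mul_comm]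
  rw [this, this, map_smul]

theorem mapCoeff_X_mul (s : σ) (f : MvPowerSeries σ R) :
    mapCoeff T (X s * f) = X s * mapCoeff T f := by
  classical
  ext n
  rw [coeff_mapCoeff, X, coeff_monomial_mul, coeff_monomial_mul]
  split_ifs <;> simp [coeff_mapCoeff]

/-- T is only ℚ-linear, but the linear forms have rational coefficients, so each coefficient of the
result is a rational combination of coefficients of f. Differentiation lowers the degree: the
derivatives of the linear forms are rational constants, which T respects, and the constant
coefficient is unchanged by the substitution. -/
theorem mapCoeff_subst [Fintype τ] {a : τ → MvPowerSeries σ R} (ha : ∀ t, IsLinForm (a t))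
    (f : MvPowerSeries τ R) : mapCoeff T (subst a f) = subst a (mapCoeff T f) := by
  have hs : HasSubst a := hasSubst_of_constantCoeff_zero fun t => (ha t).constantCoeff
  choose c hc using fun t s => (ha t).exists_pderiv s
  have h0 : ∀ f : MvPowerSeries τ R, constantCoeff (subst a f) = constantCoeff f := by
    intro f
    have : f = C (constantCoeff f) + (f - C (constantCoeff f)) := by ring
    rw [this, subst_add hs, map_add, subst_C, constantCoeff_subst_eq_zero hs
      (fun t => (ha t).constantCoeff) (by simp)]
    simp
  ext n
  rw [coeff_mapCoeff]
  induction hd : n.degree generalizing n f with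
  | zero =>
    rw [Finsupp.degree_eq_zero_iff] at hd
    rw [hd, coeff_zero_eq_constantCoeff, h0, h0]
    rfl
  | succ d ih =>
    obtain ⟨s, hsn⟩ : ∃ s, n s ≠ 0 := by
      by_contra! h
      have : n = 0 := Finsupp.ext h
      simp [this] at hd
    obtain ⟨m, rfl⟩ : ∃ m, n = m + Finsupp.single s 1 :=
      ⟨n - Finsupp.single s 1, (tsub_add_cancel_of_le
        (Finsupp.single_le_iff.2 (Nat.one_le_iff_ne_zero.2 hsn))).symm⟩
    have hm : m.degree = d := by simpa using hd
    have key : ∀ f : MvPowerSeries τ R, ((m s : ℚ) + 1) • coeff (m + Finsupp.single s 1) (subst a f)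
        = ∑ t, c t s • coeff m (subst a (pderiv R t f)) := by
      intro f
      have := congrArg (coeff m) (pderiv_subst hs s f)
      rw [coeff_pderiv] at this
      rw [Algebra.smul_def, mul_comm]
      simp only [map_add, map_natCast, map_one]
      rw [this, map_sum]
      refine Finset.sum_congr rfl fun t _ => ?_
      rw [hc, ← Algebra.smul_def]
      rfl
    have hne : ((m s : ℚ) + 1) ≠ 0 := by positivity
    refine smul_right_injective R hne ?_
    change ((m s : ℚ) + 1) • _ = ((m s : ℚ) + 1) • _
    rw [← map_smul, key, key, map_sum]
    refine Finset.sum_congr rfl fun t _ => ?_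
    rw [map_smul, ih _ _ hm, mapCoeff_pderiv]

end MapCoeff

end PowerSeries

/-! ### The swap commutes with δ -/

section BimouldOperators

theorem isLinForm_varX (r j : ℕ) : IsLinForm (varX r j) := by
  unfold varX
  split_ifs
  exacts [IsLinForm.X _, IsLinForm.zero]

theorem isLinForm_varY (r j : ℕ) : IsLinForm (varY r j) := by
  unfold varY
  split_ifs
  exacts [IsLinForm.X _, IsLinForm.zero]

/-- Sequences of linear forms. -/
def LinSeq {r : ℕ} (P : ℕ → Series r) : Prop := ∀ i, IsLinForm (P i)

section SubstXY

variable {s r t : ℕ} {P Q : ℕ → Series r}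

theorem LinSeq.hasSubst (hP : LinSeq P) (hQ : LinSeq Q) :
    MvPowerSeries.HasSubst
      (Sum.elim (fun i : Fin s => P (i + 1)) (fun i : Fin s => Q (i + 1))) :=
  hasSubst_substXY P Q (fun i => (hP i).constantCoeff) (fun i => (hQ i).constantCoeff)

/-- Substitution as a ring homomorphism. -/
def substXYHom (hP : LinSeq P) (hQ : LinSeq Q) : Series s →ₐ[ℚ] Series r :=
  (MvPowerSeries.substAlgHom (R := QA) (hP.hasSubst (s := s) hQ)).restrictScalars ℚ

theorem substXYHom_apply (hP : LinSeq P) (hQ : LinSeq Q) (f : Series s) :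
    substXYHom hP hQ f = f.substXY P Q := by
  simp [substXYHom, Series.substXY]

theorem substXY_varX (hP : LinSeq P) (hQ : LinSeq Q) (i : ℕ) :
    (varX s i).substXY P Q = if 1 ≤ i ∧ i ≤ s then P i else 0 := by
  rw [← substXYHom_apply hP hQ]
  unfold varX
  split_ifs with h
  · rw [substXYHom_apply, Series.substXY, MvPowerSeries.subst_X (hP.hasSubst hQ)]
    simp [Nat.sub_add_cancel h.1]
  · simp

theorem substXY_varY (hP : LinSeq P) (hQ : LinSeq Q) (i : ℕ) :
    (varY s i).substXY P Q = if 1 ≤ i ∧ i ≤ s then Q i else 0 := by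
  rw [← substXYHom_apply hP hQ]
  unfold varY
  split_ifs with h
  · rw [substXYHom_apply, Series.substXY, MvPowerSeries.subst_X (hP.hasSubst hQ)]
    simp [Nat.sub_add_cancel h.1]
  · simp

theorem substXY_congr {P' Q' : ℕ → Series r} (hP : ∀ i, 1 ≤ i → i ≤ s → P i = P' i)
    (hQ : ∀ i, 1 ≤ i → i ≤ s → Q i = Q' i) (f : Series s) : f.substXY P Q = f.substXY P' Q' := by
  unfold Series.substXY
  congr 1
  funext i
  rcases i with i | i
  · exact hP _ (by omega) (by omega)
  · exact hQ _ (by omega) (by omega)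

theorem substXY_substXY {P' Q' : ℕ → Series t} (hP : LinSeq P) (hQ : LinSeq Q) (hP' : LinSeq P')
    (hQ' : LinSeq Q') (f : Series s) : (f.substXY P Q).substXY P' Q' =
      f.substXY (fun i => (P i).substXY P' Q') (fun i => (Q i).substXY P' Q') := by
  unfold Series.substXY
  rw [MvPowerSeries.subst_comp_subst_apply (hP.hasSubst hQ) (hP'.hasSubst hQ')]
  congr 1
  funext i
  rcases i with i | i <;> rfl

theorem mapCoeff_substXY (T : QA →ₗ[ℚ] QA) (hP : LinSeq P) (hQ : LinSeq Q) (f : Series s) :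
    mapCoeff T (f.substXY P Q) = Series.substXY (mapCoeff T f) P Q :=
  mapCoeff_subst T (by rintro (i | i) <;> simp [hP _, hQ _]) f

end SubstXY

/-- The sequence `X_1, X_2, …` without `X_j`. -/
def skipX (r j i : ℕ) : Series r := if i < j then varX r i else varX r (i + 1)

/-- The sequence `Y_1, …, Y_m + Y_{m+1}, …`. -/
def mergeY (r m i : ℕ) : Series r :=
  if i < m then varY r i else if i = m then varY r m + varY r (m + 1) else varY r (i + 1)

theorem linSeq_skipX (r j : ℕ) : LinSeq (skipX r j) := by
  intro i; unfold skipX; split_ifs <;> exact isLinForm_varX _ _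

theorem linSeq_mergeY (r m : ℕ) : LinSeq (mergeY r m) := by
  intro i; unfold mergeY
  split_ifs
  exacts [isLinForm_varY _ _, (isLinForm_varY _ _).add (isLinForm_varY _ _), isLinForm_varY _ _]

/-- The first row of the swap. -/
def swapX (r i : ℕ) : Series r := ∑ l ∈ Finset.Icc 1 (r + 1 - i), varY r l

/-- The second row of the swap. -/
def swapY (r i : ℕ) : Series r := varX r (r + 1 - i) - varX r (r + 2 - i)

theorem linSeq_swapX (r : ℕ) : LinSeq (swapX r) :=
  fun _ => IsLinForm.sum _ fun _ _ => isLinForm_varY _ _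

theorem linSeq_swapY (r : ℕ) : LinSeq (swapY r) :=
  fun _ => (isLinForm_varX _ _).sub (isLinForm_varX _ _)

/-- `f_{r-1}` at `X` without `X_j` and `Y` with `Y_m`, `Y_{m+1}` added. -/
def phi (j m : ℕ) (f : Bimould) : Bimould := fun r =>
  (f (r - 1)).substXY (skipX r j) (mergeY r m)

theorem phiPlus_eq {j r : ℕ} (h : 1 ≤ j ∧ j ≤ r) (f : Bimould) : phiPlus j f r = phi j j f r := by
  unfold phiPlus
  rw [if_pos h]
  rfl

theorem phiMinus_eq {j r : ℕ} (h : 2 ≤ j ∧ j ≤ r) (f : Bimould) :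
    phiMinus j f r = phi j (j - 1) f r := by
  unfold phiMinus
  rw [if_pos h]
  refine substXY_congr (fun _ _ _ => rfl) (fun i _ _ => ?_) _
  unfold mergeY
  rw [Nat.sub_add_cancel (by omega)]

theorem swap_eq (f : Bimould) (r : ℕ) : swap f r = (f r).substXY (swapX r) (swapY r) := rfl

/-- The partial sums of a sequence with two neighbours merged are the old partial sums with the m-th
one left out. -/
theorem sum_merge {M : Type*} [AddCommMonoid M] (y : ℕ → M) {m : ℕ} (hm : 1 ≤ m) (N : ℕ) :
    ∑ l ∈ Finset.Icc 1 N, (if l < m then y l else if l = m then y m + y (m + 1) else y (l + 1))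
      = ∑ l ∈ Finset.Icc 1 (if N < m then N else N + 1), y l := by
  induction N with
  | zero => simp [show 0 < m by omega]
  | succ N ih =>
    rw [Finset.sum_Icc_succ_top (by omega), ih]
    rcases lt_trichotomy (N + 1) m with h | h | h
    · rw [if_pos (by omega), if_pos h, if_pos h, Finset.sum_Icc_succ_top (by omega)]
    · subst h
      simp only [lt_irrefl, if_false, if_true, Nat.lt_succ_self]
      rw [Finset.sum_Icc_succ_top (by omega), Finset.sum_Icc_succ_top (by omega), ← add_assoc]
    · rw [if_neg (by omega), if_neg (by omega), if_neg (by omega), if_neg (by omega),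
        Finset.sum_Icc_succ_top (b := N + 1) (by omega)]

/-- The swap puts partial sums of the Y in place of the X and differences of neighbouring X in place
of the Y. Omitting a partial sum merges two Y, and adding two neighbouring differences telescopes
and omits an X. Thus deletion and merging change places, and the order is reversed. -/
theorem swap_phi {j m r : ℕ} (hj : 1 ≤ j ∧ j ≤ r) (hm : 1 ≤ m ∧ m ≤ r) (f : Bimould) :
    swap (phi j m f) r = phi (r + 1 - m) (r + 1 - j) (swap f) r := by
  obtain ⟨s, rfl⟩ : ∃ s, r = s + 1 := ⟨r - 1, by omega⟩
  rw [swap_eq]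
  unfold phi
  rw [swap_eq, substXY_substXY (linSeq_skipX _ _) (linSeq_mergeY _ _) (linSeq_swapX _)
    (linSeq_swapY _), substXY_substXY (linSeq_swapX _) (linSeq_swapY _) (linSeq_skipX _ _)
    (linSeq_mergeY _ _)]
  have hl := substXY_varX (s := s + 1) (linSeq_swapX (s + 1)) (linSeq_swapY (s + 1))
  have hl' := substXY_varY (s := s + 1) (linSeq_swapX (s + 1)) (linSeq_swapY (s + 1))
  have hr := substXY_varX (s := s) (linSeq_skipX (s + 1) (s + 1 + 1 - m))
    (linSeq_mergeY (s + 1) (s + 1 + 1 - j))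
  have hr' := substXY_varY (s := s) (linSeq_skipX (s + 1) (s + 1 + 1 - m))
    (linSeq_mergeY (s + 1) (s + 1 + 1 - j))
  have hx0 : varX (s + 1) (s + 2) = 0 := by simp [varX]
  refine substXY_congr (fun i hi hi' => ?_) (fun i hi hi' => ?_) _
  · simp only [Nat.add_sub_cancel] at hi'
    have e1 : (swapX (s + 1 - 1) i).substXY (skipX (s + 1) (s + 1 + 1 - m))
        (mergeY (s + 1) (s + 1 + 1 - j)) =
        ∑ l ∈ Finset.Icc 1 (s + 1 - i), mergeY (s + 1) (s + 1 + 1 - j) l := by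
      unfold swapX
      rw [← substXYHom_apply (linSeq_skipX _ _) (linSeq_mergeY _ _), map_sum]
      refine Finset.sum_congr rfl fun l hl => ?_
      rw [Finset.mem_Icc] at hl
      rw [substXYHom_apply]
      exact (hr' l).trans (if_pos ⟨hl.1, by omega⟩)
    rw [e1]
    unfold mergeY
    rw [sum_merge _ (by omega)]
    unfold skipX
    split_ifs with h1 h2 h2
    · omega
    · rw [hl, if_pos ⟨by omega, by omega⟩]
      unfold swapX
      congr 2; omega
    · rw [hl, if_pos ⟨by omega, by omega⟩]
      unfold swapX
      congr 2; omega
    · omega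
  · simp only [Nat.add_sub_cancel] at hi'
    have e1 : (swapY (s + 1 - 1) i).substXY (skipX (s + 1) (s + 1 + 1 - m))
        (mergeY (s + 1) (s + 1 + 1 - j)) =
        skipX (s + 1) (s + 1 + 1 - m) (s + 1 - i) - skipX (s + 1) (s + 1 + 1 - m) (s + 2 - i) := by
      unfold swapY
      rw [← substXYHom_apply (linSeq_skipX _ _) (linSeq_mergeY _ _), map_sub, substXYHom_apply,
        substXYHom_apply]
      refine congrArg₂ _ ((hr _).trans (if_pos ⟨by omega, by omega⟩)) ((hr _).trans ?_)
      split_ifs with h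
      · rfl
      -- For i = 1 the subtracted variable lies beyond the last one, and it is 0 in both depths by
      -- the convention X_{r+1} = 0.
      · have : i = 1 := by omega
        subst this
        unfold skipX
        rw [if_neg (by omega)]
        exact hx0.symm
    rw [e1]
    unfold mergeY skipX
    rcases lt_trichotomy i m with h | h | h
    · rw [if_pos h, hl', if_pos ⟨hi, by omega⟩, if_neg (by omega), if_neg (by omega)]
      unfold swapY
      congr 2 <;> omega
    · subst h
      rw [if_neg (lt_irrefl _), if_pos rfl, ← substXYHom_apply (linSeq_swapX _) (linSeq_swapY _),
        map_add, substXYHom_apply, substXYHom_apply, hl', hl', if_pos ⟨hi, by omega⟩,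
        if_pos ⟨by omega, by omega⟩, if_pos (by omega), if_neg (by omega)]
      unfold swapY
      rw [show s + 1 + 2 - (i + 1) = s + 1 + 1 - i by omega,
        show s + 1 + 1 - (i + 1) = s + 1 - i by omega,
        show s + 1 + 2 - i = s + 2 - i + 1 by omega]
      ring
    · rw [if_neg (by omega), if_neg (by omega), hl', if_pos ⟨by omega, by omega⟩,
        if_pos (by omega), if_pos (by omega)]
      unfold swapY
      congr 2 <;> omega

/-- Both sides omit X_j and X_{j+1} and merge Y_m, Y_{m+1}, Y_{m+2}. This repairs the mismatch in
the squares of φ^±, where the reflection of indices differs between depths r and r - 1. -/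
theorem phi_phi {j m r : ℕ} (hj : 1 ≤ j ∧ j + 1 ≤ r) (hm : 1 ≤ m ∧ m + 1 ≤ r) (f : Bimould) :
    phi (j + 1) (m + 1) (phi j m f) r = phi j m (phi j m f) r := by
  obtain ⟨s, rfl⟩ : ∃ s, r = s + 2 := ⟨r - 2, by omega⟩
  unfold phi
  rw [substXY_substXY (linSeq_skipX _ _) (linSeq_mergeY _ _) (linSeq_skipX _ _)
    (linSeq_mergeY _ _), substXY_substXY (linSeq_skipX _ _) (linSeq_mergeY _ _) (linSeq_skipX _ _)
    (linSeq_mergeY _ _)]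
  have hX (a b i) (h : 1 ≤ i ∧ i ≤ s + 1) := (substXY_varX (s := s + 1)
    (linSeq_skipX (s + 2) a) (linSeq_mergeY (s + 2) b) i).trans (if_pos h)
  have hY (a b i) (h : 1 ≤ i ∧ i ≤ s + 1) := (substXY_varY (s := s + 1)
    (linSeq_skipX (s + 2) a) (linSeq_mergeY (s + 2) b) i).trans (if_pos h)
  refine substXY_congr (fun i hi hi' => ?_) (fun i hi hi' => ?_) _
  · change i ≤ s at hi'
    change (skipX (s + 1) j i).substXY _ _ = (skipX (s + 1) j i).substXY _ _
    rcases lt_or_ge i j with h | h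
    · have : skipX (s + 1) j i = varX (s + 1) i := if_pos h
      rw [this, hX _ _ _ ⟨hi, by omega⟩, hX _ _ _ ⟨hi, by omega⟩]
      unfold skipX
      rw [if_pos h, if_pos (by omega)]
    · have : skipX (s + 1) j i = varX (s + 1) (i + 1) := if_neg (by omega)
      rw [this, hX _ _ _ ⟨by omega, by omega⟩, hX _ _ _ ⟨by omega, by omega⟩]
      unfold skipX
      rw [if_neg (by omega), if_neg (by omega)]
  · change i ≤ s at hi'
    change (mergeY (s + 1) m i).substXY _ _ = (mergeY (s + 1) m i).substXY _ _
    rcases lt_trichotomy i m with h | h | h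
    · have : mergeY (s + 1) m i = varY (s + 1) i := if_pos h
      rw [this, hY _ _ _ ⟨hi, by omega⟩, hY _ _ _ ⟨hi, by omega⟩]
      unfold mergeY
      rw [if_pos h, if_pos (by omega)]
    · subst h
      have : mergeY (s + 1) i i = varY (s + 1) i + varY (s + 1) (i + 1) := by
        unfold mergeY; rw [if_neg (lt_irrefl _), if_pos rfl]
      rw [this, ← substXYHom_apply (linSeq_skipX _ _) (linSeq_mergeY _ _),
        ← substXYHom_apply (linSeq_skipX _ _) (linSeq_mergeY _ _), map_add, map_add,
        substXYHom_apply, substXYHom_apply, substXYHom_apply, substXYHom_apply,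
        hY _ _ _ ⟨hi, by omega⟩, hY _ _ _ ⟨by omega, by omega⟩, hY _ _ _ ⟨hi, by omega⟩,
        hY _ _ _ ⟨by omega, by omega⟩]
      unfold mergeY
      simp only [Nat.lt_succ_self, lt_irrefl, if_true, if_false,
        if_neg (show ¬ i + 1 < i by omega), if_neg (show ¬ i + 1 = i by omega)]
      ring
    · have : mergeY (s + 1) m i = varY (s + 1) (i + 1) := by
        unfold mergeY; rw [if_neg (by omega), if_neg (by omega)]
      rw [this, hY _ _ _ ⟨by omega, by omega⟩, hY _ _ _ ⟨by omega, by omega⟩]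
      unfold mergeY
      rw [if_neg (by omega), if_neg (by omega), if_neg (by omega), if_neg (by omega)]

/-- `δ` with all degenerate terms left out. -/
theorem opDelta_eq (f : Bimould) (r : ℕ) : opDelta f r =
    (∑ j ∈ Finset.Icc 1 r, varX r j * varY r j) * f r
      - (1 / 2 : ℚ) • ∑ j ∈ Finset.Icc 1 r,
          (varX r j - varX r (j + 1) + varY r j) * phi j j f r
      - (1 / 2 : ℚ) • ∑ j ∈ Finset.Icc 1 (r - 1),
          (varX r j - varX r (j + 1) + varY r (j + 1)) * phi (j + 1) j f r
      + (1 / 4 : ℚ) • ∑ j ∈ Finset.Icc 1 (r - 1), phi j j (phi j j f) r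
      - (1 / 4 : ℚ) • ∑ j ∈ Finset.Icc 1 (r - 2), phi (j + 1) j (phi (j + 1) j f) r := by
  have shift : ∀ (n : ℕ) (g : ℕ → Series r), (∀ j, j ≤ 1 ∨ n < j → g j = 0) → n ≤ r →
      ∑ j ∈ Finset.Icc 1 r, g j = ∑ j ∈ Finset.Icc 1 (n - 1), g (j + 1) := by
    intro n g hg hn
    symm
    refine Finset.sum_of_injOn (· + 1) (fun a _ b _ h => by simpa using h)
      (fun a ha => ?_) (fun a ha ha' => hg a ?_) fun _ _ => rfl
    · simp only [Finset.coe_Icc, Set.mem_Icc] at ha ⊢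
      omega
    · by_contra! h
      refine ha' ⟨a - 1, ?_, ?_⟩
      · simp only [Finset.coe_Icc, Set.mem_Icc]; omega
      · simp only; omega
  have e1 : ∑ j ∈ Finset.Icc 1 r, (varX r j - varX r (j + 1) + varY r j) * phiPlus j f r =
      ∑ j ∈ Finset.Icc 1 r, (varX r j - varX r (j + 1) + varY r j) * phi j j f r :=
    Finset.sum_congr rfl fun j hj => by rw [phiPlus_eq (Finset.mem_Icc.1 hj)]
  have e2 : ∑ j ∈ Finset.Icc 1 r, (varX r (j - 1) - varX r j + varY r j) * phiMinus j f r =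
      ∑ j ∈ Finset.Icc 1 (r - 1),
        (varX r j - varX r (j + 1) + varY r (j + 1)) * phi (j + 1) j f r := by
    rw [shift r _ (fun j hj => by unfold phiMinus; rw [if_neg (by omega), mul_zero]) le_rfl]
    refine Finset.sum_congr rfl fun j hj => ?_
    rw [Finset.mem_Icc] at hj
    rw [phiMinus_eq ⟨by omega, by omega⟩, Nat.add_sub_cancel]
  -- The square vanishes for j = r, since φ_r^+ is 0 in depth r - 1.
  have e3 : ∑ j ∈ Finset.Icc 1 r, phiPlus j (phiPlus j f) r =
      ∑ j ∈ Finset.Icc 1 (r - 1), phi j j (phi j j f) r := by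
    symm
    refine Finset.sum_subset_zero_on_sdiff (fun j hj => ?_) (fun j hj => ?_) (fun j hj => ?_)
    · rw [Finset.mem_Icc] at hj ⊢; omega
    · simp only [Finset.mem_sdiff, Finset.mem_Icc] at hj
      rw [phiPlus_eq ⟨by omega, by omega⟩]
      unfold phi
      unfold phiPlus
      rw [if_neg (by omega), ← substXYHom_apply (linSeq_skipX _ _) (linSeq_mergeY _ _), map_zero]
    · rw [Finset.mem_Icc] at hj
      rw [phiPlus_eq ⟨by omega, by omega⟩]
      unfold phi
      rw [phiPlus_eq ⟨by omega, by omega⟩]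
      rfl
  -- The inner operator acts in depth r - 1 and needs 2 ≤ j ≤ r - 1; after the shift by one, j runs
  -- from 1 to r - 2.
  have e4 : ∑ j ∈ Finset.Icc 1 r, phiMinus j (phiMinus j f) r =
      ∑ j ∈ Finset.Icc 1 (r - 2), phi (j + 1) j (phi (j + 1) j f) r := by
    have := shift (r - 1) (fun j => phiMinus j (phiMinus j f) r) (fun j hj => ?_) (by omega)
    · rw [this, Nat.sub_sub]
      refine Finset.sum_congr rfl fun j hj => ?_
      rw [Finset.mem_Icc] at hj
      rw [phiMinus_eq ⟨by omega, by omega⟩]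
      unfold phi
      rw [phiMinus_eq ⟨by omega, by omega⟩]
      rfl
    · by_cases h : 2 ≤ j ∧ j ≤ r
      · rw [phiMinus_eq h]
        unfold phi
        unfold phiMinus
        rw [if_neg (by omega), ← substXYHom_apply (linSeq_skipX _ _) (linSeq_mergeY _ _), map_zero]
      · unfold phiMinus
        rw [if_neg h]
  unfold opDelta
  rw [← e1, ← e2, ← e3, ← e4]
  simp only [Finset.sum_add_distrib, Finset.sum_sub_distrib, Finset.sum_neg_distrib,
    mul_smul_comm, Finset.smul_sum]
  ring

/-- Abel summation: partial sums of Y against differences of X give back ∑ X_j Y_j. The boundary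
term carries the factor X_{r+1} = 0. -/
theorem swap_sum_varX_mul_varY (r : ℕ) :
    (∑ j ∈ Finset.Icc 1 r, varX r j * varY r j).substXY (swapX r) (swapY r) =
      ∑ j ∈ Finset.Icc 1 r, varX r j * varY r j := by
  have h0 : varX r (r + 1) = 0 := by simp [varX]
  have key : ∀ N, ∑ m ∈ Finset.Icc 1 N,
      (∑ l ∈ Finset.Icc 1 m, varY r l) * (varX r m - varX r (m + 1)) =
      ∑ m ∈ Finset.Icc 1 N, varX r m * varY r m
        - (∑ l ∈ Finset.Icc 1 N, varY r l) * varX r (N + 1) := by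
    intro N
    induction N with
    | zero => simp
    | succ N ih =>
      rw [Finset.sum_Icc_succ_top (by omega), ih, Finset.sum_Icc_succ_top (by omega),
        Finset.sum_Icc_succ_top (by omega)]
      ring
  have h1 := key r
  rw [h0, mul_zero, sub_zero] at h1
  have h2 : ∑ i ∈ Finset.Icc 1 r, swapX r i * swapY r i =
      ∑ j ∈ Finset.Icc 1 r, varX r j * varY r j := by
    rw [← h1]
    refine Finset.sum_nbij' (fun i => r + 1 - i) (fun i => r + 1 - i) ?_ ?_ ?_ ?_ ?_
    · intro i hi; rw [Finset.mem_Icc] at hi ⊢; omega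
    · intro i hi; rw [Finset.mem_Icc] at hi ⊢; omega
    · intro i hi; rw [Finset.mem_Icc] at hi; omega
    · intro i hi; rw [Finset.mem_Icc] at hi; omega
    · intro i hi
      rw [Finset.mem_Icc] at hi
      unfold swapX swapY
      rw [show r + 2 - i = r + 1 - i + 1 by omega]
  conv_rhs => rw [← h2]
  rw [← substXYHom_apply (linSeq_swapX _) (linSeq_swapY _), map_sum]
  refine Finset.sum_congr rfl fun i hi => ?_
  rw [map_mul, substXYHom_apply, substXYHom_apply, substXY_varX (linSeq_swapX _) (linSeq_swapY _),
    substXY_varY (linSeq_swapX _) (linSeq_swapY _), if_pos (Finset.mem_Icc.1 hi),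
    if_pos (Finset.mem_Icc.1 hi)]

theorem sum_Icc_reflect {M : Type*} [AddCommMonoid M] (n : ℕ) (g h : ℕ → M)
    (hgh : ∀ j, 1 ≤ j → j ≤ n → g j = h (n + 1 - j)) :
    ∑ j ∈ Finset.Icc 1 n, g j = ∑ j ∈ Finset.Icc 1 n, h j := by
  refine Finset.sum_nbij' (fun i => n + 1 - i) (fun i => n + 1 - i) ?_ ?_ ?_ ?_ ?_
  · intro i hi; rw [Finset.mem_Icc] at hi ⊢; omega
  · intro i hi; rw [Finset.mem_Icc] at hi ⊢; omega
  · intro i hi; rw [Finset.mem_Icc] at hi; omega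
  · intro i hi; rw [Finset.mem_Icc] at hi; omega
  · intro i hi; rw [Finset.mem_Icc] at hi; exact hgh i hi.1 hi.2

section SwapHom

variable {r : ℕ}

/-- The swap in depth `r` as a ring homomorphism. -/
def swapHom (r : ℕ) : Series r →ₐ[ℚ] Series r := substXYHom (linSeq_swapX r) (linSeq_swapY r)

theorem swap_eq_swapHom (f : Bimould) (r : ℕ) : swap f r = swapHom r (f r) :=
  (substXYHom_apply _ _ _).symm

theorem swapHom_varX {i : ℕ} (h : 1 ≤ i ∧ i ≤ r + 1) : swapHom r (varX r i) = swapX r i := by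
  unfold swapHom
  rw [substXYHom_apply, substXY_varX (linSeq_swapX r) (linSeq_swapY r)]
  split_ifs with h'
  · rfl
  · simp [swapX, show i = r + 1 by omega]

theorem swapHom_varY {i : ℕ} (h : 1 ≤ i ∧ i ≤ r) : swapHom r (varY r i) = swapY r i := by
  unfold swapHom
  rw [substXYHom_apply, substXY_varY (linSeq_swapX r) (linSeq_swapY r), if_pos h]

theorem swapX_sub (i : ℕ) (h : i ≤ r) :
    swapX r i - swapX r (i + 1) = varY r (r + 1 - i) := by
  unfold swapX
  rw [show r + 1 - i = r + 1 - (i + 1) + 1 by omega, Finset.sum_Icc_succ_top (by omega)]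
  ring

/-- The swap turns X_j - X_{j+1} into Y_{r+1-j} and Y_j into X_{r+1-j} - X_{r+2-j}. The factor of
φ_j^+ therefore becomes the factor at the reflected index. -/
theorem swapHom_sum_plus (f : Bimould) (r : ℕ) :
    swapHom r (∑ j ∈ Finset.Icc 1 r, (varX r j - varX r (j + 1) + varY r j) * phi j j f r) =
      ∑ j ∈ Finset.Icc 1 r, (varX r j - varX r (j + 1) + varY r j) * phi j j (swap f) r := by
  rw [map_sum]
  refine sum_Icc_reflect _ _ _ fun j h1 h2 => ?_
  rw [map_mul, map_add, map_sub, ← swap_eq_swapHom, swap_phi ⟨h1, h2⟩ ⟨h1, h2⟩,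
    swapHom_varX ⟨h1, by omega⟩, swapHom_varX ⟨by omega, by omega⟩, swapHom_varY ⟨h1, h2⟩,
    swapX_sub _ (by omega)]
  unfold swapY
  rw [show r + 2 - j = r + 1 - j + 1 by omega, add_comm]

/-- As for φ^+, but the reflection is j ↦ r - j, because the factor now contains Y_{j+1}. -/
theorem swapHom_sum_minus (f : Bimould) (r : ℕ) :
    swapHom r (∑ j ∈ Finset.Icc 1 (r - 1),
        (varX r j - varX r (j + 1) + varY r (j + 1)) * phi (j + 1) j f r) =
      ∑ j ∈ Finset.Icc 1 (r - 1),
        (varX r j - varX r (j + 1) + varY r (j + 1)) * phi (j + 1) j (swap f) r := by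
  rw [map_sum]
  refine sum_Icc_reflect _ _ _ fun j h1 h2 => ?_
  rw [map_mul, map_add, map_sub, ← swap_eq_swapHom, swap_phi ⟨by omega, by omega⟩ ⟨h1, by omega⟩,
    swapHom_varX ⟨h1, by omega⟩, swapHom_varX ⟨by omega, by omega⟩, swapHom_varY
    ⟨by omega, by omega⟩, swapX_sub _ (by omega)]
  unfold swapY
  rw [show r + 2 - (j + 1) = r - 1 + 1 - j + 1 by omega,
    show r + 1 - (j + 1) = r - 1 + 1 - j by omega,
    show r + 1 - j = r - 1 + 1 - j + 1 by omega, add_comm]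

theorem swapHom_sum_plus_plus (f : Bimould) (r : ℕ) :
    swapHom r (∑ j ∈ Finset.Icc 1 (r - 1), phi j j (phi j j f) r) =
      ∑ j ∈ Finset.Icc 1 (r - 1), phi j j (phi j j (swap f)) r := by
  rw [map_sum]
  refine sum_Icc_reflect _ _ _ fun j h1 h2 => ?_
  have e : swap (phi j j f) (r - 1) = phi (r - j) (r - j) (swap f) (r - 1) := by
    rw [swap_phi ⟨by omega, by omega⟩ ⟨by omega, by omega⟩, show r - 1 + 1 - j = r - j by omega]
  rw [← swap_eq_swapHom, swap_phi ⟨by omega, by omega⟩ ⟨by omega, by omega⟩,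
    show r - 1 + 1 - j = r - j by omega, ← phi_phi ⟨by omega, by omega⟩ ⟨by omega, by omega⟩,
    show r - j + 1 = r + 1 - j by omega]
  change (swap (phi j j f) (r - 1)).substXY _ _ = (phi _ _ (swap f) (r - 1)).substXY _ _
  rw [e]

theorem swapHom_sum_minus_minus (f : Bimould) (r : ℕ) :
    swapHom r (∑ j ∈ Finset.Icc 1 (r - 2), phi (j + 1) j (phi (j + 1) j f) r) =
      ∑ j ∈ Finset.Icc 1 (r - 2), phi (j + 1) j (phi (j + 1) j (swap f)) r := by
  rw [map_sum]
  refine sum_Icc_reflect _ _ _ fun j h1 h2 => ?_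
  have e : swap (phi (j + 1) j f) (r - 1) = phi (r - j) (r - 1 - j) (swap f) (r - 1) := by
    rw [swap_phi ⟨by omega, by omega⟩ ⟨by omega, by omega⟩, show r - 1 + 1 - j = r - j by omega,
      show r - 1 + 1 - (j + 1) = r - 1 - j by omega]
  rw [← swap_eq_swapHom, swap_phi ⟨by omega, by omega⟩ ⟨by omega, by omega⟩,
    show r - 2 + 1 - j = r - 1 - j by omega, ← phi_phi ⟨by omega, by omega⟩ ⟨by omega, by omega⟩,
    show r + 1 - (j + 1) = r - 1 - j + 1 by omega, show r - 1 - j + 1 + 1 = r + 1 - j by omega]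
  change (swap (phi (j + 1) j f) (r - 1)).substXY _ _ = (phi _ _ (swap f) (r - 1)).substXY _ _
  rw [e, show r - 1 - j + 1 = r - j by omega]

theorem swap_opDelta (f : Bimould) : swap (opDelta f) = opDelta (swap f) := by
  funext r
  have h := swap_sum_varX_mul_varY r
  rw [← substXYHom_apply (linSeq_swapX _) (linSeq_swapY _)] at h
  change swapHom r _ = _ at h
  rw [swap_eq_swapHom, opDelta_eq, opDelta_eq, map_sub, map_add, map_sub, map_sub, map_mul,
    map_smul, map_smul, map_smul, map_smul, swapHom_sum_plus, swapHom_sum_minus,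
    swapHom_sum_plus_plus, swapHom_sum_minus_minus, h, swap_eq_swapHom]

end SwapHom

end BimouldOperators

/-! ### The swap commutes with D and W -/

section SwapDerivatives

open MvPowerSeries

theorem pderiv_inl_varX (r i : ℕ) (j : Fin r) :
    pderiv QA (Sum.inl j) (varX r i) = if i = j + 1 then 1 else 0 := by
  classical
  unfold varX
  split_ifs with h h' h'
  · rw [show (⟨i - 1, by omega⟩ : Fin r) = j from Fin.ext (by simp; omega), pderiv_X_self]
  · rw [pderiv_X_of_ne]
    rw [Ne, Sum.inl.injEq, Fin.ext_iff]
    simp only; omega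
  · omega
  · simp

theorem pderiv_inr_varX (r i : ℕ) (j : Fin r) : pderiv QA (Sum.inr j) (varX r i) = 0 := by
  unfold varX
  split_ifs with h
  · rw [pderiv_X_of_ne (by simp)]
  · simp

theorem pderiv_inr_varY (r i : ℕ) (j : Fin r) :
    pderiv QA (Sum.inr j) (varY r i) = if i = j + 1 then 1 else 0 := by
  classical
  unfold varY
  split_ifs with h h' h'
  · rw [show (⟨i - 1, by omega⟩ : Fin r) = j from Fin.ext (by simp; omega), pderiv_X_self]
  · rw [pderiv_X_of_ne]
    rw [Ne, Sum.inr.injEq, Fin.ext_iff]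
    simp only; omega
  · omega
  · simp

theorem pderiv_inl_varY (r i : ℕ) (j : Fin r) : pderiv QA (Sum.inl j) (varY r i) = 0 := by
  unfold varY
  split_ifs with h
  · rw [pderiv_X_of_ne (by simp)]
  · simp

/-- Indices are counted from 0: the partial sum that replaces the i-th X contains the j-th Y exactly
if i + j < r. -/
theorem pderiv_inr_swapHom {r : ℕ} (j : Fin r) (g : Series r) :
    pderiv QA (Sum.inr j) (swapHom r g) =
      ∑ i : Fin r, (if (i : ℕ) + j < r then 1 else 0 : ℚ) •
        swapHom r (pderiv QA (Sum.inl i) g) := by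
  simp only [swapHom, substXYHom_apply, Series.substXY]
  rw [pderiv_subst ((linSeq_swapX r).hasSubst (linSeq_swapY r)), Fintype.sum_sum_type]
  simp only [Sum.elim_inl, Sum.elim_inr, swapX, swapY, map_sum, map_sub, pderiv_inr_varX,
    pderiv_inr_varY, sub_self, zero_mul, Finset.sum_const_zero, add_zero]
  refine Finset.sum_congr rfl fun i _ => ?_
  rw [Finset.sum_ite_eq']
  simp only [Finset.mem_Icc]
  by_cases h : (i : ℕ) + j < r
  · rw [if_pos ⟨by omega, by omega⟩, if_pos h, one_mul, one_smul]
  · rw [if_neg (by omega), if_neg h, zero_mul, zero_smul]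

theorem pderiv_inl_swapHom {r : ℕ} (j : Fin r) (g : Series r) :
    pderiv QA (Sum.inl j) (swapHom r g) =
      ∑ i : Fin r, ((if (i : ℕ) + j + 1 = r then 1 else 0) -
        (if (i : ℕ) + j = r then 1 else 0) : ℚ) • swapHom r (pderiv QA (Sum.inr i) g) := by
  simp only [swapHom, substXYHom_apply, Series.substXY]
  rw [pderiv_subst ((linSeq_swapX r).hasSubst (linSeq_swapY r)), Fintype.sum_sum_type]
  simp only [Sum.elim_inl, Sum.elim_inr, swapX, swapY, map_sum, map_sub, pderiv_inl_varX,
    pderiv_inl_varY, zero_mul, Finset.sum_const_zero, zero_add]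
  refine Finset.sum_congr rfl fun i _ => ?_
  rw [sub_smul, sub_mul]
  congr 1
  · by_cases h : (i : ℕ) + j + 1 = r
    · rw [if_pos (by omega), if_pos h, one_mul, one_smul]
    · rw [if_neg (by omega), if_neg h, zero_mul, zero_smul]
  · by_cases h : (i : ℕ) + j = r
    · rw [if_pos (by omega), if_pos h, one_mul, one_smul]
    · rw [if_neg (by omega), if_neg h, zero_mul, zero_smul]

/-- By the chain rule the swap transforms ∂/∂X by a difference matrix and ∂/∂Y by a summation
matrix. Their contraction over j is the identity matrix, so ∑ ∂/∂X_j ∂/∂Y_j is invariant. -/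
theorem swap_opD (f : Bimould) : swap (opD f) = opD (swap f) := by
  funext r
  rw [swap_eq_swapHom]
  unfold opD
  rw [swap_eq_swapHom]
  generalize f r = g
  simp only [pderiv_inr_swapHom, map_sum, pderiv_ratSMul, pderiv_inl_swapHom, Finset.smul_sum,
    smul_smul]
  rw [Finset.sum_comm]
  refine Finset.sum_congr rfl fun i _ => ?_
  rw [Finset.sum_comm]
  simp only [← Finset.sum_smul]
  have key : ∀ k : Fin r, (∑ j : Fin r, (if (i : ℕ) + j < r then 1 else 0) *
      ((if (k : ℕ) + j + 1 = r then 1 else 0) - (if (k : ℕ) + j = r then 1 else 0)) : ℚ)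
      = if k = i then 1 else 0 := by
    intro k
    have hk := k.2
    have hi := i.2
    have e1 : (∑ j : Fin r, (if (i : ℕ) + j < r then 1 else 0) *
        (if (k : ℕ) + j + 1 = r then 1 else 0) : ℚ) = if (i : ℕ) ≤ k then 1 else 0 := by
      rw [Finset.sum_eq_single ⟨r - 1 - k, by omega⟩]
      · simp only
        rw [if_pos (show (k : ℕ) + (r - 1 - k) + 1 = r by omega), mul_one]
        congr 1
        exact propext ⟨fun h => by omega, fun h => by omega⟩
      · intro j _ hj
        rw [if_neg (show ¬ (k : ℕ) + j + 1 = r from fun h => hj (Fin.ext (by simp; omega))),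
          mul_zero]
      · simp
    have e2 : (∑ j : Fin r, (if (i : ℕ) + j < r then 1 else 0) *
        (if (k : ℕ) + j = r then 1 else 0) : ℚ) = if (i : ℕ) < k then 1 else 0 := by
      rcases Nat.eq_zero_or_pos (k : ℕ) with h0 | h0
      · rw [if_neg (by omega)]
        refine Finset.sum_eq_zero fun j _ => ?_
        have := j.2
        rw [if_neg (show ¬ (k : ℕ) + j = r by omega), mul_zero]
      rw [Finset.sum_eq_single ⟨r - k, by omega⟩]
      · simp only
        rw [if_pos (show (k : ℕ) + (r - k) = r by omega), mul_one]
        congr 1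
        exact propext ⟨fun h => by omega, fun h => by omega⟩
      · intro j _ hj
        rw [if_neg (show ¬ (k : ℕ) + j = r from fun h => hj (Fin.ext (by simp; omega))),
          mul_zero]
      · simp
    simp only [mul_sub, Finset.sum_sub_distrib, e1, e2, Fin.ext_iff]
    rcases lt_trichotomy (i : ℕ) k with h | h | h
    · rw [if_pos (by omega), if_pos h, if_neg (by omega)]; simp
    · rw [if_pos (by omega), if_neg (by omega), if_pos (by omega)]; simp
    · rw [if_neg (by omega), if_neg (by omega), if_neg (by omega)]; simp
  simp only [key, ite_smul, one_smul, zero_smul]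
  rw [Finset.sum_ite_eq' Finset.univ i]
  simp only [Finset.mem_univ, if_true]
  congr 1
  -- What remains is that ∂/∂X_i and ∂/∂Y_i commute.
  ext n
  simp only [coeff_pderiv]
  rw [add_right_comm]
  simp [mul_right_comm]

theorem IsLinForm.euler {σ R : Type*} [Fintype σ] [CommRing R] [Algebra ℚ R]
    {g : MvPowerSeries σ R} (hg : IsLinForm g) : ∑ s, MvPowerSeries.X s * pderiv R s g = g := by
  classical
  obtain ⟨c, rfl⟩ := hg
  simp only [Finsupp.sum, map_sum, pderiv_ratSMul, Finset.mul_sum]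
  rw [Finset.sum_comm]
  refine Finset.sum_congr rfl fun t _ => ?_
  simp only [mul_smul_comm, ← Finset.smul_sum, pderiv_X]
  congr 1
  rw [Finset.sum_eq_single t]
  · simp
  · intro b _ hb; simp [hb.symm]
  · simp

theorem opW_eq (f : Bimould) (r : ℕ) :
    opW f r = (r : ℚ) • f r + ∑ s : Fin r ⊕ Fin r, X s * pderiv QA s (f r) := by
  unfold opW
  simp only [Derivation.leibniz, pderiv_X_self, smul_eq_mul, mul_one, Finset.sum_add_distrib,
    Fintype.sum_sum_type, Finset.sum_const, Finset.card_univ, Fintype.card_fin]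
  rw [← Nat.cast_smul_eq_nsmul ℚ]
  ring

/-- By `opW_eq`, W is r plus the Euler operator in all 2r variables, and the Euler operator is
invariant under every linear substitution. -/
theorem swap_opW (f : Bimould) : swap (opW f) = opW (swap f) := by
  funext r
  rw [swap_eq_swapHom, opW_eq, opW_eq, map_add, map_smul, map_sum, swap_eq_swapHom]
  congr 1
  simp only [map_mul]
  simp only [swapHom, substXYHom_apply]
  have ha : ∀ s, IsLinForm ((Sum.elim (fun i : Fin r => swapX r (i + 1))
      (fun i : Fin r => swapY r (i + 1)) : Fin r ⊕ Fin r → Series r) s) := by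
    rintro (i | i)
    exacts [linSeq_swapX r _, linSeq_swapY r _]
  have hs := (linSeq_swapX r).hasSubst (s := r) (linSeq_swapY r)
  unfold Series.substXY
  simp only [subst_X hs, pderiv_subst hs, Finset.mul_sum]
  rw [Finset.sum_comm]
  refine Finset.sum_congr rfl fun s _ => ?_
  conv_lhs => rw [← (ha s).euler]
  rw [Finset.sum_mul]
  exact Finset.sum_congr rfl fun _ _ => mul_assoc _ _ _

end SwapDerivatives

/-! ### From operators on series to maps on words -/

section Naturality

/-- An operator on bimoulds is natural if it commutes with linear maps of the coefficients. -/
def IsNatural (ρ : Bimould → Bimould) : Prop :=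
  ∀ (T : QA →ₗ[ℚ] QA) (f : Bimould) (r : ℕ),
    mapCoeff T (ρ f r) = ρ (fun r => mapCoeff T (f r)) r

theorem isNatural_swap : IsNatural swap := fun T f r =>
  mapCoeff_substXY T (linSeq_swapX r) (linSeq_swapY r) (f r)

theorem isNatural_phi (j m : ℕ) : IsNatural (phi j m) := fun T f r =>
  mapCoeff_substXY T (linSeq_skipX r j) (linSeq_mergeY r m) (f (r - 1))

theorem isNatural_opD : IsNatural opD := fun T f r => by
  unfold opD
  simp only [mapCoeff_sum, mapCoeff_pderiv]

theorem isNatural_opW : IsNatural opW := fun T f r => by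
  unfold opW
  simp only [mapCoeff_sum, mapCoeff_add, mapCoeff_pderiv, mapCoeff_X_mul]

theorem mapCoeff_varX_mul (T : QA →ₗ[ℚ] QA) (r j : ℕ) (g : Series r) :
    mapCoeff T (varX r j * g) = varX r j * mapCoeff T g := by
  unfold varX
  split_ifs
  · exact mapCoeff_X_mul T _ _
  · simp [mapCoeff_zero]

theorem mapCoeff_varY_mul (T : QA →ₗ[ℚ] QA) (r j : ℕ) (g : Series r) :
    mapCoeff T (varY r j * g) = varY r j * mapCoeff T g := by
  unfold varY
  split_ifs
  · exact mapCoeff_X_mul T _ _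
  · simp [mapCoeff_zero]

theorem isNatural_opDelta : IsNatural opDelta := fun T f r => by
  have h := fun j m f r => isNatural_phi j m T f r
  rw [opDelta_eq, opDelta_eq]
  simp only [mapCoeff_add, mapCoeff_sub, mapCoeff_smul, mapCoeff_sum, Finset.sum_mul, add_mul,
    sub_mul, mul_assoc, mapCoeff_varX_mul, mapCoeff_varY_mul, h]

/-- The word with exponent `n`. -/
def wordOf {r : ℕ} (n : Fin r ⊕ Fin r →₀ ℕ) : List Letter :=
  List.ofFn fun j : Fin r => ((n (Sum.inl j)).succPNat, n (Sum.inr j))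

theorem onWords_word (ρ : Bimould → Bimould) (w : List Letter) :
    onWords ρ (word w) = (∏ j : Fin w.length, ((w.get j).2.factorial : ℚ)) •
      MvPowerSeries.coeff (exponent w) (ρ genSeries w.length) :=
  wordLift_word _ _

theorem onWords_wordOf (ρ : Bimould → Bimould) {r : ℕ} (n : Fin r ⊕ Fin r →₀ ℕ) :
    onWords ρ (word (wordOf n)) = (∏ j : Fin r, ((n (Sum.inr j)).factorial : ℚ)) •
      MvPowerSeries.coeff n (ρ genSeries r) := by
  have key : ∀ (w : List Letter) (h : w.length = r), w = wordOf n →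
      (∏ j : Fin w.length, ((w.get j).2.factorial : ℚ)) •
        MvPowerSeries.coeff (exponent w) (ρ genSeries w.length) =
      (∏ j : Fin r, ((n (Sum.inr j)).factorial : ℚ)) • MvPowerSeries.coeff n (ρ genSeries r) := by
    intro w h hw
    subst h
    have hg : ∀ j : Fin w.length, w.get j = ((n (Sum.inl j)).succPNat, n (Sum.inr j)) := by
      intro j
      have : w.get j = (wordOf n)[(j : ℕ)]'(by simp [wordOf]) := by
        simp only [List.get_eq_getElem]
        congr 1
      rw [this]
      simp [wordOf]
    have hn : exponent w = n := by
      ext s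
      rcases s with s | s <;> simp only [exponent, Finsupp.equivFunOnFinite_symm_apply_apply,
        Sum.elim_inl, Sum.elim_inr, hg]
      simp
    rw [hn]
    simp only [hg]
  rw [onWords_word]
  exact key _ (by simp [wordOf]) rfl

theorem coeff_genSeries {r : ℕ} (n : Fin r ⊕ Fin r →₀ ℕ) :
    MvPowerSeries.coeff n (genSeries r) =
      (∏ j : Fin r, ((n (Sum.inr j)).factorial : ℚ))⁻¹ • word (wordOf n) := rfl

/-- The defining property of the induced map; it trades a map on coefficients for an operator on
series. -/
theorem mapCoeff_onWords_genSeries (ρ : Bimould → Bimould) (r : ℕ) :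
    mapCoeff (onWords ρ) (genSeries r) = ρ genSeries r := by
  ext n
  rw [coeff_mapCoeff, coeff_genSeries, map_smul, onWords_wordOf, inv_smul_smul₀]
  exact Finset.prod_ne_zero_iff.2 fun j _ => by positivity

/-- Composition is reversed: naturality of ρ' moves the linear map induced by ρ inside ρ', where it
turns the generating series into its image under ρ. -/
theorem onWords_onWords {ρ ρ' : Bimould → Bimould} (h : IsNatural ρ') (u : QA) :
    onWords ρ (onWords ρ' u) = onWords (ρ' ∘ ρ) u := by
  have : (onWords ρ).comp (onWords ρ') = onWords (ρ' ∘ ρ) := words_hom_ext fun w => by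
    rw [LinearMap.comp_apply, onWords_word, onWords_word, map_smul]
    congr 1
    rw [← coeff_mapCoeff, h]
    simp only [mapCoeff_onWords_genSeries]
    rfl
  exact LinearMap.congr_fun this u

theorem onWords_swap_comm {ρ : Bimould → Bimould} (hρ : IsNatural ρ)
    (h : ∀ f, swap (ρ f) = ρ (swap f)) (u : QA) :
    onWords ρ (onWords swap u) = onWords swap (onWords ρ u) := by
  rw [onWords_onWords isNatural_swap, onWords_onWords hρ]
  congr 2
  funext f
  exact h f

end Naturality

/-! ### Coefficients after merging variables -/

section CoefficientsOfSubst

open MvPowerSeries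

/-- The coefficients of a power series in which each variable is replaced by a sum of variables,
for pairwise disjoint sets of variables. -/
theorem factorial_smul_coeff_subst {σ τ R : Type*} [Fintype σ] [Fintype τ]
    [CommRing R] [Algebra ℚ R] (S : τ → Finset σ) (hS : ∀ s t t', s ∈ S t → s ∈ S t' → t = t')
    (f : MvPowerSeries τ R) (n : σ →₀ ℕ) :
    (∏ s, ((n s).factorial : ℚ)) • coeff n (subst (fun t => ∑ s ∈ S t, (X s : MvPowerSeries σ R)) f)
      = open scoped Classical in if ∀ s, (∀ t, s ∉ S t) → n s = 0 then
        (∏ t, ((∑ s ∈ S t, n s).factorial : ℚ)) •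
          coeff (Finsupp.equivFunOnFinite.symm fun t => ∑ s ∈ S t, n s) f else 0 := by
  classical
  set a : τ → MvPowerSeries σ R := fun t => ∑ s ∈ S t, (X s : MvPowerSeries σ R) with ha
  have hlin : ∀ t, IsLinForm (a t) := fun t => IsLinForm.sum _ fun s _ => IsLinForm.X s
  have hs : HasSubst a := hasSubst_of_constantCoeff_zero fun t => (hlin t).constantCoeff
  have hd : ∀ s t, pderiv R s (a t) = if s ∈ S t then 1 else 0 := by
    intro s t
    simp only [ha, map_sum, pderiv_X, Pi.single_apply]
    exact Finset.sum_ite_eq' _ _ _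
  have h0 : ∀ f : MvPowerSeries τ R, constantCoeff (subst a f) = constantCoeff f := by
    intro f
    have : f = C (constantCoeff f) + (f - C (constantCoeff f)) := by ring
    rw [this, subst_add hs, map_add, subst_C, constantCoeff_subst_eq_zero hs
      (fun t => (hlin t).constantCoeff) (by simp)]
    simp
  induction hdeg : n.degree generalizing n f with
  | zero =>
    rw [Finsupp.degree_eq_zero_iff] at hdeg
    subst hdeg
    have : (Finsupp.equivFunOnFinite.symm fun t => ∑ s ∈ S t, (0 : σ →₀ ℕ) s) = 0 := by
      ext t; simp
    rw [this, if_pos (by simp), coeff_zero_eq_constantCoeff, h0]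
    simp
  | succ d ih =>
    obtain ⟨s, hsn⟩ : ∃ s, n s ≠ 0 := by
      by_contra! h
      have : n = 0 := Finsupp.ext h
      simp [this] at hdeg
    obtain ⟨m, rfl⟩ : ∃ m, n = m + Finsupp.single s 1 :=
      ⟨n - Finsupp.single s 1, (tsub_add_cancel_of_le
        (Finsupp.single_le_iff.2 (Nat.one_le_iff_ne_zero.2 hsn))).symm⟩
    have hm : m.degree = d := by simpa using hdeg
    have hfac : (∏ s', (((m + Finsupp.single s 1 : σ →₀ ℕ) s').factorial : ℚ)) =
        (∏ s', ((m s').factorial : ℚ)) * (m s + 1) := by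
      rw [← Finset.mul_prod_erase _ _ (Finset.mem_univ s),
        ← Finset.mul_prod_erase _ (fun s' => ((m s').factorial : ℚ)) (Finset.mem_univ s)]
      have : ∀ s' ∈ Finset.univ.erase s, (((m + Finsupp.single s 1 : σ →₀ ℕ) s').factorial : ℚ) =
          ((m s').factorial : ℚ) := fun s' hs' => by
        simp [Finsupp.single_eq_of_ne (Finset.ne_of_mem_erase hs')]
      rw [Finset.prod_congr rfl this]
      simp [Nat.factorial_succ]
      ring
    have key : ((m s : ℚ) + 1) • coeff (m + Finsupp.single s 1) (subst a f)
        = coeff m (pderiv R s (subst a f)) := by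
      rw [coeff_pderiv, Algebra.smul_def, mul_comm]
      simp
    rw [hfac, mul_smul, key, pderiv_subst hs]
    simp only [hd]
    -- The sets are disjoint, so ∂/∂X_s acts on at most one of the sums and becomes a single ∂/∂X_t.
    -- If s lies in no set, the substituted series does not involve X_s, and n s ≠ 0 violates the
    -- condition on the right.
    by_cases hex : ∃ t, s ∈ S t
    · obtain ⟨t, ht⟩ := hex
      rw [Finset.sum_eq_single t
        (fun t' _ ht' => by rw [if_neg (fun h => ht' (hS s _ _ h ht)), zero_mul]) (by simp),
        if_pos ht, one_mul, ih _ _ hm]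
      have hsum : ∀ t', ∑ s' ∈ S t', (m + Finsupp.single s 1 : σ →₀ ℕ) s' =
          (∑ s' ∈ S t', m s') + if t' = t then 1 else 0 := by
        intro t'
        simp only [Finsupp.add_apply, Finset.sum_add_distrib]
        congr 1
        simp only [Finsupp.single_apply]
        rw [Finset.sum_ite_eq]
        congr 1
        exact propext ⟨fun h => hS s _ _ h ht, fun h => h ▸ ht⟩
      have hcond : (∀ s', (∀ t, s' ∉ S t) → (m + Finsupp.single s 1 : σ →₀ ℕ) s' = 0) ↔
          ∀ s', (∀ t, s' ∉ S t) → m s' = 0 := by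
        refine forall₂_congr fun s' hs' => ?_
        have : s' ≠ s := fun e => hs' t (e ▸ ht)
        simp [Finsupp.single_eq_of_ne this]
      simp only [hcond]
      split_ifs
      · have e1 : (Finsupp.equivFunOnFinite.symm fun t' => ∑ s' ∈ S t',
            (m + Finsupp.single s 1 : σ →₀ ℕ) s') =
            (Finsupp.equivFunOnFinite.symm fun t' => ∑ s' ∈ S t', m s') + Finsupp.single t 1 := by
          ext t'
          refine (hsum t').trans ?_
          simp only [Finsupp.equivFunOnFinite_symm_apply_apply, Finsupp.add_apply,
            Finsupp.single_apply, eq_comm]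
        rw [e1, coeff_pderiv]
        simp only [hsum]
        have e2 : (∏ t', (((∑ s' ∈ S t', m s') + if t' = t then 1 else 0).factorial : ℚ)) =
            (∏ t', ((∑ s' ∈ S t', m s').factorial : ℚ)) * ((∑ s' ∈ S t, m s' : ℕ) + 1) := by
          rw [← Finset.mul_prod_erase _ _ (Finset.mem_univ t),
            ← Finset.mul_prod_erase _ (fun t' => ((∑ s' ∈ S t', m s').factorial : ℚ))
              (Finset.mem_univ t)]
          have : ∀ t' ∈ Finset.univ.erase t,
              (((∑ s' ∈ S t', m s') + if t' = t then 1 else 0).factorial : ℚ) =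
              ((∑ s' ∈ S t', m s').factorial : ℚ) := fun t' ht' => by
            rw [if_neg (Finset.ne_of_mem_erase ht'), add_zero]
          rw [Finset.prod_congr rfl this, if_pos rfl, Nat.factorial_succ]
          push_cast
          ring
        rw [e2, mul_smul]
        congr 1
        rw [Algebra.smul_def, mul_comm]
        simp
      · simp
    · push Not at hex
      rw [Finset.sum_eq_zero fun t _ => by rw [if_neg (hex t), zero_mul], if_neg]
      · simp
      · intro h
        simpa using h s hex

end CoefficientsOfSubst

/-! ### Normalised coefficients indexed by words -/

section WordCoefficients

/-- The exponent in depth `r` of a word of length `r`. -/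
def expo (r : ℕ) (w : List Letter) : Fin r ⊕ Fin r →₀ ℕ :=
  Finsupp.equivFunOnFinite.symm (Sum.elim (fun j => (w.getD j (1, 0)).1.natPred)
    (fun j => (w.getD j (1, 0)).2))

theorem expo_inl {r : ℕ} (w : List Letter) (j : Fin r) :
    expo r w (Sum.inl j) = (w.getD j (1, 0)).1.natPred := rfl

theorem expo_inr {r : ℕ} (w : List Letter) (j : Fin r) :
    expo r w (Sum.inr j) = (w.getD j (1, 0)).2 := rfl

/-- The factor `d_1! ⋯ d_r!`. -/
def factorials (w : List Letter) : ℚ := (w.map fun a => (a.2.factorial : ℚ)).prod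

/-- The coefficient of `X_1^{k_1-1} ⋯ X_r^{k_r-1} Y_1^{d_1}/d_1! ⋯ Y_r^{d_r}/d_r!`. -/
def wordCoeff (r : ℕ) (w : List Letter) : Series r →ₗ[ℚ] QA where
  toFun g := factorials w • MvPowerSeries.coeff (expo r w) g
  map_add' g h := by rw [map_add, smul_add]
  map_smul' q g := by
    change factorials w • (q • MvPowerSeries.coeff _ g) = q • factorials w • MvPowerSeries.coeff _ g
    exact smul_comm _ _ _

theorem wordCoeff_apply (r : ℕ) (w : List Letter) (g : Series r) :
    wordCoeff r w g = factorials w • MvPowerSeries.coeff (expo r w) g := rfl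

theorem prod_fin_getD {M : Type*} [CommMonoid M] (w : List Letter) (F : Letter → M) {r : ℕ}
    (h : w.length = r) : ∏ j : Fin r, F (w.getD j (1, 0)) = (w.map F).prod := by
  subst h
  rw [← List.prod_ofFn]
  congr 1
  refine List.ext_getElem (by simp) fun i h1 h2 => ?_
  simp only [List.length_ofFn] at h1
  simp [List.getD_eq_getElem?_getD]

theorem wordOf_expo {r : ℕ} (w : List Letter) (h : w.length = r) : wordOf (expo r w) = w := by
  subst h
  refine List.ext_getElem (by simp [wordOf]) fun i h1 h2 => ?_
  simp [wordOf, expo_inl, expo_inr]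

theorem onWords_eq_wordCoeff (ρ : Bimould → Bimould) {r : ℕ} (w : List Letter)
    (h : w.length = r) : onWords ρ (word w) = wordCoeff r w (ρ genSeries r) := by
  conv_lhs => rw [← wordOf_expo w h, onWords_wordOf]
  rw [wordCoeff_apply, factorials, ← prod_fin_getD w (fun a => (a.2.factorial : ℚ)) h]
  rfl

theorem wordCoeff_genSeries {r : ℕ} (w : List Letter) (h : w.length = r) :
    wordCoeff r w (genSeries r) = word w := by
  rw [wordCoeff_apply, coeff_genSeries, wordOf_expo w h, factorials,
    ← prod_fin_getD w (fun a => (a.2.factorial : ℚ)) h]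
  refine smul_inv_smul₀ (Finset.prod_ne_zero_iff.2 fun j _ => ?_) _
  positivity

theorem getD_append_cons (u v : List Letter) (a : Letter) (i : ℕ) (d : Letter) :
    (u ++ a :: v).getD i d = if i < u.length then u.getD i d else if i = u.length then a
      else v.getD (i - u.length - 1) d := by
  rcases lt_trichotomy i u.length with h | h | h
  · rw [if_pos h, List.getD_append _ _ _ _ h]
  · subst h
    rw [if_neg (lt_irrefl _), if_pos rfl, List.getD_append_right _ _ _ _ le_rfl]
    simp
  · rw [if_neg (by omega), if_neg (by omega), List.getD_append_right _ _ _ _ h.le]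
    obtain ⟨k, rfl⟩ : ∃ k, i = u.length + 1 + k := ⟨i - u.length - 1, by omega⟩
    rw [show u.length + 1 + k - u.length = k + 1 by omega]
    simp

theorem factorials_append_cons (u v : List Letter) (a : Letter) :
    factorials (u ++ a :: v) = factorials (u ++ v) * (a.2.factorial : ℚ) := by
  simp [factorials]; ring

open MvPowerSeries in
theorem coeff_X_mul_eq {σ R : Type*} [CommRing R] (s : σ) (n : σ →₀ ℕ)
    (g : MvPowerSeries σ R) :
    coeff n (X s * g) = if n s = 0 then 0 else coeff (n - Finsupp.single s 1) g := by
  classical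
  rw [X, coeff_monomial_mul, one_mul]
  by_cases h : n s = 0
  · rw [if_neg (by rw [Finsupp.single_le_iff]; omega), if_pos h]
  · rw [if_pos (by rw [Finsupp.single_le_iff]; omega), if_neg h]

theorem wordCoeff_varX_mul {r : ℕ} (u v : List Letter) (a : Letter) (h : u.length < r)
    (g : Series r) : wordCoeff r (u ++ a :: v) (varX r (u.length + 1) * g) =
      if a.1.natPred = 0 then 0
      else wordCoeff r (u ++ ((a.1.natPred - 1).succPNat, a.2) :: v) g := by
  have hX : varX r (u.length + 1) = MvPowerSeries.X (Sum.inl ⟨u.length, h⟩) := by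
    unfold varX
    rw [dif_pos ⟨by omega, h⟩]
    rfl
  rw [wordCoeff_apply, hX, coeff_X_mul_eq, expo_inl]
  simp only [getD_append_cons, lt_irrefl, if_false, if_true]
  split_ifs with h0
  · rw [smul_zero]
  · rw [wordCoeff_apply, factorials_append_cons, factorials_append_cons]
    refine congrArg (fun n => (_ : ℚ) • MvPowerSeries.coeff n g) ?_
    refine Finsupp.ext fun s => ?_
    rcases s with s | s <;>
      simp only [Finsupp.tsub_apply, expo_inl, expo_inr, getD_append_cons]
    · by_cases hs : (s : ℕ) = u.length
      · have : s = ⟨u.length, h⟩ := Fin.ext hs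
        subst this
        simp
      · rw [Finsupp.single_eq_of_ne (by
          rw [Ne, Sum.inl.injEq]; rintro rfl; exact hs rfl), Nat.sub_zero, if_neg hs, if_neg hs]
    · rw [Finsupp.single_eq_of_ne (by simp), Nat.sub_zero]
      split_ifs <;> rfl

theorem wordCoeff_varY_mul {r : ℕ} (u v : List Letter) (a : Letter) (h : u.length < r)
    (g : Series r) : wordCoeff r (u ++ a :: v) (varY r (u.length + 1) * g) =
      (a.2 : ℚ) • wordCoeff r (u ++ (a.1, a.2 - 1) :: v) g := by
  have hX : varY r (u.length + 1) = MvPowerSeries.X (Sum.inr ⟨u.length, h⟩) := by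
    unfold varY
    rw [dif_pos ⟨by omega, h⟩]
    rfl
  rw [wordCoeff_apply, hX, coeff_X_mul_eq, expo_inr]
  simp only [getD_append_cons, lt_irrefl, if_false, if_true]
  split_ifs with h0
  · rw [h0]; simp
  · rw [wordCoeff_apply, factorials_append_cons, factorials_append_cons, smul_smul]
    congr 1
    · rw [mul_left_comm]
      congr 1
      exact_mod_cast (Nat.mul_factorial_pred h0).symm
    refine congrArg (fun n => MvPowerSeries.coeff n g) ?_
    refine Finsupp.ext fun s => ?_
    rcases s with s | s <;>
      simp only [Finsupp.tsub_apply, expo_inl, expo_inr, getD_append_cons]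
    · rw [Finsupp.single_eq_of_ne (by simp), Nat.sub_zero]
      split_ifs <;> rfl
    · by_cases hs : (s : ℕ) = u.length
      · have : s = ⟨u.length, h⟩ := Fin.ext hs
        subst this
        simp
      · rw [Finsupp.single_eq_of_ne (by
          rw [Ne, Sum.inr.injEq]; rintro rfl; exact hs rfl), Nat.sub_zero, if_neg hs, if_neg hs]

/-- The sets of variables that are replaced by one variable of `f_{r-1}` in `phi`. -/
def phiFibre (s j m : ℕ) : Fin s ⊕ Fin s → Finset (Fin (s + 1) ⊕ Fin (s + 1)) :=
  Sum.elim (fun i => {Sum.inl (if i + 1 < j then i.castSucc else i.succ)})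
    (fun i => if i + 1 < m then {Sum.inr i.castSucc}
      else if i + 1 = m then {Sum.inr i.castSucc, Sum.inr i.succ} else {Sum.inr i.succ})

theorem phi_eq_subst (j m s : ℕ) (f : Bimould) : phi j m f (s + 1) =
    MvPowerSeries.subst (fun t => ∑ v ∈ phiFibre s j m t, MvPowerSeries.X v) (f s) := by
  unfold phi Series.substXY
  congr 1
  have hx : ∀ i : ℕ, (h : i < s + 1) → varX (s + 1) (i + 1) = MvPowerSeries.X (Sum.inl ⟨i, h⟩) := by
    intro i h
    unfold varX
    rw [dif_pos ⟨by omega, by omega⟩]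
    rfl
  have hy : ∀ i : ℕ, (h : i < s + 1) → varY (s + 1) (i + 1) = MvPowerSeries.X (Sum.inr ⟨i, h⟩) := by
    intro i h
    unfold varY
    rw [dif_pos ⟨by omega, by omega⟩]
    rfl
  funext t
  rcases t with i | i
  · simp only [Sum.elim_inl, phiFibre, Finset.sum_singleton, skipX]
    split_ifs
    · exact hx _ (by omega)
    · exact hx _ (by omega)
  · simp only [Sum.elim_inr, phiFibre, mergeY]
    split_ifs with h1 h2
    · rw [Finset.sum_singleton]
      exact hy _ (by omega)
    · rw [Finset.sum_pair (by simp [Fin.ext_iff]), ← h2]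
      exact congrArg₂ _ (hy _ (by omega)) (hy _ (by omega))
    · rw [Finset.sum_singleton]
      exact hy _ (by omega)

theorem phiFibre_disjoint (s j m : ℕ) (v : Fin (s + 1) ⊕ Fin (s + 1)) (t t' : Fin s ⊕ Fin s)
    (h : v ∈ phiFibre s j m t) (h' : v ∈ phiFibre s j m t') : t = t' := by
  rcases t with t | t <;> rcases t' with t' | t' <;> rcases v with v | v <;>
    simp only [phiFibre, Sum.elim_inl, Sum.elim_inr, Finset.mem_singleton, Sum.inl.injEq,
      Sum.inr.injEq, reduceCtorEq] at h h' ⊢ <;> split_ifs at h h' <;>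
    simp only [Finset.mem_singleton, Finset.mem_insert, Fin.ext_iff,
      Sum.inr.injEq, reduceCtorEq, or_self, Fin.val_castSucc, Fin.val_succ] at h h' ⊢ <;> omega

/-- Since (Y_m + Y_{m+1})^d/d! is the sum of all products of divided powers with exponents adding up
to d, normalised coefficients show no binomials: merging just adds two entries d. X_j does not occur
in the result, which forces k_j = 1; for m = s + 1 neither does the last Y, which forces its
exponent to be 0. -/
theorem coeff_phi {j m s : ℕ} (hj : 1 ≤ j ∧ j ≤ s + 1) (hm : 1 ≤ m ∧ m ≤ s + 1) (f : Bimould)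
    {w w' : List Letter} (hw : w.length = s + 1) (hw' : w'.length = s)
    (h1 : ∀ i < s, (w'.getD i (1, 0)).1 =
      if i + 1 < j then (w.getD i (1, 0)).1 else (w.getD (i + 1) (1, 0)).1)
    (h2 : ∀ i < s, (w'.getD i (1, 0)).2 = if i + 1 < m then (w.getD i (1, 0)).2
      else if i + 1 = m then (w.getD i (1, 0)).2 + (w.getD (i + 1) (1, 0)).2
      else (w.getD (i + 1) (1, 0)).2)
    (h3 : (w.getD (j - 1) (1, 0)).1.natPred = 0 →
      (w.map fun a => (a.1.natPred.factorial : ℚ)).prod = (w'.map fun a => (a.1.natPred.factorial : ℚ)).prod) :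
    wordCoeff (s + 1) w (phi j m f (s + 1)) =
      if (w.getD (j - 1) (1, 0)).1.natPred = 0 ∧ (m = s + 1 → (w.getD s (1, 0)).2 = 0) then
        wordCoeff s w' (f s) else 0 := by
  classical
  have key := factorial_smul_coeff_subst (phiFibre s j m) (phiFibre_disjoint s j m) (f s)
    (expo (s + 1) w)
  rw [← phi_eq_subst] at key
  have hexp : (Finsupp.equivFunOnFinite.symm fun t => ∑ v ∈ phiFibre s j m t, expo (s + 1) w v) =
      expo s w' := by
    ext t
    rcases t with t | t
    · simp only [Finsupp.equivFunOnFinite_symm_apply_apply, phiFibre, Sum.elim_inl,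
        Finset.sum_singleton, expo_inl, h1 t t.2]
      split_ifs <;> rfl
    · simp only [Finsupp.equivFunOnFinite_symm_apply_apply, phiFibre, Sum.elim_inr, expo_inr,
        h2 t t.2]
      split_ifs
      · rfl
      · rw [Finset.sum_pair (by simp [Fin.ext_iff])]; rfl
      · rfl
  have hval : ∀ t, ∑ v ∈ phiFibre s j m t, expo (s + 1) w v = expo s w' t := fun t => by
    rw [← hexp]; rfl
  have hcond : (∀ v, (∀ t, v ∉ phiFibre s j m t) → expo (s + 1) w v = 0) ↔
      (w.getD (j - 1) (1, 0)).1.natPred = 0 ∧ (m = s + 1 → (w.getD s (1, 0)).2 = 0) := by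
    constructor
    · intro h
      refine ⟨h (Sum.inl ⟨j - 1, by omega⟩) ?_, fun hms => h (Sum.inr ⟨s, by omega⟩) ?_⟩
      · rintro (t | t) ht
        · simp only [phiFibre, Sum.elim_inl, Finset.mem_singleton, Sum.inl.injEq] at ht
          split_ifs at ht <;>
            simp only [Fin.ext_iff, Fin.val_castSucc, Fin.val_succ] at ht <;> omega
        · simp only [phiFibre, Sum.elim_inr] at ht
          split_ifs at ht <;> simp at ht
      · rintro (t | t) ht
        · simp [phiFibre] at ht
        · have := t.2
          simp only [phiFibre, Sum.elim_inr, if_pos (show (t : ℕ) + 1 < m by omega),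
            Finset.mem_singleton, Sum.inr.injEq, Fin.ext_iff, Fin.val_castSucc] at ht
          omega
    · rintro ⟨ha, hb⟩ (v | v) hv
      · by_cases hvj : (v : ℕ) = j - 1
        · rw [expo_inl, hvj, ha]
        · exfalso
          have := v.2
          by_cases hlt : (v : ℕ) + 1 < j
          · refine hv (Sum.inl ⟨v, by omega⟩) ?_
            simp only [phiFibre, Sum.elim_inl, Finset.mem_singleton, if_pos hlt]
            rfl
          · refine hv (Sum.inl ⟨v - 1, by omega⟩) ?_
            simp only [phiFibre, Sum.elim_inl, Finset.mem_singleton,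
              if_neg (show ¬ (v : ℕ) - 1 + 1 < j by omega), Sum.inl.injEq, Fin.ext_iff,
              Fin.val_succ]
            omega
      · have := v.2
        by_cases hvs : m = s + 1 ∧ (v : ℕ) = s
        · rw [expo_inr, hvs.2, hb hvs.1]
        · exfalso
          by_cases hlt : (v : ℕ) < m ∧ (v : ℕ) < s
          · refine hv (Sum.inr ⟨v, by omega⟩) ?_
            simp only [phiFibre, Sum.elim_inr]
            split_ifs
            · simp
            · simp
            · omega
          · refine hv (Sum.inr ⟨v - 1, by omega⟩) ?_
            simp only [phiFibre, Sum.elim_inr]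
            rw [if_neg (by omega)]
            split_ifs <;> simp only [Finset.mem_singleton, Finset.mem_insert, Sum.inr.injEq,
              Fin.ext_iff, Fin.val_castSucc, Fin.val_succ] <;> omega
  simp only [hexp, hcond] at key
  simp only [hval] at key
  have hfac : ∀ {r : ℕ} (u : List Letter), u.length = r → (∏ v, ((expo r u v).factorial : ℚ)) =
      (u.map fun a => (a.1.natPred.factorial : ℚ)).prod * factorials u := by
    intro r u hu
    rw [Fintype.prod_sum_type, factorials,
      ← prod_fin_getD u (fun a => (a.1.natPred.factorial : ℚ)) hu,
      ← prod_fin_getD u (fun a => (a.2.factorial : ℚ)) hu]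
    rfl
  rw [hfac w hw, hfac w' hw'] at key
  -- The general formula also carries the factorials (k - 1)! of the X-exponents; they agree on both
  -- sides by `h3` and are cancelled.
  have hne : (w.map fun a => (a.1.natPred.factorial : ℚ)).prod ≠ 0 := by
    refine List.prod_ne_zero fun h => ?_
    obtain ⟨a, _, ha⟩ := List.mem_map.1 h
    exact Nat.factorial_ne_zero _ (by exact_mod_cast ha)
  refine smul_right_injective QA hne ?_
  change _ • _ = _ • _
  simp only [smul_ite, smul_zero, wordCoeff_apply, smul_smul]
  refine key.trans (if_ctx_congr Iff.rfl (fun h => ?_) fun _ => rfl)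
  rw [h3 h.1]

end WordCoefficients

/-! ### Local operators as sums over positions -/

section Prefixes

variable {L : Type*}

/-- Prepending a word to every word. -/
def prefixL (u : List L) : Words L →ₗ[ℚ] Words L := wordLift fun w => word (u ++ w)

theorem prefixL_word (u w : List L) : prefixL u (word w) = word (u ++ w) := wordLift_word _ _

theorem prefixL_cons (a : L) (u : List L) (f : Words L) :
    prefixL (a :: u) f = consL a (prefixL u f) := by
  have : prefixL (a :: u) = (consL a).comp (prefixL u) := words_hom_ext fun w => by
    rw [LinearMap.comp_apply, prefixL_word, prefixL_word, consL_word]; rfl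
  exact LinearMap.congr_fun this f

theorem localWord_eq_sum (P : Words L →ₗ[ℚ] Words L) (w : List L) :
    localWord P w = ∑ p ∈ Finset.range w.length, prefixL (w.take p) (P (word (w.drop p))) := by
  induction w with
  | nil => rfl
  | cons a w ih =>
    have h0 : prefixL ([] : List L) = LinearMap.id := words_hom_ext fun w => prefixL_word _ _
    rw [localWord, List.length_cons, Finset.sum_range_succ', ih, map_sum]
    simp [prefixL_cons, h0]

theorem localOp_word (P : Words L →ₗ[ℚ] Words L) (w : List L) :
    localOp P (word w) = localWord P w := wordLift_word _ _

variable [AddCommSemigroup L]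

theorem LocalData.head_one (X : LocalData L) (a : L) :
    X.head (word [a]) = prepend (X.one a) (word []) + X.endOne a • word [] := by
  rw [LocalData.head, ← consL_word a, headOp_consL, LinearMap.add_apply, headOp_nil]
  rfl

theorem LocalData.head_two (X : LocalData L) (a b : L) :
    X.head (word [a, b]) = prepend (X.one a) (word [b]) + (prepend (X.two a b) (word [])
      + X.endTwo a b • word []) := by
  rw [LocalData.head, ← consL_word a, headOp_consL, LinearMap.add_apply, ← consL_word b,
    headOp_consL, LinearMap.add_apply, headOp_nil]
  rfl

theorem LocalData.head_three (X : LocalData L) (a b c : L) (w : List L) :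
    X.head (word (a :: b :: c :: w)) = prepend (X.one a) (word (b :: c :: w))
      + (prepend (X.two a b) (word (c :: w)) + prepend (X.three a b c) (word w)) := by
  rw [LocalData.head, ← consL_word a, headOp_consL, LinearMap.add_apply, ← consL_word b,
    headOp_consL, LinearMap.add_apply, ← consL_word c, headOp_consL]

theorem LocalData.head_of_one (X : LocalData L) (h2 : ∀ a b, X.two a b = 0)
    (h3 : ∀ a b c, X.three a b c = 0) (e1 : ∀ a, X.endOne a = 0) (e2 : ∀ a b, X.endTwo a b = 0)
    (a : L) (w : List L) : X.head (word (a :: w)) = prepend (X.one a) (word w) := by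
  rcases w with _ | ⟨b, _ | ⟨c, w⟩⟩
  · simp [X.head_one, e1]
  · simp [X.head_two, h2, e2]
  · simp [X.head_three, h2, h3]

end Prefixes

/-- Brings the sums of different lengths in `opDelta_eq` to the common index set of positions in a
word. -/
theorem sum_Icc_sub {M : Type*} [AddCommMonoid M] (r k : ℕ) (g : ℕ → M) :
    ∑ j ∈ Finset.Icc 1 (r - k), g j =
      ∑ p ∈ Finset.range r, if p + 1 + k ≤ r then g (p + 1) else 0 := by
  rw [← Finset.sum_filter]
  have h1 : (Finset.range r).filter (fun p => p + 1 + k ≤ r) = Finset.Ico 0 (r - k) := by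
    ext p; simp; omega
  have h2 : Finset.Icc 1 (r - k) = Finset.Ico (0 + 1) (r - k + 1) := by
    ext p; simp
  rw [h1, h2, Finset.sum_Ico_add']

theorem sum_Icc_eq_sum_range {M : Type*} [AddCommMonoid M] (r : ℕ) (g : ℕ → M) :
    ∑ j ∈ Finset.Icc 1 r, g j = ∑ p ∈ Finset.range r, g (p + 1) := by
  have := sum_Icc_sub r 0 g
  rw [Nat.sub_zero] at this
  rw [this]
  exact Finset.sum_congr rfl fun p hp => if_pos (by rw [Finset.mem_range] at hp; omega)

/-! ### The induced maps on words are the local derivations -/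

section WordFormulas

variable (u v : List Letter) (a b c d : Letter)

theorem getD_append_of_lt {i : ℕ} (h : i < u.length) : (u ++ v).getD i d = u.getD i d :=
  List.getD_append _ _ _ _ h

theorem getD_append_self : (u ++ a :: v).getD u.length d = a := by
  rw [List.getD_append_right _ _ _ _ le_rfl, Nat.sub_self]; rfl

theorem getD_append_add (k : ℕ) : (u ++ v).getD (u.length + k) d = v.getD k d := by
  rw [List.getD_append_right _ _ _ _ (Nat.le_add_right _ _), Nat.add_sub_cancel_left]

/-- Common source of the formulas for φ^+ and φ^-: the letters a, b merge their entries d, and one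
of them, called e, loses its entry k, which must be 1. -/
theorem wordCoeff_phi_pair {s j : ℕ} (f : Bimould) (h : (u ++ a :: b :: v).length = s + 1)
    {k : ℕ+} (hj : j = u.length + 1 ∧ k = b.1 ∨ j = u.length + 2 ∧ k = a.1) {e : Letter}
    (he : (u ++ a :: b :: v).getD (j - 1) (1, 0) = e) (hab : a.1 = k ∧ b.1 = e.1 ∨ a.1 = e.1 ∧ b.1 = k) :
    wordCoeff (s + 1) (u ++ a :: b :: v) (phi j (u.length + 1) f (s + 1)) =
      if e.1.natPred = 0 then wordCoeff s (u ++ (k, a.2 + b.2) :: v) (f s) else 0 := by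
  simp only [List.length_append, List.length_cons] at h
  rw [coeff_phi (w' := u ++ (k, a.2 + b.2) :: v) (by omega) (by omega) f
    (by simp; omega) (by simp; omega)]
  · rw [he]
    exact if_congr (and_iff_left (by omega)) rfl rfl
  · intro i hi
    rcases lt_trichotomy i u.length with hu | hu | hu
    · rw [getD_append_of_lt _ _ _ hu, getD_append_of_lt _ _ _ hu, if_pos (by omega)]
    · subst hu
      rw [getD_append_self, getD_append_self, getD_append_add]
      rcases hj with ⟨rfl, rfl⟩ | ⟨rfl, rfl⟩
      · rw [if_neg (by omega)]; rfl
      · rw [if_pos (by omega)]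
    · obtain ⟨n, rfl⟩ : ∃ n, i = u.length + (1 + n) := ⟨i - u.length - 1, by omega⟩
      rw [if_neg (by omega), getD_append_add, add_assoc, getD_append_add, add_comm 1 n]
      rfl
  · intro i hi
    rcases lt_trichotomy i u.length with hu | hu | hu
    · rw [getD_append_of_lt _ _ _ hu, getD_append_of_lt _ _ _ hu, if_pos (by omega)]
    · subst hu
      rw [if_neg (by omega), if_pos rfl, getD_append_self, getD_append_self, getD_append_add]
      rfl
    · obtain ⟨n, rfl⟩ : ∃ n, i = u.length + (1 + n) := ⟨i - u.length - 1, by omega⟩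
      rw [if_neg (by omega), if_neg (by omega), getD_append_add, add_assoc, getD_append_add,
        add_comm 1 n]
      rfl
  · rw [he]
    intro h0
    rcases hab with ⟨ha, hb⟩ | ⟨ha, hb⟩ <;> simp [ha, hb, h0]

theorem wordCoeff_phi_plus {s : ℕ} (f : Bimould) (h : (u ++ a :: b :: v).length = s + 1) :
    wordCoeff (s + 1) (u ++ a :: b :: v) (phi (u.length + 1) (u.length + 1) f (s + 1)) =
      if a.1.natPred = 0 then wordCoeff s (u ++ (b.1, a.2 + b.2) :: v) (f s) else 0 :=
  wordCoeff_phi_pair u v a b f h (Or.inl ⟨rfl, rfl⟩) (getD_append_self u _ _ _) (by simp)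

theorem wordCoeff_phi_minus {s : ℕ} (f : Bimould) (h : (u ++ a :: b :: v).length = s + 1) :
    wordCoeff (s + 1) (u ++ a :: b :: v) (phi (u.length + 2) (u.length + 1) f (s + 1)) =
      if b.1.natPred = 0 then wordCoeff s (u ++ (a.1, a.2 + b.2) :: v) (f s) else 0 :=
  wordCoeff_phi_pair u v a b f h (Or.inr ⟨rfl, rfl⟩) (getD_append_add u _ _ 1) (by simp)

theorem wordCoeff_phi_last (f : Bimould) :
    wordCoeff (u.length + 1) (u ++ [a]) (phi (u.length + 1) (u.length + 1) f (u.length + 1)) =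
      if a.1.natPred = 0 ∧ a.2 = 0 then wordCoeff u.length u (f u.length) else 0 := by
  rw [coeff_phi (w' := u) (by omega) (by omega) f (by simp) rfl]
  · rw [Nat.add_sub_cancel, getD_append_self]
    simp
  · intro i hi
    rw [getD_append_of_lt _ _ _ hi, if_pos (by omega)]
  · intro i hi
    rw [getD_append_of_lt _ _ _ hi, if_pos (by omega)]
  · rw [Nat.add_sub_cancel, getD_append_self]
    intro h0
    simp [h0]

theorem wordCoeff_varX_succ_mul {r : ℕ} (h : u.length + 1 < r) (g : Series r) :
    wordCoeff r (u ++ a :: b :: v) (varX r (u.length + 2) * g) =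
      if b.1.natPred = 0 then 0
      else wordCoeff r (u ++ a :: ((b.1.natPred - 1).succPNat, b.2) :: v) g := by
  have := wordCoeff_varX_mul (u ++ [a]) v b (by simpa using h) g
  simpa using this

theorem wordCoeff_varY_succ_mul {r : ℕ} (h : u.length + 1 < r) (g : Series r) :
    wordCoeff r (u ++ a :: b :: v) (varY r (u.length + 2) * g) =
      (b.2 : ℚ) • wordCoeff r (u ++ a :: (b.1, b.2 - 1) :: v) g := by
  have := wordCoeff_varY_mul (u ++ [a]) v b (by simpa using h) g
  simpa using this

theorem prefixL_prepend_letterAt (n e : ℕ) (w : List Letter) :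
    prefixL u (prepend (letterAt n e) (word w)) = word (u ++ (n.succPNat, e) :: w) := by
  rw [letterAt, prepend_single, one_smul, consL_word, prefixL_word]

theorem wordCoeff_one {r : ℕ} (h : (u ++ a :: v).length = r) :
    wordCoeff r (u ++ a :: v) (varX r (u.length + 1) * varY r (u.length + 1) * genSeries r) =
      prefixL u (prepend (dataDelta.one a) (word v)) := by
  have h' : u.length < r := by simp at h; omega
  rw [mul_assoc, wordCoeff_varX_mul _ _ _ h', wordCoeff_varY_mul _ _ _ h', wordCoeff_genSeries]
  · simp only [dataDelta, lowerAt]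
    split_ifs
    · simp
    · rw [map_smul, LinearMap.smul_apply, map_smul, prefixL_prepend_letterAt]
  · simp at h ⊢; omega

/-- φ_j^+ and φ_{j+1}^- both merge the letters at j and j + 1 and differ only in which entry k is
deleted, so they are collected into the same local datum. -/
theorem wordCoeff_two {r : ℕ} (h : (u ++ a :: b :: v).length = r) :
    -(1 / 2 : ℚ) • wordCoeff r (u ++ a :: b :: v)
        ((varX r (u.length + 1) - varX r (u.length + 2) + varY r (u.length + 1)) *
          phi (u.length + 1) (u.length + 1) genSeries r)
      - (1 / 2 : ℚ) • wordCoeff r (u ++ a :: b :: v)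
        ((varX r (u.length + 1) - varX r (u.length + 2) + varY r (u.length + 2)) *
          phi (u.length + 2) (u.length + 1) genSeries r) =
      prefixL u (prepend (dataDelta.two a b) (word v)) := by
  obtain ⟨s, rfl⟩ : ∃ s, r = s + 1 := ⟨r - 1, by simp at h; omega⟩
  obtain ⟨k, d⟩ := a
  obtain ⟨l, e⟩ := b
  obtain ⟨m, rfl⟩ : ∃ m : ℕ, k = m.succPNat := ⟨k.natPred, by simp⟩
  obtain ⟨n, rfl⟩ : ∃ n : ℕ, l = n.succPNat := ⟨l.natPred, by simp⟩
  have h0 : u.length + v.length + 1 = s := by simp at h; omega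
  have h1 : u.length + 1 < s + 1 := by omega
  have h2 : u.length < s + 1 := by omega
  have h3 : ∀ a b : Letter, (u ++ a :: b :: v).length = s + 1 := by intros; simp; omega
  have h4 : ∀ a : Letter, (u ++ a :: v).length = s := by intros; simp; omega
  simp only [add_mul, sub_mul, map_add, map_sub, wordCoeff_varX_mul _ _ _ h2,
    wordCoeff_varY_mul _ _ _ h2, wordCoeff_varX_succ_mul _ _ _ _ h1,
    wordCoeff_varY_succ_mul _ _ _ _ h1, wordCoeff_phi_plus _ _ _ _ _ (h3 _ _),
    wordCoeff_phi_minus _ _ _ _ _ (h3 _ _), wordCoeff_genSeries _ (h4 _), Nat.natPred_succPNat]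
  simp only [dataDelta, lowerAt, map_add, map_sub, LinearMap.add_apply, LinearMap.sub_apply,
    Nat.natPred_succPNat]
  rcases m with _ | _ | m <;> rcases n with _ | _ | n <;>
    simp [prefixL_prepend_letterAt] <;> module

theorem wordCoeff_three {r : ℕ} (h : (u ++ a :: b :: c :: v).length = r) :
    (1 / 4 : ℚ) • wordCoeff r (u ++ a :: b :: c :: v)
        (phi (u.length + 1) (u.length + 1) (phi (u.length + 1) (u.length + 1) genSeries) r)
      - (1 / 4 : ℚ) • wordCoeff r (u ++ a :: b :: c :: v)
        (phi (u.length + 2) (u.length + 1) (phi (u.length + 2) (u.length + 1) genSeries) r) =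
      prefixL u (prepend (dataDelta.three a b c) (word v)) := by
  obtain ⟨s, rfl⟩ : ∃ s, r = s + 2 := ⟨r - 2, by simp at h; omega⟩
  obtain ⟨k, d⟩ := a
  obtain ⟨l, e⟩ := c
  obtain ⟨m, rfl⟩ : ∃ m : ℕ, k = m.succPNat := ⟨k.natPred, by simp⟩
  obtain ⟨n, rfl⟩ : ∃ n : ℕ, l = n.succPNat := ⟨l.natPred, by simp⟩
  have h3 : ∀ a b : Letter, (u ++ a :: b :: v).length = s + 1 := by
    intros; simp at h ⊢; omega
  have h4 : ∀ a : Letter, (u ++ a :: v).length = s := by intros; simp at h ⊢; omega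
  simp only [wordCoeff_phi_plus _ _ _ _ _ h, wordCoeff_phi_plus _ _ _ _ _ (h3 _ _),
    wordCoeff_phi_minus _ _ _ _ _ h, wordCoeff_phi_minus _ _ _ _ _ (h3 _ _),
    wordCoeff_genSeries _ (h4 _), dataDelta, map_sub, LinearMap.sub_apply]
  simp only [Nat.natPred_succPNat]
  by_cases hb : b.1.natPred = 0 <;> rcases m with _ | m <;> rcases n with _ | n <;>
    simp [hb, prefixL_prepend_letterAt, add_assoc]

theorem wordCoeff_end_one :
    -(1 / 2 : ℚ) • wordCoeff (u.length + 1) (u ++ [a])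
        ((varX (u.length + 1) (u.length + 1) - varX (u.length + 1) (u.length + 2)
          + varY (u.length + 1) (u.length + 1)) *
          phi (u.length + 1) (u.length + 1) genSeries (u.length + 1)) =
      dataDelta.endOne a • word u := by
  obtain ⟨k, d⟩ := a
  obtain ⟨m, rfl⟩ : ∃ m : ℕ, k = m.succPNat := ⟨k.natPred, by simp⟩
  have hX : varX (u.length + 1) (u.length + 2) = 0 := by
    unfold varX
    rw [dif_neg (by omega)]
  rw [hX, sub_zero, add_mul, map_add, wordCoeff_varX_mul _ _ _ (by omega),
    wordCoeff_varY_mul _ _ _ (by omega), wordCoeff_phi_last, wordCoeff_phi_last,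
    wordCoeff_genSeries _ rfl]
  simp only [dataDelta, Nat.natPred_succPNat]
  rcases m with _ | _ | m <;> rcases d with _ | _ | d <;> simp

theorem wordCoeff_end_two :
    (1 / 4 : ℚ) • wordCoeff (u.length + 2) (u ++ [a, b])
        (phi (u.length + 1) (u.length + 1) (phi (u.length + 1) (u.length + 1) genSeries)
          (u.length + 2)) =
      dataDelta.endTwo a b • word u := by
  rw [wordCoeff_phi_plus u [] a b _ (by simp), wordCoeff_phi_last, wordCoeff_genSeries _ rfl]
  simp only [dataDelta]
  by_cases ha : a.1.natPred = 0 <;> by_cases hb : b.1.natPred = 0 <;>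
    simp [ha, hb]

/-- The terms of `opDelta_eq` are sorted by the first position that they touch, which is also how
`localWord_eq_sum` sorts a local operator. -/
theorem onWords_opDelta (f : QA) : onWords opDelta f = derDelta f := by
  suffices h : onWords opDelta = localOp dataDelta.head from LinearMap.congr_fun h f
  refine words_hom_ext fun w => ?_
  rw [onWords_eq_wordCoeff _ w rfl, localOp_word, localWord_eq_sum, opDelta_eq]
  simp only [Finset.sum_mul, map_add, map_sub, map_smul, map_sum]
  simp only [sum_Icc_eq_sum_range w.length, sum_Icc_sub, Finset.smul_sum, smul_ite, smul_zero]
  rw [← Finset.sum_sub_distrib, ← Finset.sum_sub_distrib, ← Finset.sum_add_distrib,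
    ← Finset.sum_sub_distrib]
  refine Finset.sum_congr rfl fun p hp => ?_
  rw [Finset.mem_range] at hp
  obtain ⟨u, t, rfl, rfl⟩ : ∃ u t, w = u ++ t ∧ p = u.length :=
    ⟨w.take p, w.drop p, by simp, by simp; omega⟩
  rw [List.take_left, List.drop_left]
  -- One or two remaining letters leave room for the terms at the end, where the last Y is dropped;
  -- with three or more letters only the merging terms occur.
  match t with
  | [] => simp at hp
  | [a] =>
    have hl : (u ++ [a]).length = u.length + 1 := by simp
    rw [if_neg (by omega), if_neg (by omega), if_neg (by omega), wordCoeff_one _ _ _ rfl, hl,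
      dataDelta.head_one, map_add, map_smul, prefixL_word, List.append_nil, ← wordCoeff_end_one]
    module
  | [a, b] =>
    have hl : (u ++ [a, b]).length = u.length + 2 := by simp
    rw [if_pos (by omega), if_pos (by omega), if_neg (by omega), wordCoeff_one _ _ _ rfl,
      dataDelta.head_two, map_add, map_add, map_smul, prefixL_word, List.append_nil,
      ← wordCoeff_end_two, ← wordCoeff_two _ _ _ _ rfl, hl]
    module
  | a :: b :: c :: v =>
    have hl : (u ++ a :: b :: c :: v).length = u.length + v.length + 3 := by simp; omega
    rw [if_pos (by omega), if_pos (by omega), if_pos (by omega), wordCoeff_one _ _ _ rfl,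
      dataDelta.head_three, map_add, map_add, ← wordCoeff_three _ _ _ _ _ rfl,
      ← wordCoeff_two _ _ _ _ rfl]
    module

open MvPowerSeries in
theorem wordCoeff_pderiv_inl {r : ℕ} (h : u.length < r) (g : Series r) :
    wordCoeff r (u ++ a :: v) (pderiv QA (Sum.inl ⟨u.length, h⟩) g) =
      (a.1 : ℚ) • wordCoeff r (u ++ (a.1 + 1, a.2) :: v) g := by
  rw [wordCoeff_apply, wordCoeff_apply, coeff_pderiv, expo_inl]
  simp only [getD_append_self]
  have he : expo r (u ++ a :: v) + Finsupp.single (Sum.inl ⟨u.length, h⟩) 1 =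
      expo r (u ++ (a.1 + 1, a.2) :: v) := by
    ext (s | s) <;> simp only [Finsupp.add_apply, expo_inl, expo_inr, getD_append_cons]
    · by_cases hs : (s : ℕ) = u.length
      · obtain rfl : s = ⟨u.length, h⟩ := Fin.ext hs
        simp [natPred_add_one_pnat]
      · rw [Finsupp.single_eq_of_ne (by
          rw [Ne, Sum.inl.injEq]; rintro rfl; exact hs rfl), add_zero, if_neg hs, if_neg hs]
    · rw [Finsupp.single_eq_of_ne (by simp), add_zero]
      split_ifs <;> rfl
  have hq : ((a.1.natPred : QA) + 1) = algebraMap ℚ QA a.1 := by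
    rw [cast_eq_natPred]; simp
  rw [he, hq, mul_comm, ← Algebra.smul_def, smul_comm]
  simp [factorials]

open MvPowerSeries in
theorem wordCoeff_pderiv_inr {r : ℕ} (h : u.length < r) (g : Series r) :
    wordCoeff r (u ++ a :: v) (pderiv QA (Sum.inr ⟨u.length, h⟩) g) =
      wordCoeff r (u ++ (a.1, a.2 + 1) :: v) g := by
  rw [wordCoeff_apply, wordCoeff_apply, coeff_pderiv, expo_inr]
  simp only [getD_append_self]
  have he : expo r (u ++ a :: v) + Finsupp.single (Sum.inr ⟨u.length, h⟩) 1 =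
      expo r (u ++ (a.1, a.2 + 1) :: v) := by
    ext (s | s) <;> simp only [Finsupp.add_apply, expo_inl, expo_inr, getD_append_cons]
    · rw [Finsupp.single_eq_of_ne (by simp), add_zero]
      split_ifs <;> rfl
    · by_cases hs : (s : ℕ) = u.length
      · obtain rfl : s = ⟨u.length, h⟩ := Fin.ext hs
        simp
      · rw [Finsupp.single_eq_of_ne (by
          rw [Ne, Sum.inr.injEq]; rintro rfl; exact hs rfl), add_zero, if_neg hs, if_neg hs]
  have hq : ((a.2 : QA) + 1) = algebraMap ℚ QA (a.2 + 1) := by simp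
  rw [he, hq, mul_comm, ← Algebra.smul_def, smul_smul, factorials_append_cons,
    factorials_append_cons, Nat.factorial_succ]
  congr 1
  push_cast
  ring

theorem onWords_opD (f : QA) : onWords opD f = derD f := by
  suffices h : onWords opD = localOp dataD.head from LinearMap.congr_fun h f
  refine words_hom_ext fun w => ?_
  rw [onWords_eq_wordCoeff _ w rfl, localOp_word, localWord_eq_sum, opD, map_sum,
    ← Fin.sum_univ_eq_sum_range (fun p => prefixL (w.take p) (dataD.head (word (w.drop p))))]
  refine Finset.sum_congr rfl fun p _ => ?_
  obtain ⟨p, hp⟩ := p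
  obtain ⟨u, a, v, rfl, rfl⟩ : ∃ u a v, w = u ++ a :: v ∧ p = u.length :=
    ⟨w.take p, w[p], w.drop (p + 1), by simp, by simp; omega⟩
  rw [wordCoeff_pderiv_inl _ _ _ hp, wordCoeff_pderiv_inr _ _ _ hp,
    wordCoeff_genSeries _ (by simp), List.take_left, List.drop_left,
    dataD.head_of_one (fun _ _ => rfl) (fun _ _ _ => rfl) (fun _ => rfl) (fun _ _ => rfl)]
  simp [dataD, prepend_single, consL_word, prefixL_word]

theorem onWords_opW (f : QA) : onWords opW f = derW f := by
  suffices h : onWords opW = localOp dataW.head from LinearMap.congr_fun h f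
  refine words_hom_ext fun w => ?_
  rw [onWords_eq_wordCoeff _ w rfl, localOp_word, localWord_eq_sum, opW, map_sum,
    ← Fin.sum_univ_eq_sum_range (fun p => prefixL (w.take p) (dataW.head (word (w.drop p))))]
  refine Finset.sum_congr rfl fun p _ => ?_
  obtain ⟨p, hp⟩ := p
  obtain ⟨u, a, v, rfl, rfl⟩ : ∃ u a v, w = u ++ a :: v ∧ p = u.length :=
    ⟨w.take p, w[p], w.drop (p + 1), by simp, by simp; omega⟩
  have hX : MvPowerSeries.X (Sum.inl ⟨u.length, hp⟩) =
      varX (u ++ a :: v).length (u.length + 1) := by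
    unfold varX
    rw [dif_pos ⟨by omega, hp⟩]
    rfl
  have hY : MvPowerSeries.X (Sum.inr ⟨u.length, hp⟩) =
      varY (u ++ a :: v).length (u.length + 1) := by
    unfold varY
    rw [dif_pos ⟨by omega, hp⟩]
    rfl
  rw [map_add, wordCoeff_pderiv_inl _ _ _ hp, hX, hY, wordCoeff_varX_mul _ _ _ hp,
    wordCoeff_varY_mul _ _ _ hp, wordCoeff_pderiv_inr _ _ _ hp, List.take_left, List.drop_left,
    dataW.head_of_one (fun _ _ => rfl) (fun _ _ _ => rfl) (fun _ => rfl) (fun _ _ => rfl)]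
  simp only [natPred_add_one_pnat, Nat.add_sub_cancel, PNat.succPNat_natPred]
  rw [if_neg (by omega), wordCoeff_genSeries _ rfl]
  by_cases h : a.2 = 0
  · simp [dataW, prepend_single, consL_word, prefixL_word, h]
  · rw [Nat.sub_add_cancel (Nat.pos_of_ne_zero h), wordCoeff_genSeries _ rfl]
    simp [dataW, prepend_single, consL_word, prefixL_word, add_smul]

end WordFormulas

/-! ### Descent to FMES -/

section InducedDerivations

theorem proj_surjective : Function.Surjective proj := Ideal.Quotient.mkₐ_surjective ℚ swapIdeal

theorem proj_eq_zero_iff {f : QA} : proj f = 0 ↔ f ∈ swapIdeal := Ideal.Quotient.eq_zero_iff_mem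

theorem proj_onWords_swap (f : QA) : proj (onWords swap f) = proj f := by
  rw [← sub_eq_zero, ← map_sub, proj_eq_zero_iff]
  exact Ideal.subset_span ⟨f, rfl⟩

/-- A generator σ(g) - g goes to the generator σ(dg) - dg, and the Leibniz rule covers multiples of
generators. -/
theorem map_mem_swapIdeal (d : Derivation ℚ QA QA)
    (hd : ∀ f, d (onWords swap f) = onWords swap (d f)) {f : QA} (hf : f ∈ swapIdeal) :
    d f ∈ swapIdeal := by
  refine Submodule.span_induction ?_ ?_ ?_ ?_ hf
  · rintro _ ⟨g, rfl⟩
    rw [map_sub, hd]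
    exact Ideal.subset_span ⟨d g, rfl⟩
  · rw [map_zero]
    exact zero_mem _
  · intro g h _ _ hg hh
    rw [map_add]
    exact add_mem hg hh
  · intro a g hg hdg
    rw [smul_eq_mul, Derivation.leibniz]
    exact add_mem (Ideal.mul_mem_left _ _ hdg) (Ideal.mul_mem_right _ _ hg)

/-- The derivation of `FMES` induced by a derivation of `ℚ⟨A⟩` that commutes with the swap. -/
def inducedDer (d : Derivation ℚ QA QA) (hd : ∀ f, d (onWords swap f) = onWords swap (d f)) :
    Derivation ℚ FMES FMES :=
  Derivation.liftOfSurjective proj_surjective (d := d) fun _ hf =>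
    proj_eq_zero_iff.2 (map_mem_swapIdeal d hd (proj_eq_zero_iff.1 hf))

theorem inducedDer_proj (d : Derivation ℚ QA QA)
    (hd : ∀ f, d (onWords swap f) = onWords swap (d f)) (f : QA) :
    inducedDer d hd (proj f) = proj (d f) :=
  Derivation.liftOfSurjective_apply proj_surjective (fun _ hf =>
    proj_eq_zero_iff.2 (map_mem_swapIdeal d hd (proj_eq_zero_iff.1 hf))) f

theorem derD_swap (f : QA) : derD (onWords swap f) = onWords swap (derD f) := by
  rw [← onWords_opD, ← onWords_opD, onWords_swap_comm isNatural_opD swap_opD]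

theorem derW_swap (f : QA) : derW (onWords swap f) = onWords swap (derW f) := by
  rw [← onWords_opW, ← onWords_opW, onWords_swap_comm isNatural_opW swap_opW]

theorem derDelta_swap (f : QA) : derDelta (onWords swap f) = onWords swap (derDelta f) := by
  rw [← onWords_opDelta, ← onWords_opDelta, onWords_swap_comm isNatural_opDelta swap_opDelta]

/-- The derivation `D` of `FMES`. -/
def fmesD : Derivation ℚ FMES FMES := inducedDer derD derD_swap

/-- The derivation `W` of `FMES`. -/
def fmesW : Derivation ℚ FMES FMES := inducedDer derW derW_swap

/-- The derivation `δ` of `FMES`. -/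
def fmesDelta : Derivation ℚ FMES FMES := inducedDer derDelta derDelta_swap

theorem fmesD_proj (f : QA) : fmesD (proj f) = proj (derD f) := inducedDer_proj _ _ f

theorem fmesW_proj (f : QA) : fmesW (proj f) = proj (derW f) := inducedDer_proj _ _ f

theorem fmesDelta_proj (f : QA) : fmesDelta (proj f) = proj (derDelta f) := inducedDer_proj _ _ f

theorem lie_fmesW_fmesD : ⁅fmesW, fmesD⁆ = (2 : ℚ) • fmesD := by
  refine Derivation.ext fun g => ?_
  obtain ⟨f, rfl⟩ := proj_surjective g
  rw [Derivation.commutator_apply, Derivation.smul_apply]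
  simp only [fmesD_proj, fmesW_proj, derW_derD, map_add, map_smul]
  abel

theorem lie_fmesW_fmesDelta : ⁅fmesW, fmesDelta⁆ = (-2 : ℚ) • fmesDelta := by
  refine Derivation.ext fun g => ?_
  obtain ⟨f, rfl⟩ := proj_surjective g
  rw [Derivation.commutator_apply, Derivation.smul_apply]
  simp only [fmesDelta_proj, fmesW_proj, derDelta_derW, map_add, map_smul]
  module

theorem lie_fmesDelta_fmesD : ⁅fmesDelta, fmesD⁆ = fmesW := by
  refine Derivation.ext fun g => ?_
  obtain ⟨f, rfl⟩ := proj_surjective g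
  rw [Derivation.commutator_apply]
  simp only [fmesDelta_proj, fmesD_proj, fmesW_proj, derDelta_derD, map_add, map_smul]
  module

end InducedDerivations

/-! ### Lower weight zero and the formula for δ -/

section LowerWeightZero

/-- The embedding `ℌ¹ → ℚ⟨A⟩`, `z_k ↦ [k; 0]`. -/
def embH1 : H1 →ₗ[ℚ] QA := wordLift fun ks => word (ks.map fun k => (k, 0))

theorem embH1_word (ks : List ℕ+) : embH1 (word ks) = word (ks.map fun k => (k, 0)) :=
  wordLift_word _ _

theorem embH1_consL (k : ℕ+) (f : H1) : embH1 (consL k f) = consL (k, 0) (embH1 f) := by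
  have : embH1.comp (consL k) = (consL (k, 0)).comp embH1 := words_hom_ext fun ks => by
    simp [consL_word, embH1_word]
  exact LinearMap.congr_fun this f

theorem proj_embH1 (f : H1) : proj (embH1 f) = eisLin f := by
  have : proj.toLinearMap.comp embH1 = eisLin := words_hom_ext fun ks => by
    rw [LinearMap.comp_apply, embH1_word, eisLin, wordLift_word]; rfl
  exact LinearMap.congr_fun this f

theorem embH1_mul_word : ∀ w v : List ℕ+,
    embH1 (word w * word v) = embH1 (word w) * embH1 (word v)
  | [], v => by
      rw [embH1_word []]
      exact (congrArg embH1 (one_mul (word v))).trans (one_mul (embH1 (word v))).symm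
  | a :: w, [] => by
      rw [embH1_word []]
      exact (congrArg embH1 (mul_one (word (a :: w)))).trans (mul_one (embH1 (word (a :: w)))).symm
  | a :: w, b :: v => by
      have h1 := embH1_mul_word w (b :: v)
      have h2 := embH1_mul_word (a :: w) v
      have h3 := embH1_mul_word w v
      simp only [← consL_word] at *
      rw [consL_mul_consL]
      simp only [map_add, embH1_consL] at *
      rw [consL_mul_consL, h1, h2, h3]
      rfl
  termination_by w v => w.length + v.length

theorem embH1_mul (f g : H1) : embH1 (f * g) = embH1 f * embH1 g := by
  have : (LinearMap.mul ℚ H1).compr₂ embH1 = (LinearMap.mul ℚ QA).compl₁₂ embH1 embH1 :=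
    words_hom_ext fun w => words_hom_ext fun v => embH1_mul_word w v
  exact LinearMap.congr_fun (LinearMap.congr_fun this f) g

/-- The homomorphism `ℌ¹ → FMES`, `z_k ↦ G^f(k)`. -/
def eisHom : H1 →ₐ[ℚ] FMES :=
  proj.comp (AlgHom.ofLinearMap embH1 (embH1_word []) embH1_mul)

theorem eisHom_apply (f : H1) : eisHom f = eisLin f := proj_embH1 f

/-- As the range of an algebra homomorphism, Fil^lwt_0 is a subalgebra. -/
theorem toSubmodule_range_eisHom : Subalgebra.toSubmodule eisHom.range = filLwt 0 := by
  refine le_antisymm ?_ (Submodule.span_le.2 ?_)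
  · rintro _ ⟨f, rfl⟩
    change eisHom f ∈ _
    rw [eisHom_apply]
    have h : (filLwt 0).mkQ.comp eisLin = 0 := words_hom_ext fun ks => by
      rw [LinearMap.comp_apply, eisLin, wordLift_word, LinearMap.zero_apply, Submodule.mkQ_apply,
        Submodule.Quotient.mk_eq_zero]
      exact Submodule.subset_span ⟨_, by simp [lwt, Function.comp_def], rfl⟩
    exact (Submodule.Quotient.mk_eq_zero _).1 (LinearMap.congr_fun h f)
  · rintro _ ⟨w, hw, rfl⟩
    refine ⟨word (w.map Prod.fst), ?_⟩
    change eisHom _ = _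
    rw [eisHom_apply, eisLin, wordLift_word, eis, eisWord]
    congr 2
    rw [List.map_map]
    refine (List.map_congr_left fun a ha => ?_).trans (List.map_id w)
    have : a.2 = 0 := by
      have h0 := Nat.le_zero.1 hw
      rw [lwt, List.sum_eq_zero_iff] at h0
      exact h0 _ (List.mem_map_of_mem ha)
    exact Prod.ext rfl this.symm

/-- `[k_1, …, k_r; 0, …, 0]`. -/
def depthWord (ks : List ℕ+) : QA := word (ks.map fun k => (k, 0))

theorem consL_depthWord (k : ℕ+) (ks : List ℕ+) :
    consL (k, 0) (depthWord ks) = depthWord (k :: ks) := consL_word _ _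

/-- The terms of `δ` in which `1` is removed and the entry after it is lowered. -/
def lowerNext (ks : List ℕ+) : QA := ∑ j ∈ Finset.range (ks.length - 1),
  if ks[j]? = some 1 ∧ 1 < ks.getD (j + 1) 1 then
    depthWord (ks.take j ++ (ks.getD (j + 1) 1 - 1) :: ks.drop (j + 2)) else 0

/-- The terms of `δ` in which `1` is removed and the entry before it is lowered. -/
def lowerPrev (ks : List ℕ+) : QA := ∑ j ∈ Finset.Ico 1 ks.length,
  if ks[j]? = some 1 ∧ 1 < ks.getD (j - 1) 1 then
    depthWord (ks.take (j - 1) ++ (ks.getD (j - 1) 1 - 1) :: ks.drop (j + 1)) else 0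

theorem lowerNext_cons (a b : ℕ+) (ks : List ℕ+) : lowerNext (a :: b :: ks) =
    consL (a, 0) (lowerNext (b :: ks)) +
      if a = 1 ∧ 1 < b then depthWord ((b - 1) :: ks) else 0 := by
  unfold lowerNext
  simp only [List.length_cons, Nat.add_sub_cancel]
  rw [Finset.sum_range_succ', map_sum]
  simp [apply_ite (consL ((a, 0) : Letter)), consL_depthWord]

theorem lowerPrev_cons (a b : ℕ+) (ks : List ℕ+) : lowerPrev (a :: b :: ks) =
    consL (a, 0) (lowerPrev (b :: ks)) +
      if b = 1 ∧ 1 < a then depthWord ((a - 1) :: ks) else 0 := by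
  unfold lowerPrev
  simp only [Finset.sum_Ico_eq_sum_range, List.length_cons, Nat.add_sub_cancel]
  rw [Finset.sum_range_succ', map_sum]
  simp [apply_ite (consL ((a, 0) : Letter)), consL_depthWord, add_comm 1]

theorem prepend_letterAt_depthWord (k : ℕ+) (ks : List ℕ+) :
    prepend (letterAt k.natPred 0) (depthWord ks) = depthWord (k :: ks) := by
  rw [letterAt, prepend_single, one_smul, PNat.succPNat_natPred, consL_depthWord]

theorem prepend_lowerAt_depthWord (k : ℕ+) (ks : List ℕ+) :
    prepend (lowerAt k.natPred 0) (depthWord ks) =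
      if 1 < k then depthWord ((k - 1) :: ks) else 0 := by
  obtain ⟨n, rfl⟩ : ∃ n : ℕ, k = n.succPNat := ⟨k.natPred, by simp⟩
  rcases n with _ | n
  · rw [if_neg (by decide), Nat.natPred_succPNat, lowerAt_zero, map_zero, LinearMap.zero_apply]
  · have h : 1 < (n + 1).succPNat := by rw [← PNat.coe_lt_coe]; simp
    have h' : (n + 1).succPNat - 1 = n.succPNat := by
      apply PNat.eq; rw [PNat.sub_coe, if_pos h]; simp
    rw [if_pos h, h', Nat.natPred_succPNat, lowerAt_succ, letterAt, prepend_single, one_smul,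
      consL_depthWord]

theorem prepend_dataDelta_one (k : ℕ+) (f : QA) : prepend (dataDelta.one (k, 0)) f = 0 := by
  simp [dataDelta]

theorem prepend_dataDelta_two (a b : ℕ+) (ks : List ℕ+) :
    prepend (dataDelta.two (a, 0) (b, 0)) (depthWord ks) =
      -(1 / 2 : ℚ) • (if a = 2 then depthWord (b :: ks) else 0)
      + (1 / 2 : ℚ) • (if a = 1 ∧ 1 < b then depthWord ((b - 1) :: ks) else 0)
      + (1 / 2 : ℚ) • (if b = 2 then depthWord (a :: ks) else 0)
      - (1 / 2 : ℚ) • (if b = 1 ∧ 1 < a then depthWord ((a - 1) :: ks) else 0) := by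
  have h1 : ∀ k : ℕ+, k.natPred = 0 ↔ k = 1 := fun k => by
    rw [← PNat.natPred_inj]; rfl
  have h2 : ∀ k : ℕ+, k.natPred = 1 ↔ k = 2 := fun k => by
    rw [← PNat.natPred_inj]; rfl
  simp only [dataDelta, h1, h2, ite_and, add_zero, Nat.cast_zero, zero_div, zero_smul, sub_zero]
  simp only [apply_ite (prepend : (Letter →₀ ℚ) →ₗ[ℚ] _), map_add, map_sub, map_smul, map_zero,
    LinearMap.add_apply, LinearMap.sub_apply, ite_apply, apply_ite DFunLike.coe]
  split_ifs <;> simp_all [prepend_letterAt_depthWord, prepend_lowerAt_depthWord]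

theorem prepend_dataDelta_three (a b c : ℕ+) (ks : List ℕ+) :
    prepend (dataDelta.three (a, 0) (b, 0) (c, 0)) (depthWord ks) =
      (1 / 4 : ℚ) • (if a = 1 ∧ b = 1 then depthWord (c :: ks) else 0)
      - (1 / 4 : ℚ) • (if b = 1 ∧ c = 1 then depthWord (a :: ks) else 0) := by
  have h1 : ∀ k : ℕ+, k.natPred = 0 ↔ k = 1 := fun k => by
    rw [← PNat.natPred_inj]; rfl
  simp only [dataDelta, h1, add_zero, map_sub, LinearMap.sub_apply]
  congr 1 <;> split_ifs <;> simp [prepend_letterAt_depthWord]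

theorem dataDelta_endOne (a : ℕ+) : dataDelta.endOne (a, 0) = if a = 2 then -(1 / 2) else 0 := by
  have h2 : ∀ k : ℕ+, k.natPred = 1 ↔ k = 2 := fun k => by
    rw [← PNat.natPred_inj]; rfl
  simp [dataDelta, h2]

theorem dataDelta_endTwo (a b : ℕ+) :
    dataDelta.endTwo (a, 0) (b, 0) = if a = 1 ∧ b = 1 then 1 / 4 else 0 := by
  have h1 : ∀ k : ℕ+, k.natPred = 0 ↔ k = 1 := fun k => by
    rw [← PNat.natPred_inj]; rfl
  simp [dataDelta, h1]

/-- The sum telescopes. Deleting an entry 2 has coefficient -1/2 when it is the first letter seen by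
δ and +1/2 when it is the second, so only a 2 in first place survives; in the same way the deletions
of a pair 1, 1 with coefficients ±1/4 leave only the initial pair. -/
theorem derDelta_depthWord (ks : List ℕ+) : derDelta (depthWord ks) =
    -((1 / 2 : ℚ) • if ks[0]? = some 2 then depthWord (ks.drop 1) else 0)
      + ((1 / 4 : ℚ) • if ks[0]? = some 1 ∧ ks[1]? = some 1 then depthWord (ks.drop 2) else 0)
      + (1 / 2 : ℚ) • lowerNext ks - (1 / 2 : ℚ) • lowerPrev ks := by
  have hcons : ∀ k ks, derDelta (depthWord (k :: ks)) =
      consL (k, 0) (derDelta (depthWord ks)) + dataDelta.head (depthWord (k :: ks)) := fun k ks => by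
    rw [← consL_depthWord]
    exact localOp_consL _ _ _
  induction ks with
  | nil =>
    have : derDelta (depthWord []) = 0 := localOp_nil _
    simp [this, lowerNext, lowerPrev]
  | cons a ks ih =>
    rw [hcons, ih]
    rcases ks with _ | ⟨b, _ | ⟨c, ks⟩⟩
    · have : dataDelta.head (depthWord [a]) = prepend (dataDelta.one (a, 0)) (depthWord [])
          + dataDelta.endOne (a, 0) • depthWord [] := dataDelta.head_one (a, 0)
      rw [this, prepend_dataDelta_one, dataDelta_endOne]
      simp [lowerNext, lowerPrev]
      split_ifs <;> simp
    · have : dataDelta.head (depthWord [a, b]) = prepend (dataDelta.one (a, 0)) (depthWord [b])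
          + (prepend (dataDelta.two (a, 0) (b, 0)) (depthWord [])
          + dataDelta.endTwo (a, 0) (b, 0) • depthWord []) := dataDelta.head_two (a, 0) (b, 0)
      rw [this, prepend_dataDelta_one, prepend_dataDelta_two, dataDelta_endTwo, lowerNext_cons,
        lowerPrev_cons]
      simp only [map_add, map_sub, map_neg, map_smul, apply_ite (consL ((a, 0) : Letter)),
        consL_depthWord, map_zero, List.drop_succ_cons, List.drop_zero, List.getElem?_cons_zero,
        List.getElem?_cons_succ, Option.some.injEq, List.drop_nil, List.getElem?_nil, reduceCtorEq,
        and_false, if_false, ite_smul, zero_smul]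
      simp only [← smul_ite_zero]
      module
    · have : dataDelta.head (depthWord (a :: b :: c :: ks)) =
          prepend (dataDelta.one (a, 0)) (depthWord (b :: c :: ks))
          + (prepend (dataDelta.two (a, 0) (b, 0)) (depthWord (c :: ks))
          + prepend (dataDelta.three (a, 0) (b, 0) (c, 0)) (depthWord ks)) :=
        dataDelta.head_three (a, 0) (b, 0) (c, 0) _
      rw [this, prepend_dataDelta_one, prepend_dataDelta_two, prepend_dataDelta_three,
        lowerNext_cons a b, lowerPrev_cons a b]
      simp only [map_add, map_sub, map_neg, map_smul, apply_ite (consL ((a, 0) : Letter)),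
        consL_depthWord, map_zero, List.drop_succ_cons, List.drop_zero, List.getElem?_cons_zero,
        List.getElem?_cons_succ, Option.some.injEq]
      module

end LowerWeightZero

/-! ### Words read from the last letter -/

section LastLetter

variable {L : Type*}

/-- Appending a letter to every word. -/
def snocL (a : L) : Words L →ₗ[ℚ] Words L := wordLift fun w => word (w ++ [a])

theorem snocL_word (a : L) (w : List L) : snocL a (word w) = word (w ++ [a]) := wordLift_word _ _

theorem snocL_consL (a b : L) (f : Words L) : snocL a (consL b f) = consL b (snocL a f) := by
  have : (snocL a).comp (consL b) = (consL b).comp (snocL a) := words_hom_ext fun w => by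
    simp [snocL_word, consL_word]
  exact LinearMap.congr_fun this f

open Classical in
/-- Removing the last letter, if it is `c`; the other words are mapped to `0`. -/
def stripLast (c : L) : Words L →ₗ[ℚ] Words L :=
  wordLift fun w => if w.getLast? = some c then word w.dropLast else 0

theorem stripLast_nil (c : L) : stripLast c (word []) = 0 := by
  rw [stripLast, wordLift_word, if_neg (by simp)]

open Classical in
theorem stripLast_snoc (c a : L) (w : List L) :
    stripLast c (word (w ++ [a])) = if a = c then word w else 0 := by
  rw [stripLast, wordLift_word]
  simp

open Classical in
theorem stripLast_snocL (c a : L) (f : Words L) :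
    stripLast c (snocL a f) = if a = c then f else 0 := by
  have : (stripLast c).comp (snocL a) = if a = c then LinearMap.id else 0 :=
    words_hom_ext fun w => by
      rw [LinearMap.comp_apply, snocL_word, stripLast_snoc]
      split_ifs <;> rfl
  refine (LinearMap.congr_fun this f).trans ?_
  split_ifs <;> rfl

/-- The component of the empty word. -/
def emptyPart : Words L →ₗ[ℚ] Words L := headOp (fun _ => 0) (word [])

theorem emptyPart_nil : emptyPart (word [] : Words L) = word [] := headOp_nil _ _

theorem emptyPart_cons (a : L) (w : List L) : emptyPart (word (a :: w)) = 0 := by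
  rw [← consL_word]
  exact headOp_consL _ _ _ _

theorem emptyPart_of_ne_nil {w : List L} (h : w ≠ []) : emptyPart (word w) = 0 := by
  obtain ⟨a, w, rfl⟩ := List.exists_cons_of_ne_nil h
  exact emptyPart_cons a w

theorem emptyPart_consL (a : L) (f : Words L) : emptyPart (consL a f) = 0 := headOp_consL _ _ _ _

theorem emptyPart_snocL (a : L) (f : Words L) : emptyPart (snocL a f) = 0 := by
  have : emptyPart.comp (snocL a) = 0 := words_hom_ext fun w => by
    rw [LinearMap.comp_apply, snocL_word]
    exact emptyPart_of_ne_nil (by simp)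
  exact LinearMap.congr_fun this f

/-- The coefficient of a word. -/
def coeffWord (u : List L) : Words L →ₗ[ℚ] ℚ := Finsupp.lapply u

open Classical in
theorem coeffWord_word (u w : List L) : coeffWord u (word w) = if w = u then 1 else 0 :=
  Finsupp.single_apply

/-- The coefficient of u c in f is the coefficient of u after the last letter c is removed; the
empty word is handled separately. -/
theorem eq_zero_of_stripLast {f : Words L} (h0 : emptyPart f = 0)
    (h : ∀ c, stripLast c f = 0) : f = 0 := by
  classical
  have e0 : (coeffWord ([] : List L)).comp emptyPart = coeffWord [] := words_hom_ext fun w => by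
    rcases w with _ | ⟨a, w⟩
    · rw [LinearMap.comp_apply, emptyPart_nil]
    · rw [LinearMap.comp_apply, emptyPart_cons, map_zero, coeffWord_word, if_neg (by simp)]
  have e1 : ∀ (u : List L) (c : L), (coeffWord u).comp (stripLast c) = coeffWord (u ++ [c]) :=
    fun u c => words_hom_ext fun w => by
      rcases List.eq_nil_or_concat w with rfl | ⟨v, a, rfl⟩
      · rw [LinearMap.comp_apply, stripLast_nil, map_zero, coeffWord_word, if_neg (by simp)]
      · rw [LinearMap.comp_apply, List.concat_eq_append, stripLast_snoc, coeffWord_word]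
        by_cases ha : a = c
        · simp [ha, coeffWord_word]
        · simp [ha]
  refine Finsupp.ext fun w => ?_
  change coeffWord w f = 0
  rcases List.eq_nil_or_concat w with rfl | ⟨u, c, rfl⟩
  · rw [← e0, LinearMap.comp_apply, h0, map_zero]
  · rw [List.concat_eq_append, ← e1, LinearMap.comp_apply, h, map_zero]

theorem words_snoc_ext {M : Type*} [AddCommGroup M] [Module ℚ M] {f g : Words L →ₗ[ℚ] M}
    (h0 : f (word []) = g (word [])) (h : ∀ a v, f (snocL a v) = g (snocL a v)) : f = g :=
  words_hom_ext fun w => by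
    rcases List.eq_nil_or_concat w with rfl | ⟨u, c, rfl⟩
    · exact h0
    · rw [List.concat_eq_append, ← snocL_word, h]

variable [AddCommSemigroup L]

/-- The stuffle recursion defines the product from the left. For a single factor b it can also be
read from the right: b stays before a, comes after a, or merges with a. -/
theorem letter_mul_snocL (b a : L) (f : Words L) : word [b] * snocL a f =
    snocL a (word [b] * f) + snocL b (snocL a f) + snocL (a + b) f := by
  have : (LinearMap.mulLeft ℚ (word [b])).comp (snocL a) =
      (snocL a).comp (LinearMap.mulLeft ℚ (word [b])) + (snocL b).comp (snocL a)
        + snocL (a + b) := by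
    refine words_hom_ext fun w => ?_
    simp only [LinearMap.comp_apply, LinearMap.add_apply, LinearMap.mulLeft_apply]
    have hb : word [b] = consL b (1 : Words L) := (consL_word _ _).symm
    induction w with
    | nil =>
      have ha : snocL a (word []) = consL a (1 : Words L) := by
        rw [snocL_word, words_one_def, consL_word]; rfl
      rw [ha, hb, consL_mul_consL, ← words_one_def, mul_one, mul_one, one_mul,
        snocL_consL, snocL_consL, words_one_def, snocL_word, snocL_word, snocL_word]
      simp only [consL_word, List.nil_append, add_comm b a]
    | cons c w ih =>
      rw [← consL_word c w, snocL_consL, hb, consL_mul_consL, consL_mul_consL, ← hb, one_mul, one_mul,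
        one_mul, one_mul, ih]
      simp only [map_add, snocL_consL]
      abel
  exact LinearMap.congr_fun this f

theorem emptyPart_letter_mul (b : L) (f : Words L) : emptyPart (word [b] * f) = 0 := by
  have : emptyPart.comp (LinearMap.mulLeft ℚ (word [b])) = 0 := words_snoc_ext (by
      rw [LinearMap.comp_apply, LinearMap.mulLeft_apply, ← words_one_def, mul_one]
      exact emptyPart_cons _ _) fun a v => by
    rw [LinearMap.comp_apply, LinearMap.mulLeft_apply, letter_mul_snocL]
    simp [emptyPart_snocL]
  exact LinearMap.congr_fun this f

end LastLetter

/-! ### Last letters under D and under multiplication by [1; 1] -/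

section LastLetterOfQA

theorem derD_snocL (a : Letter) (f : QA) : derD (snocL a f) =
    snocL a (derD f) + (a.1 : ℚ) • snocL (a.1 + 1, a.2 + 1) f := by
  have : (derD : QA →ₗ[ℚ] QA).comp (snocL a) =
      (snocL a).comp (derD : QA →ₗ[ℚ] QA) + (a.1 : ℚ) • snocL (a.1 + 1, a.2 + 1) := by
    have hcons : ∀ (c : Letter) (w : List Letter), derD (word (c :: w)) =
        consL c (derD (word w)) + (c.1 : ℚ) • word ((c.1 + 1, c.2 + 1) :: w) := fun c w => by
      rw [← consL_word]
      refine (localOp_consL _ _ _).trans (congrArg _ ?_)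
      rw [consL_word, dataD.head_of_one (fun _ _ => rfl) (fun _ _ _ => rfl) (fun _ => rfl)
        (fun _ _ => rfl)]
      simp [dataD, prepend_single, consL_word]
    have hnil : derD (word []) = 0 := localOp_nil _
    refine words_hom_ext fun w => ?_
    simp only [LinearMap.comp_apply, LinearMap.add_apply, LinearMap.smul_apply,
      Derivation.coeFn_coe]
    induction w with
    | nil =>
      rw [snocL_word, List.nil_append, hcons, hnil, map_zero, map_zero, snocL_word, List.nil_append]
    | cons c w ih =>
      rw [snocL_word] at ih
      rw [snocL_word, List.cons_append, hcons, ih, hcons, ← consL_word c w, snocL_consL]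
      simp only [map_add, map_smul, snocL_consL, snocL_word, List.cons_append]
      abel
  exact LinearMap.congr_fun this f

theorem emptyPart_derD (f : QA) : emptyPart (derD f) = 0 := by
  have : emptyPart.comp (derD : QA →ₗ[ℚ] QA) = 0 := words_snoc_ext (by
      have : derD (word []) = 0 := localOp_nil _
      simp [this]) fun a v => by
    simp [derD_snocL, emptyPart_snocL]
  exact LinearMap.congr_fun this f

/-- A last letter created by D has the form a + (1, 1), so other last letters come from f unchanged.
-/
theorem stripLast_derD_of_ne {c : Letter} (hc : ∀ a, a + (1, 1) ≠ c) (f : QA) :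
    stripLast c (derD f) = derD (stripLast c f) := by
  classical
  have hnil : derD (word []) = 0 := localOp_nil _
  have : (stripLast c).comp (derD : QA →ₗ[ℚ] QA) = (derD : QA →ₗ[ℚ] QA).comp (stripLast c) := by
    refine words_snoc_ext (by simp [hnil, stripLast_nil]) fun a v => ?_
    simp only [LinearMap.comp_apply, Derivation.coeFn_coe, derD_snocL, map_add, map_smul,
      stripLast_snocL]
    rw [if_neg (show ((a.1 + 1, a.2 + 1) : Letter) ≠ c from hc a), smul_zero, add_zero]
    split_ifs <;> simp
  exact LinearMap.congr_fun this f

theorem stripLast_derD_add (b : Letter) (f : QA) : stripLast (b + (1, 1)) (derD f) =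
    derD (stripLast (b + (1, 1)) f) + (b.1 : ℚ) • stripLast b f := by
  classical
  have hnil : derD (word []) = 0 := localOp_nil _
  have : (stripLast (b + (1, 1))).comp (derD : QA →ₗ[ℚ] QA) =
      (derD : QA →ₗ[ℚ] QA).comp (stripLast (b + (1, 1))) + (b.1 : ℚ) • stripLast b := by
    refine words_snoc_ext (by simp [hnil, stripLast_nil]) fun a v => ?_
    simp only [LinearMap.comp_apply, LinearMap.add_apply, LinearMap.smul_apply,
      Derivation.coeFn_coe, derD_snocL, map_add, map_smul, stripLast_snocL]
    have h : ((a.1 + 1, a.2 + 1) : Letter) = b + (1, 1) ↔ a = b := by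
      simp [Prod.ext_iff]
    simp only [h]
    by_cases hab : a = b
    · subst hab
      split_ifs <;> simp
    · rw [if_neg hab]
      split_ifs <;> simp
  exact LinearMap.congr_fun this f

open Classical in
theorem stripLast_letter_mul_of_ne {c : Letter} (hc : ∀ a, a + (1, 1) ≠ c) (f : QA) :
    stripLast c (word [(1, 1)] * f) =
      word [(1, 1)] * stripLast c f + if c = (1, 1) then f else 0 := by
  have : (stripLast c).comp (LinearMap.mulLeft ℚ (word [(1, 1)])) =
      (LinearMap.mulLeft ℚ (word [(1, 1)])).comp (stripLast c)
        + if c = (1, 1) then LinearMap.id else 0 := by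
    refine words_snoc_ext ?_ fun a v => ?_
    · simp only [LinearMap.comp_apply, LinearMap.add_apply, LinearMap.mulLeft_apply, stripLast_nil]
      rw [← words_one_def, mul_one, mul_zero, zero_add, ← List.nil_append [((1, 1) : Letter)],
        stripLast_snoc, words_one_def]
      by_cases h : c = (1, 1)
      · simp [h]
      · simp [h, Ne.symm h]
    · simp only [LinearMap.comp_apply, LinearMap.add_apply, LinearMap.mulLeft_apply,
        letter_mul_snocL, map_add, stripLast_snocL]
      rw [if_neg (hc a), add_zero]
      congr 1
      · split_ifs <;> simp
      · by_cases h : c = (1, 1)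
        · simp [h]
        · simp [h, Ne.symm h]
  refine (LinearMap.congr_fun this f).trans ?_
  simp only [LinearMap.comp_apply, LinearMap.add_apply, LinearMap.mulLeft_apply]
  split_ifs <;> rfl

/-- Merging b with [1; 1] gives the same letter as raising b by D, but with coefficient 1 instead of
k; compare `stripLast_derD_add`. The two agree for k = 1. -/
theorem stripLast_letter_mul_add (b : Letter) (f : QA) :
    stripLast (b + (1, 1)) (word [(1, 1)] * f) =
      word [(1, 1)] * stripLast (b + (1, 1)) f + stripLast b f := by
  classical
  have hb : ((1, 1) : Letter) ≠ b + (1, 1) := fun h => by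
    have := congrArg (fun c : Letter => (c.1 : ℕ)) h
    simp at this
  have : (stripLast (b + (1, 1))).comp (LinearMap.mulLeft ℚ (word [(1, 1)])) =
      (LinearMap.mulLeft ℚ (word [(1, 1)])).comp (stripLast (b + (1, 1))) + stripLast b := by
    refine words_snoc_ext ?_ fun a v => ?_
    · simp only [LinearMap.comp_apply, LinearMap.add_apply, LinearMap.mulLeft_apply, stripLast_nil]
      rw [← words_one_def, mul_one, mul_zero, zero_add, ← List.nil_append [((1, 1) : Letter)],
        stripLast_snoc, if_neg hb]
    · simp only [LinearMap.comp_apply, LinearMap.add_apply, LinearMap.mulLeft_apply,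
        letter_mul_snocL, map_add, stripLast_snocL]
      rw [if_neg hb, add_zero]
      congr 1
      · split_ifs <;> simp
      · by_cases hab : a = b <;> simp [hab]
  exact LinearMap.congr_fun this f

end LastLetterOfQA

/-! ### Derivations of the shuffle product -/

section ShuffleDerivations

variable {L : Type*}

theorem shuffle_word (w v : List L) : shuffle (word w) (word v) = shuffleWord w v := by
  simp [shuffle, wordLift_word]

theorem shuffle_nil_left (f : Words L) : shuffle (word []) f = f := by
  have : shuffle (word ([] : List L)) = LinearMap.id :=
    words_hom_ext fun w => by rw [shuffle_word, shuffleWord]; rfl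
  rw [this]; rfl

theorem shuffle_nil_right (f : Words L) : shuffle f (word []) = f := by
  have : (shuffle (L := L)).flip (word []) = LinearMap.id :=
    words_hom_ext fun w => by
      rw [LinearMap.flip_apply, shuffle_word]
      cases w <;> rw [shuffleWord] <;> rfl
  exact LinearMap.congr_fun this f

theorem shuffle_consL_consL (a b : L) (f g : Words L) : shuffle (consL a f) (consL b g) =
    consL a (shuffle f (consL b g)) + consL b (shuffle (consL a f) g) := by
  have : (shuffle.compl₁₂ (consL a) (consL b) : Words L →ₗ[ℚ] Words L →ₗ[ℚ] Words L) =
      (shuffle.compl₁₂ LinearMap.id (consL b)).compr₂ (consL a)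
        + (shuffle.compl₁₂ (consL a) LinearMap.id).compr₂ (consL b) := by
    refine words_hom_ext fun w => words_hom_ext fun v => ?_
    simp [consL_word, shuffle_word, shuffleWord]
  simpa using LinearMap.congr_fun (LinearMap.congr_fun this f) g

/-- Derivations of the shuffle product. -/
def IsShuffleDer (T : Words L →ₗ[ℚ] Words L) : Prop :=
  ∀ f g, T (shuffle f g) = shuffle (T f) g + shuffle f (T g)

theorem IsShuffleDer.commutator {T T' : Words L →ₗ[ℚ] Words L} (hT : IsShuffleDer T)
    (hT' : IsShuffleDer T') : IsShuffleDer (T.comp T' - T'.comp T) := fun f g => by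
  simp only [LinearMap.sub_apply, LinearMap.comp_apply, hT _ _, hT' _ _, map_add, map_sub]
  abel

/-- Removing the first letter `a`, with the factor `p a`. -/
def stripFirst (p : L → ℚ) : Words L →ₗ[ℚ] Words L := headOp (fun a => p a • LinearMap.id) 0

theorem stripFirst_nil (p : L → ℚ) : stripFirst p (word []) = 0 := headOp_nil _ _

theorem stripFirst_consL (p : L → ℚ) (a : L) (f : Words L) :
    stripFirst p (consL a f) = p a • f := headOp_consL _ _ _ _

/-- The first letter of a shuffle is the first letter of exactly one of the factors. -/
theorem isShuffleDer_stripFirst (p : L → ℚ) : IsShuffleDer (stripFirst p) := by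
  have : shuffle.compr₂ (stripFirst p) = (shuffle.compl₁₂ (stripFirst p) LinearMap.id
      + shuffle.compl₁₂ LinearMap.id (stripFirst p) : Words L →ₗ[ℚ] Words L →ₗ[ℚ] Words L) := by
    refine words_hom_ext fun w => words_hom_ext fun v => ?_
    simp only [LinearMap.compr₂_apply, LinearMap.add_apply, LinearMap.compl₁₂_apply,
      LinearMap.id_apply]
    rcases w with _ | ⟨a, w⟩
    · simp [shuffle_nil_left, stripFirst_nil]
    · rcases v with _ | ⟨b, v⟩
      · simp [shuffle_nil_right, stripFirst_nil]
      · rw [← consL_word a, ← consL_word b, shuffle_consL_consL]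
        simp [stripFirst_consL]
  exact fun f g => LinearMap.congr_fun (LinearMap.congr_fun this f) g

theorem emptyPart_shuffle_consL (a : L) (f g : Words L) : emptyPart (shuffle (consL a f) g) = 0 := by
  have : ((shuffle.comp (consL a)).compr₂ emptyPart : Words L →ₗ[ℚ] Words L →ₗ[ℚ] Words L) = 0 := by
    refine words_hom_ext fun w => words_hom_ext fun v => ?_
    simp only [LinearMap.compr₂_apply, LinearMap.comp_apply, LinearMap.zero_apply]
    rcases v with _ | ⟨b, v⟩
    · rw [shuffle_nil_right, emptyPart_consL]
    · rw [← consL_word b, shuffle_consL_consL, map_add, emptyPart_consL, emptyPart_consL, add_zero]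
  exact LinearMap.congr_fun (LinearMap.congr_fun this f) g

end ShuffleDerivations

/-! ### Operators on the first letter of ℌ¹ -/

section FirstLetterOfH1

/-- Lowering the first index: `z_k w ↦ z_{k-1} w` for `k > 1`; the other words are killed. -/
def lowerFirst : H1 →ₗ[ℚ] H1 := headOp (fun k => if k = 1 then 0 else consL (k - 1)) 0

/-- Removing the first letter `z_1`; the other words are killed. -/
def dropOne : H1 →ₗ[ℚ] H1 := headOp (fun k => if k = 1 then LinearMap.id else 0) 0

/-- The iterated commutators of `dropOne` with `lowerFirst`. -/
def dropFirst : ℕ → H1 →ₗ[ℚ] H1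
  | 0 => dropOne
  | d + 1 => (dropFirst d).comp lowerFirst - lowerFirst.comp (dropFirst d)

/-- Removing the first letter `x`. -/
def stripX : Words XY →ₗ[ℚ] Words XY := stripFirst fun | XY.x => 1 | XY.y => 0

/-- Removing the first letter `y`. -/
def stripY : Words XY →ₗ[ℚ] Words XY := stripFirst fun | XY.x => 0 | XY.y => 1

/-- The iterated commutators of `stripY` with `stripX`. -/
def stripXY : ℕ → Words XY →ₗ[ℚ] Words XY
  | 0 => stripY
  | d + 1 => (stripXY d).comp stripX - stripX.comp (stripXY d)

theorem isShuffleDer_stripXY (d : ℕ) : IsShuffleDer (stripXY d) := by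
  induction d with
  | zero => exact isShuffleDer_stripFirst _
  | succ d ih => exact ih.commutator (isShuffleDer_stripFirst _)

theorem toXY_word (ks : List ℕ+) : toXY (word ks) = word (zToXY ks) := wordLift_word _ _

theorem zToXY_one (ks : List ℕ+) : zToXY (1 :: ks) = XY.y :: zToXY ks := rfl

theorem zToXY_of_one_lt {k : ℕ+} (hk : k ≠ 1) (ks : List ℕ+) :
    zToXY (k :: ks) = XY.x :: zToXY ((k - 1) :: ks) := by
  have h : 1 < k := lt_of_le_of_ne one_le (Ne.symm hk)
  have h' : (k : ℕ) - 1 = ((k - 1 : ℕ+) : ℕ) - 1 + 1 := by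
    have := (k - 1).pos
    have h2 : ((k - 1 : ℕ+) : ℕ) = (k : ℕ) - 1 := by rw [PNat.sub_coe, if_pos h]; rfl
    omega
  rw [zToXY, h', List.replicate_succ, zToXY]
  rfl

/-- Since z_k = x^{k-1} y, lowering k > 1 removes a leading x, and words beginning with z_1 = y are
killed on both sides. -/
theorem toXY_lowerFirst (f : H1) : toXY (lowerFirst f) = stripX (toXY f) := by
  have : toXY.comp lowerFirst = stripX.comp toXY := words_hom_ext fun ks => by
    simp only [LinearMap.comp_apply]
    rcases ks with _ | ⟨k, ks⟩
    · simp [lowerFirst, headOp_nil, toXY_word, zToXY, stripX, stripFirst_nil]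
    · rw [← consL_word, lowerFirst, headOp_consL, consL_word, toXY_word]
      by_cases hk : k = 1
      · subst hk
        rw [zToXY_one, ← consL_word, stripX, stripFirst_consL]
        simp
      · rw [zToXY_of_one_lt hk, ← consL_word, stripX, stripFirst_consL, if_neg hk, consL_word,
          toXY_word, one_smul]
  exact LinearMap.congr_fun this f

theorem toXY_dropOne (f : H1) : toXY (dropOne f) = stripY (toXY f) := by
  have : toXY.comp dropOne = stripY.comp toXY := words_hom_ext fun ks => by
    simp only [LinearMap.comp_apply]
    rcases ks with _ | ⟨k, ks⟩
    · simp [dropOne, headOp_nil, toXY_word, zToXY, stripY, stripFirst_nil]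
    · rw [← consL_word, dropOne, headOp_consL, consL_word, toXY_word]
      by_cases hk : k = 1
      · subst hk
        rw [zToXY_one, ← consL_word, stripY, stripFirst_consL, if_pos rfl, one_smul,
          LinearMap.id_apply, toXY_word]
      · rw [zToXY_of_one_lt hk, ← consL_word, stripY, stripFirst_consL, if_neg hk]
        simp
  exact LinearMap.congr_fun this f

theorem toXY_dropFirst (d : ℕ) (f : H1) : toXY (dropFirst d f) = stripXY d (toXY f) := by
  induction d generalizing f with
  | zero => exact toXY_dropOne f
  | succ d ih => simp [dropFirst, stripXY, ih, toXY_lowerFirst]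

theorem toXY_injective : Function.Injective toXY := Function.LeftInverse.injective ofXY_toXY

/-- The shuffle product of `ℌ¹` as a bilinear map. -/
def shuffleH1Lin : H1 →ₗ[ℚ] H1 →ₗ[ℚ] H1 := (shuffle.compl₁₂ toXY toXY).compr₂ ofXY

theorem shuffleH1Lin_apply (f g : H1) : shuffleH1Lin f g = shuffleH1 f g := rfl

/-- In ℚ⟨x, y⟩ these operators are commutators of derivations of the shuffle product; the injection
`toXY` carries the Leibniz rule back. -/
theorem dropFirst_shuffleH1Lin (d : ℕ) (f g : H1) : dropFirst d (shuffleH1Lin f g) =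
    shuffleH1Lin (dropFirst d f) g + shuffleH1Lin f (dropFirst d g) := by
  apply toXY_injective
  simp only [map_add, toXY_dropFirst, shuffleH1Lin_apply, toXY_shuffleH1,
    isShuffleDer_stripXY d _ _]

theorem shuffleH1Lin_nil_left (f : H1) : shuffleH1Lin (word []) f = f := by
  apply toXY_injective
  rw [shuffleH1Lin_apply, toXY_shuffleH1, toXY_word, zToXY, shuffle_nil_left]

theorem shuffleH1Lin_nil_right (f : H1) : shuffleH1Lin f (word []) = f := by
  apply toXY_injective
  rw [shuffleH1Lin_apply, toXY_shuffleH1, toXY_word, zToXY, shuffle_nil_right]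

theorem dropFirst_nil (d : ℕ) : dropFirst d (word []) = 0 := by
  induction d with
  | zero => exact headOp_nil _ _
  | succ d ih =>
    have : lowerFirst (word []) = 0 := headOp_nil _ _
    simp [dropFirst, ih, this]

theorem dropFirst_one (d : ℕ) : dropFirst (d + 1) (word [1]) = 0 := by
  have h1 : lowerFirst (word []) = 0 := headOp_nil _ _
  have h2 : lowerFirst (word [1]) = 0 := by
    rw [← consL_word, lowerFirst, headOp_consL, if_pos rfl]; rfl
  have h3 : dropOne (word [1]) = word [] := by
    rw [← consL_word, dropOne, headOp_consL, if_pos rfl]; rfl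
  induction d with
  | zero => simp [dropFirst, h1, h2, h3]
  | succ d ih =>
    rw [dropFirst, LinearMap.sub_apply, LinearMap.comp_apply, LinearMap.comp_apply, ih, h2]
    simp

/-- For z_2 = x y the x has to be removed first and then the y, which happens only in the first
commutator. -/
theorem dropFirst_two (d : ℕ) : dropFirst d (word [2]) = if d = 1 then word [] else 0 := by
  have h1 : lowerFirst (word []) = 0 := headOp_nil _ _
  have h2 : lowerFirst (word [2]) = word [1] := by
    rw [← consL_word, lowerFirst, headOp_consL, if_neg (by decide), consL_word]; rfl
  have h3 : dropOne (word [1]) = word [] := by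
    rw [← consL_word, dropOne, headOp_consL, if_pos rfl]; rfl
  have h4 : dropOne (word [2]) = 0 := by
    rw [← consL_word, dropOne, headOp_consL, if_neg (by decide)]; rfl
  induction d with
  | zero => exact h4
  | succ d ih =>
    rw [dropFirst, LinearMap.sub_apply, LinearMap.comp_apply, LinearMap.comp_apply, ih, h2]
    rcases d with _ | d
    · simp [dropFirst, h3]
    · rw [dropFirst_one]
      split_ifs <;> simp_all

theorem emptyPart_shuffleH1Lin_cons (k : ℕ+) (ks : List ℕ+) (f : H1) :
    emptyPart (shuffleH1Lin (word (k :: ks)) f) = 0 := by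
  have h : ∀ g : H1, toXY (emptyPart g) = emptyPart (toXY g) := by
    have : toXY.comp emptyPart = emptyPart.comp toXY := words_hom_ext fun ks => by
      simp only [LinearMap.comp_apply, toXY_word]
      rcases ks with _ | ⟨k, ks⟩
      · rw [emptyPart_nil, toXY_word, zToXY, emptyPart_nil]
      · rw [emptyPart_cons, map_zero, emptyPart_of_ne_nil (by simp [zToXY])]
    exact LinearMap.congr_fun this
  apply toXY_injective
  rw [h, shuffleH1Lin_apply, toXY_shuffleH1, toXY_word, map_zero]
  obtain ⟨a, w, hw⟩ := List.exists_cons_of_ne_nil (show zToXY (k :: ks) ≠ [] by simp [zToXY])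
  rw [hw, ← consL_word, emptyPart_shuffle_consL]

/-- The span of the words of length `n`. -/
def depthEq (n : ℕ) : Submodule ℚ H1 :=
  Submodule.span ℚ {f | ∃ ks : List ℕ+, ks.length = n ∧ f = word ks}

theorem lowerFirst_mem {n : ℕ} {f : H1} (hf : f ∈ depthEq n) : lowerFirst f ∈ depthEq n := by
  have : depthEq n ≤ (depthEq n).comap lowerFirst := by
    refine Submodule.span_le.2 ?_
    rintro _ ⟨ks, hks, rfl⟩
    rcases ks with _ | ⟨k, ks⟩
    · have : lowerFirst (word []) = 0 := headOp_nil _ _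
      simp [this]
    · change lowerFirst _ ∈ depthEq n
      rw [← consL_word, lowerFirst, headOp_consL]
      split_ifs
      · exact zero_mem _
      · rw [consL_word]
        exact Submodule.subset_span ⟨_, by simpa using hks, rfl⟩
  exact this hf

/-- Each term contains one removal of y and otherwise removals of x, so the depth drops by one. This
drives the induction for `letter_mul_swapH1`. -/
theorem dropFirst_mem (d : ℕ) {n : ℕ} {f : H1} (hf : f ∈ depthEq (n + 1)) :
    dropFirst d f ∈ depthEq n := by
  induction d generalizing f with
  | zero =>
    have : depthEq (n + 1) ≤ (depthEq n).comap dropOne := by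
      refine Submodule.span_le.2 ?_
      rintro _ ⟨ks, hks, rfl⟩
      rcases ks with _ | ⟨k, ks⟩
      · simp at hks
      · change dropOne _ ∈ depthEq n
        rw [← consL_word, dropOne, headOp_consL]
        split_ifs
        · exact Submodule.subset_span ⟨_, by simpa using hks, rfl⟩
        · exact zero_mem _
    exact this hf
  | succ d ih => exact sub_mem (ih (lowerFirst_mem hf)) (lowerFirst_mem (ih hf))

theorem dropFirst_depth_zero (d : ℕ) {f : H1} (hf : f ∈ depthEq 0) : dropFirst d f = 0 := by
  have : depthEq 0 ≤ LinearMap.ker (dropFirst d) := by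
    refine Submodule.span_le.2 ?_
    rintro _ ⟨ks, hks, rfl⟩
    rw [List.length_eq_zero_iff] at hks
    subst hks
    exact dropFirst_nil d
  exact this hf

end FirstLetterOfH1

/-! ### The swap on words with all d_i = 0, and the formula for D -/

section SwapOfDepthWords

theorem series_ext {r : ℕ} {g h : Series r}
    (H : ∀ w : List Letter, w.length = r → wordCoeff r w g = wordCoeff r w h) : g = h := by
  ext n
  have key := H (wordOf n) (by simp [wordOf])
  have he : expo r (wordOf n) = n := by
    ext (s | s) <;> simp [expo_inl, expo_inr, wordOf]
  rw [wordCoeff_apply, wordCoeff_apply, he] at key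
  refine smul_right_injective QA ?_ key
  refine List.prod_ne_zero fun h => ?_
  obtain ⟨a, _, ha⟩ := List.mem_map.1 h
  exact Nat.factorial_ne_zero _ (by exact_mod_cast ha)

theorem wordCoeff_mapCoeff (T : QA →ₗ[ℚ] QA) {r : ℕ} (w : List Letter) (g : Series r) :
    wordCoeff r w (mapCoeff T g) = T (wordCoeff r w g) := by
  rw [wordCoeff_apply, coeff_mapCoeff, wordCoeff_apply, map_smul]

theorem varX_depth_zero (i : ℕ) : varX 0 i = 0 := by
  unfold varX
  rw [dif_neg (by omega)]

theorem varY_depth_zero (i : ℕ) : varY 0 i = 0 := by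
  unfold varY
  rw [dif_neg (by omega)]

/-- The coefficients at the words with `d_1 = ⋯ = d_r = 0`. -/
def coeffH1 (h : Bimould) : H1 →ₗ[ℚ] QA :=
  wordLift fun ks => wordCoeff ks.length (ks.map fun k => (k, 0)) (h ks.length)

theorem coeffH1_word (h : Bimould) (ks : List ℕ+) :
    coeffH1 h (word ks) = wordCoeff ks.length (ks.map fun k => (k, 0)) (h ks.length) :=
  wordLift_word _ _

/-- The swap of the words with `d_1 = ⋯ = d_r = 0`. -/
def swapH1 : H1 →ₗ[ℚ] QA := (onWords swap).comp embH1

theorem swapH1_eq : swapH1 = coeffH1 (swap genSeries) := words_hom_ext fun ks => by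
  rw [swapH1, LinearMap.comp_apply, embH1_word, coeffH1_word,
    onWords_eq_wordCoeff _ _ (List.length_map _)]

/-- Multiplication by `X_1`. -/
def mulFirst (h : Bimould) : Bimould := fun r => varX r 1 * h r

theorem coeffH1_mulFirst (h : Bimould) (f : H1) :
    coeffH1 (mulFirst h) f = coeffH1 h (lowerFirst f) := by
  have : coeffH1 (mulFirst h) = (coeffH1 h).comp lowerFirst := words_hom_ext fun ks => by
    rw [LinearMap.comp_apply, coeffH1_word]
    rcases ks with _ | ⟨k, ks⟩
    · have h1 : lowerFirst (word []) = 0 := headOp_nil _ _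
      simp [h1, mulFirst, varX_depth_zero]
    · rw [← consL_word, lowerFirst, headOp_consL]
      have := wordCoeff_varX_mul [] (ks.map fun k => (k, 0)) (k, 0)
        (show 0 < (k :: ks).length by simp) (h (k :: ks).length)
      refine this.trans ?_
      obtain ⟨n, rfl⟩ : ∃ n : ℕ, k = n.succPNat := ⟨k.natPred, by simp⟩
      rw [Nat.natPred_succPNat]
      rcases n with _ | n
      · rw [if_pos rfl, if_pos (by rfl), LinearMap.zero_apply, map_zero]
      · have h1 : (n + 1).succPNat ≠ 1 := by
          intro h; have := congrArg PNat.natPred h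
          rw [Nat.natPred_succPNat] at this; exact Nat.succ_ne_zero n this
        have h2 : (n + 1).succPNat - 1 = n.succPNat := by
          apply PNat.eq
          rw [PNat.sub_coe, if_pos (by rw [← PNat.coe_lt_coe]; simp)]; simp
        rw [if_neg (by omega), if_neg h1, h2, consL_word, coeffH1_word]
        rfl
  exact LinearMap.congr_fun this f

/-- Removing `X_1` and adding `Y_1` to `Y_2`, in positive depth. -/
def phiFirst (h : Bimould) : Bimould := fun r => if r = 0 then 0 else phi 1 1 h r

theorem coeffH1_phiFirst (h : Bimould) (f : H1) :
    coeffH1 (phiFirst h) f = coeffH1 h (dropOne f) := by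
  have hk : ∀ k : ℕ+, k.natPred = 0 ↔ k = 1 := fun k => by
    rw [← PNat.natPred_inj]; rfl
  have : coeffH1 (phiFirst h) = (coeffH1 h).comp dropOne := words_hom_ext fun ks => by
    rw [LinearMap.comp_apply, coeffH1_word]
    rcases ks with _ | ⟨k, _ | ⟨l, ks⟩⟩
    · have h1 : dropOne (word []) = 0 := headOp_nil _ _
      simp [h1, phiFirst]
    · rw [← consL_word, dropOne, headOp_consL]
      refine (wordCoeff_phi_last [] (k, 0) h).trans ?_
      simp only [hk, and_true]
      split_ifs
      · exact (coeffH1_word h []).symm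
      · exact (map_zero _).symm
    · rw [← consL_word, dropOne, headOp_consL]
      refine (wordCoeff_phi_plus [] (ks.map fun k => (k, 0)) (k, 0) (l, 0) h (by simp)).trans ?_
      simp only [hk]
      split_ifs
      · exact (coeffH1_word h (l :: ks)).symm
      · exact (map_zero _).symm
  exact LinearMap.congr_fun this f

/-- After X_1 is deleted, the first variable of the inner series is X_2. -/
theorem varX_two_mul_phiFirst (h : Bimould) (r : ℕ) :
    varX r 2 * phiFirst h r = phiFirst (mulFirst h) r := by
  unfold phiFirst
  split_ifs with hr
  · rw [mul_zero]
  · unfold phi mulFirst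
    rw [← substXYHom_apply (linSeq_skipX r 1) (linSeq_mergeY r 1),
      ← substXYHom_apply (linSeq_skipX r 1) (linSeq_mergeY r 1), map_mul,
      substXYHom_apply _ _ (varX _ _), substXY_varX (linSeq_skipX r 1) (linSeq_mergeY r 1)]
    congr 1
    split_ifs with h1
    · rfl
    · unfold varX
      rw [dif_neg (by omega)]

/-- Multiplication of `phiFirst` by a power of `X_1 - X_2`. -/
def diffFirst (d : ℕ) (h : Bimould) : Bimould := fun r =>
  (varX r 1 - varX r 2) ^ d * phiFirst h r

theorem diffFirst_succ (d : ℕ) (h : Bimould) (r : ℕ) :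
    diffFirst (d + 1) h r = mulFirst (diffFirst d h) r - diffFirst d (mulFirst h) r := by
  unfold diffFirst
  rw [← varX_two_mul_phiFirst]
  unfold mulFirst
  ring

/-- On coefficients, X_1 in front of `phiFirst` means lowering k_1 before the removal of z_1, and
X_2 means lowering after it. Hence each factor X_1 - X_2 is a commutator with `lowerFirst`. -/
theorem coeffH1_diffFirst (d : ℕ) (h : Bimould) (f : H1) :
    coeffH1 (diffFirst d h) f = coeffH1 h (dropFirst d f) := by
  induction d generalizing h f with
  | zero =>
    have : diffFirst 0 h = phiFirst h := by
      funext r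
      rw [diffFirst, pow_zero, one_mul]
    rw [this]
    exact coeffH1_phiFirst h f
  | succ d ih =>
    have : coeffH1 (diffFirst (d + 1) h) =
        coeffH1 (mulFirst (diffFirst d h)) - coeffH1 (diffFirst d (mulFirst h)) :=
      words_hom_ext fun ks => by
        rw [LinearMap.sub_apply, coeffH1_word, coeffH1_word, coeffH1_word, diffFirst_succ, map_sub]
    rw [this, LinearMap.sub_apply, coeffH1_mulFirst, ih, ih, coeffH1_mulFirst, dropFirst,
      LinearMap.sub_apply, map_sub]
    rfl

/-- The generating series of the words with last letter `c`, without this letter. -/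
def lastSeries (c : Letter) : Bimould := fun r => mapCoeff (stripLast c) (genSeries r)

/-- For r ≥ 1 the series of words with last letter [k; d] is X_r^{k-1} Y_r^d/d! times the generating
series in depth r - 1. This lemma and the next two, `varY_mul_lastSeries` and `lastSeries_one_zero`,
say so recursively. -/
theorem varX_mul_lastSeries (k : ℕ+) (d r : ℕ) :
    varX r r * lastSeries (k, d) r = lastSeries (k + 1, d) r := by
  refine series_ext fun w hw => ?_
  rcases List.eq_nil_or_concat w with rfl | ⟨u, a, rfl⟩
  · subst hw
    rw [List.length_nil, varX_depth_zero, zero_mul, map_zero, lastSeries, wordCoeff_mapCoeff,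
      wordCoeff_genSeries (r := 0) [] rfl, stripLast_nil]
  · rw [List.concat_eq_append] at *
    obtain rfl : r = u.length + 1 := by simpa using hw.symm
    rw [wordCoeff_varX_mul u [] a (by omega)]
    simp only [lastSeries, wordCoeff_mapCoeff]
    rw [wordCoeff_genSeries _ (by simp), wordCoeff_genSeries _ (by simp), stripLast_snoc,
      stripLast_snoc]
    obtain ⟨l, e⟩ := a
    obtain ⟨n, rfl⟩ : ∃ n : ℕ, l = n.succPNat := ⟨l.natPred, by simp⟩
    obtain ⟨m, rfl⟩ : ∃ m : ℕ, k = m.succPNat := ⟨k.natPred, by simp⟩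
    simp only [Nat.natPred_succPNat, Prod.mk.injEq]
    have h2 : n.succPNat = m.succPNat + 1 ↔ n = m + 1 := by
      rw [← PNat.natPred_inj, natPred_add_one_pnat]; simp
    have h3 : (n - 1).succPNat = m.succPNat ↔ n - 1 = m := by
      rw [← PNat.natPred_inj]; simp
    simp only [h2, h3]
    split_ifs <;> first | rfl | omega

theorem varY_mul_lastSeries (k : ℕ+) (d r : ℕ) :
    varY r r * lastSeries (k, d) r = ((d : ℚ) + 1) • lastSeries (k, d + 1) r := by
  refine series_ext fun w hw => ?_
  rcases List.eq_nil_or_concat w with rfl | ⟨u, a, rfl⟩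
  · subst hw
    rw [List.length_nil, varY_depth_zero, zero_mul, map_zero, lastSeries, map_smul, wordCoeff_mapCoeff,
      wordCoeff_genSeries (r := 0) [] rfl, stripLast_nil, smul_zero]
  · rw [List.concat_eq_append] at *
    obtain rfl : r = u.length + 1 := by simpa using hw.symm
    rw [wordCoeff_varY_mul u [] a (by omega), map_smul]
    simp only [lastSeries, wordCoeff_mapCoeff]
    rw [wordCoeff_genSeries _ (by simp), wordCoeff_genSeries _ (by simp), stripLast_snoc,
      stripLast_snoc]
    obtain ⟨l, e⟩ := a
    simp only [Prod.mk.injEq]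
    rcases e with _ | e
    · simp
    · simp only [Nat.add_sub_cancel, Nat.add_right_cancel_iff]
      split_ifs with h
      · rw [h.2]; push_cast; rfl
      · simp

theorem lastSeries_one_zero (r : ℕ) :
    lastSeries (1, 0) r = if r = 0 then 0 else phi r r genSeries r := by
  have hk : ∀ k : ℕ+, k.natPred = 0 ↔ k = 1 := fun k => by
    rw [← PNat.natPred_inj]; rfl
  refine series_ext fun w hw => ?_
  rcases List.eq_nil_or_concat w with rfl | ⟨u, a, rfl⟩
  · subst hw
    change wordCoeff 0 [] (lastSeries (1, 0) 0) = wordCoeff 0 [] (if 0 = 0 then 0 else _)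
    rw [if_pos rfl, map_zero, lastSeries, wordCoeff_mapCoeff,
      wordCoeff_genSeries (r := 0) [] rfl, stripLast_nil]
  · rw [List.concat_eq_append] at *
    obtain rfl : r = u.length + 1 := by simpa using hw.symm
    rw [if_neg (by omega), wordCoeff_phi_last, lastSeries, wordCoeff_mapCoeff,
      wordCoeff_genSeries _ hw, wordCoeff_genSeries _ rfl, stripLast_snoc]
    simp [hk, Prod.ext_iff]

/-- The swap replaces X_r by Y_1. -/
theorem swap_lastSeries_succ (k : ℕ+) (d r : ℕ) :
    swap (lastSeries (k + 1, d)) r = varY r 1 * swap (lastSeries (k, d)) r := by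
  rw [swap_eq_swapHom, swap_eq_swapHom, ← varX_mul_lastSeries, map_mul]
  rcases r with _ | r
  · rw [varX_depth_zero, varY_depth_zero, map_zero]
  · rw [swapHom_varX (by omega), swapX, Nat.add_sub_cancel_left, Finset.Icc_self,
      Finset.sum_singleton]

/-- The swap replaces Y_r by X_1 - X_2; the factor d + 1 comes from the divided powers of Y_r. -/
theorem swap_lastSeries_one (d r : ℕ) :
    ((d : ℚ) + 1) • swap (lastSeries (1, d + 1)) r =
      (varX r 1 - varX r 2) * swap (lastSeries (1, d)) r := by
  rw [swap_eq_swapHom, swap_eq_swapHom, ← map_smul, ← varY_mul_lastSeries, map_mul]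
  rcases r with _ | r
  · rw [varX_depth_zero, varX_depth_zero, varY_depth_zero, map_zero, sub_zero]
  · rw [swapHom_varY (by omega), swapY, Nat.add_sub_cancel_left, Nat.add_sub_cancel_left]

theorem factorial_smul_swap_lastSeries (d r : ℕ) :
    (d.factorial : ℚ) • swap (lastSeries (1, d)) r = diffFirst d (swap genSeries) r := by
  induction d with
  | zero =>
    rw [diffFirst, pow_zero, one_mul, Nat.factorial_zero, Nat.cast_one, one_smul, phiFirst,
      swap_eq_swapHom, lastSeries_one_zero]
    split_ifs with hr
    · exact map_zero _
    · rw [← swap_eq_swapHom, swap_phi ⟨by omega, le_rfl⟩ ⟨by omega, le_rfl⟩,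
        Nat.add_sub_cancel_left]
  | succ d ih =>
    rw [Nat.factorial_succ, mul_comm, Nat.cast_mul, mul_smul, Nat.cast_add, Nat.cast_one,
      swap_lastSeries_one, mul_comm, ← smul_mul_assoc, ih]
    unfold diffFirst
    ring

/-- Removing the last letter is a linear map on coefficients, so it passes through the natural
operator σ to the generating series itself. -/
theorem stripLast_swapH1_word (c : Letter) (ks : List ℕ+) :
    stripLast c (swapH1 (word ks)) = coeffH1 (swap (lastSeries c)) (word ks) := by
  rw [swapH1_eq, coeffH1_word, coeffH1_word, ← wordCoeff_mapCoeff, isNatural_swap]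
  rfl

theorem stripLast_swapH1_one (d : ℕ) (f : H1) :
    (d.factorial : ℚ) • stripLast (1, d) (swapH1 f) = swapH1 (dropFirst d f) := by
  have : (d.factorial : ℚ) • (stripLast (1, d)).comp swapH1 = swapH1.comp (dropFirst d) :=
    words_hom_ext fun ks => by
      rw [LinearMap.smul_apply, LinearMap.comp_apply, LinearMap.comp_apply, stripLast_swapH1_word,
        swapH1_eq, ← coeffH1_diffFirst, coeffH1_word, coeffH1_word, ← map_smul,
        factorial_smul_swap_lastSeries]
  exact LinearMap.congr_fun this f

/-- For a last letter with k > 1 the swapped series is divisible by Y_1, while only coefficients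
with all d_i = 0 are read off. -/
theorem stripLast_swapH1_succ (k : ℕ+) (d : ℕ) (f : H1) :
    stripLast (k + 1, d) (swapH1 f) = 0 := by
  have : (stripLast (k + 1, d)).comp swapH1 = 0 := words_hom_ext fun ks => by
    rw [LinearMap.comp_apply, stripLast_swapH1_word, coeffH1_word, swap_lastSeries_succ]
    rcases ks with _ | ⟨l, ks⟩
    · simp [varY_depth_zero]
    · have := wordCoeff_varY_mul [] (ks.map fun k => (k, 0)) (l, 0)
        (show 0 < (l :: ks).length by simp) (swap (lastSeries (k, d)) (l :: ks).length)
      refine this.trans ?_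
      simp
  exact LinearMap.congr_fun this f

theorem mapCoeff_emptyPart_genSeries (r : ℕ) :
    mapCoeff emptyPart (genSeries r) = if r = 0 then genSeries r else 0 := by
  refine series_ext fun w hw => ?_
  rw [wordCoeff_mapCoeff, wordCoeff_genSeries _ hw]
  rcases w with _ | ⟨a, w⟩
  · subst hw
    exact emptyPart_nil.trans (wordCoeff_genSeries [] rfl).symm
  · rw [emptyPart_cons, if_neg (by rw [← hw]; simp), map_zero]

theorem emptyPart_swapH1 (f : H1) : emptyPart (swapH1 f) = swapH1 (emptyPart f) := by
  have : emptyPart.comp swapH1 = swapH1.comp emptyPart := words_hom_ext fun ks => by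
    rw [LinearMap.comp_apply, LinearMap.comp_apply, swapH1_eq, coeffH1_word, ← wordCoeff_mapCoeff,
      isNatural_swap, swap_eq_swapHom, mapCoeff_emptyPart_genSeries]
    rcases ks with _ | ⟨k, ks⟩
    · rw [emptyPart_nil, coeffH1_word, if_pos List.length_nil, swap_eq_swapHom]
    · rw [if_neg (by simp), map_zero, map_zero, emptyPart_cons, map_zero]
  exact LinearMap.congr_fun this f

/-- Last letters are compared one by one. For [1; d] the derivation `dropFirst d` reduces the claim
to the hypothesis, and for d = 1 both products contribute an extra σ(f). For [2; d + 1] the merged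
letter and the letter raised by D cancel. All other last letters have k > 1 and contribute nothing.
-/
theorem letter_mul_swapH1_of_dropFirst {f : H1}
    (hf : ∀ d, word [(1, 1)] * swapH1 (dropFirst d f) =
      swapH1 (shuffleH1Lin (word [2]) (dropFirst d f)) + derD (swapH1 (dropFirst d f))) :
    word [(1, 1)] * swapH1 f = swapH1 (shuffleH1Lin (word [2]) f) + derD (swapH1 f) := by
  classical
  rw [← sub_eq_zero]
  refine eq_zero_of_stripLast ?_ fun c => ?_
  · rw [map_sub, map_add, emptyPart_letter_mul, emptyPart_derD, emptyPart_swapH1,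
      emptyPart_shuffleH1Lin_cons, map_zero, add_zero, sub_zero]
  · rw [map_sub, map_add]
    by_cases hc : ∀ a, a + (1, 1) ≠ c
    · rw [stripLast_derD_of_ne hc, stripLast_letter_mul_of_ne hc]
      obtain ⟨k, d⟩ := c
      by_cases hk : k = 1
      · subst hk
        have hd : (d.factorial : ℚ) ≠ 0 := Nat.cast_ne_zero.2 d.factorial_ne_zero
        refine smul_right_injective QA hd ?_
        change (d.factorial : ℚ) • _ = (d.factorial : ℚ) • (0 : QA)
        rw [smul_sub, smul_add, smul_add, ← mul_smul_comm, ← Derivation.map_smul,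
          stripLast_swapH1_one, stripLast_swapH1_one, dropFirst_shuffleH1Lin, dropFirst_two, hf,
          map_add, smul_zero]
        by_cases h : d = 1
        · subst h
          rw [if_pos rfl, if_pos rfl, shuffleH1Lin_nil_left, Nat.factorial_one, Nat.cast_one,
            one_smul]
          abel
        · rw [if_neg h, if_neg (by simpa [Prod.ext_iff] using h)]
          simp
      · obtain ⟨m, rfl⟩ : ∃ m, k = m + 1 := PNat.exists_eq_succ_of_ne_one hk
        rw [stripLast_swapH1_succ, stripLast_swapH1_succ, if_neg]
        · simp
        · intro h
          have := congrArg (fun c : Letter => (c.1 : ℕ)) h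
          simp at this
    -- Here the last letter is [k; d] + [1; 1], with coefficient 1 from the product and k from D.
    -- These agree for k = 1, and for k > 1 the letter [k; d] does not end any word of σ(f).
    · push Not at hc
      obtain ⟨⟨k, d⟩, rfl⟩ := hc
      rw [stripLast_derD_add, stripLast_letter_mul_add]
      have h : ∀ g, stripLast ((k, d) + (1, 1)) (swapH1 g) = 0 := stripLast_swapH1_succ k (d + 1)
      rw [h, h]
      by_cases hk : k = 1
      · subst hk
        simp
      · obtain ⟨m, rfl⟩ : ∃ m, k = m + 1 := PNat.exists_eq_succ_of_ne_one hk
        rw [stripLast_swapH1_succ]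
        simp

theorem letter_mul_swapH1_of_mem {n : ℕ} {f : H1} (hf : f ∈ depthEq n) :
    word [(1, 1)] * swapH1 f = swapH1 (shuffleH1Lin (word [2]) f) + derD (swapH1 f) := by
  induction n generalizing f with
  | zero =>
    refine letter_mul_swapH1_of_dropFirst fun d => ?_
    simp [dropFirst_depth_zero d hf]
  | succ n ih => exact letter_mul_swapH1_of_dropFirst fun d => ih (dropFirst_mem d hf)

theorem letter_mul_swapH1 (f : H1) :
    word [(1, 1)] * swapH1 f = swapH1 (shuffleH1Lin (word [2]) f) + derD (swapH1 f) := by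
  have : (LinearMap.mulLeft ℚ (word [(1, 1)])).comp swapH1 =
      swapH1.comp (shuffleH1Lin (word [2])) + (derD : QA →ₗ[ℚ] QA).comp swapH1 :=
    words_hom_ext fun ks => letter_mul_swapH1_of_mem (Submodule.subset_span ⟨ks, rfl, rfl⟩)
  exact LinearMap.congr_fun this f

theorem proj_swapH1 (f : H1) : proj (swapH1 f) = eisLin f := by
  rw [swapH1, LinearMap.comp_apply, proj_onWords_swap, proj_embH1]

/-- In FMES the swap in `letter_mul_swapH1` becomes invisible, and multiplication by G^f[1; 1] is
multiplication by G^f(2), that is, the stuffle product with z_2. -/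
theorem fmesD_eisLin (f : H1) :
    fmesD (eisLin f) = eisLin (word [2] * f - shuffleH1 (word [2]) f) := by
  have key : ∀ f, proj (word [(1, 1)]) * eisLin f =
      eisLin (shuffleH1 (word [2]) f) + fmesD (eisLin f) := fun f => by
    rw [← proj_swapH1 f, ← map_mul, letter_mul_swapH1, map_add, proj_swapH1, fmesD_proj]
    rfl
  have hone : eisLin (word []) = 1 := (eisHom_apply 1).symm.trans (map_one eisHom)
  -- This is the case f = 1 of `key`, where the term with D vanishes.
  have h2 : proj (word [(1, 1)]) = eisLin (word [2]) := by
    have := key (word [])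
    rwa [hone, mul_one, Derivation.map_one_eq_zero, add_zero, ← shuffleH1Lin_apply,
      shuffleH1Lin_nil_right] at this
  rw [map_sub, ← eisHom_apply (_ * _), map_mul, eisHom_apply, eisHom_apply, ← h2, key]
  abel

end SwapOfDepthWords

/-! ### Closure of Fil^lwt_0 under D, W and δ -/

section ClosureOfLowerWeightZero

theorem derW_depthWord (ks : List ℕ+) :
    derW (depthWord ks) = (ks.map fun k : ℕ+ => (k : ℚ)).sum • depthWord ks := by
  induction ks with
  | nil =>
    have : derW (depthWord []) = 0 := localOp_nil _
    simp [this]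
  | cons k ks ih =>
    have hcons : derW (depthWord (k :: ks)) =
        consL (k, 0) (derW (depthWord ks)) + dataW.head (depthWord (k :: ks)) := by
      rw [← consL_depthWord]
      exact localOp_consL _ _ _
    have hhead : dataW.head (depthWord (k :: ks)) =
        prepend (dataW.one (k, 0)) (depthWord ks) :=
      dataW.head_of_one (fun _ _ => rfl) (fun _ _ _ => rfl) (fun _ => rfl) (fun _ _ => rfl) _ _
    rw [hcons, hhead, ih, map_smul, consL_depthWord]
    simp only [dataW, map_smul, prepend_single, LinearMap.smul_apply, one_smul, consL_depthWord,
      List.map_cons, List.sum_cons, add_smul, Nat.cast_zero, zero_smul, add_zero]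
    abel

theorem proj_depthWord (ks : List ℕ+) : proj (depthWord ks) = eis ks := rfl

theorem fmesW_eis (ks : List ℕ+) :
    fmesW (eis ks) = (ks.map fun k : ℕ+ => (k : ℚ)).sum • eis ks := by
  rw [← proj_depthWord, fmesW_proj, derW_depthWord, map_smul]

theorem fmesDelta_eis (ks : List ℕ+) : fmesDelta (eis ks) =
    -((1 / 2 : ℚ) • if ks[0]? = some 2 then eis (ks.drop 1) else 0)
      + ((1 / 4 : ℚ) • if ks[0]? = some 1 ∧ ks[1]? = some 1 then eis (ks.drop 2) else 0)
      + (1 / 2 : ℚ) • ∑ j ∈ Finset.range (ks.length - 1),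
          (if ks[j]? = some 1 ∧ 1 < ks.getD (j + 1) 1 then
            eis (ks.take j ++ (ks.getD (j + 1) 1 - 1) :: ks.drop (j + 2)) else 0)
      - (1 / 2 : ℚ) • ∑ j ∈ Finset.Ico 1 ks.length,
          (if ks[j]? = some 1 ∧ 1 < ks.getD (j - 1) 1 then
            eis (ks.take (j - 1) ++ (ks.getD (j - 1) 1 - 1) :: ks.drop (j + 1)) else 0) := by
  rw [← proj_depthWord, fmesDelta_proj, derDelta_depthWord]
  simp only [map_add, map_sub, map_neg, map_smul, apply_ite proj, map_zero, lowerNext, lowerPrev,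
    map_sum, proj_depthWord]

theorem eis_mem_range (ks : List ℕ+) : eis ks ∈ eisHom.range :=
  ⟨word ks, (eisHom_apply _).trans (wordLift_word _ _)⟩

theorem map_mem_range_eisHom (T : FMES →ₗ[ℚ] FMES) (hT : ∀ ks, T (eis ks) ∈ eisHom.range)
    {f : FMES} (hf : f ∈ eisHom.range) : T f ∈ eisHom.range := by
  obtain ⟨g, rfl⟩ := hf
  change T (eisHom g) ∈ _
  rw [eisHom_apply]
  have h : (Subalgebra.toSubmodule eisHom.range).mkQ.comp (T.comp eisLin) = 0 :=
    words_hom_ext fun ks => by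
      rw [LinearMap.comp_apply, LinearMap.comp_apply, eisLin, wordLift_word, LinearMap.zero_apply,
        Submodule.mkQ_apply, Submodule.Quotient.mk_eq_zero]
      exact hT ks
  exact (Submodule.Quotient.mk_eq_zero _).1 (LinearMap.congr_fun h g)

theorem fmesD_mem {f : FMES} (hf : f ∈ eisHom.range) : fmesD f ∈ eisHom.range := by
  obtain ⟨g, rfl⟩ := hf
  change fmesD (eisHom g) ∈ _
  rw [eisHom_apply, fmesD_eisLin, ← eisHom_apply]
  exact ⟨_, rfl⟩

theorem fmesW_mem {f : FMES} (hf : f ∈ eisHom.range) : fmesW f ∈ eisHom.range :=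
  map_mem_range_eisHom (fmesW : FMES →ₗ[ℚ] FMES) (fun ks => by
    rw [Derivation.coeFn_coe, fmesW_eis]
    exact Subalgebra.smul_mem _ (eis_mem_range ks) _) hf

theorem fmesDelta_mem {f : FMES} (hf : f ∈ eisHom.range) : fmesDelta f ∈ eisHom.range :=
  map_mem_range_eisHom (fmesDelta : FMES →ₗ[ℚ] FMES) (fun ks => by
    have hite : ∀ (p : Prop) [Decidable p] (ls : List ℕ+),
        (if p then eis ls else 0) ∈ eisHom.range := fun p _ ls => by
      split_ifs
      · exact eis_mem_range ls
      · exact zero_mem _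
    rw [Derivation.coeFn_coe, fmesDelta_eis]
    exact sub_mem (add_mem (add_mem (neg_mem (Subalgebra.smul_mem _ (hite _ _) _))
      (Subalgebra.smul_mem _ (hite _ _) _))
      (Subalgebra.smul_mem _ (sum_mem fun j _ => hite _ _) _))
      (Subalgebra.smul_mem _ (sum_mem fun j _ => hite _ _) _)) hf

end ClosureOfLowerWeightZero

end

end FormalMES

theorem mainTheorem5 :
    ∃ D W δ : Derivation ℚ FMES FMES,
      -- the derivations induced by the operators `D`, `W`, `δ` on generating series
      (∀ u : QA, D (proj u) = proj (onWords opD u)) ∧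
      (∀ u : QA, W (proj u) = proj (onWords opW u)) ∧
      (∀ u : QA, δ (proj u) = proj (onWords opDelta u)) ∧
      -- they form an `sl_2`-triple
      ⁅W, D⁆ = (2 : ℚ) • D ∧ ⁅W, δ⁆ = (-2 : ℚ) • δ ∧ ⁅δ, D⁆ = W ∧
      -- `Fil^lwt_0 FMES` is a subalgebra that is closed under `D`, `W` and `δ`
      (∃ S : Subalgebra ℚ FMES, Subalgebra.toSubmodule S = filLwt 0 ∧
        ∀ f ∈ S, D f ∈ S ∧ W f ∈ S ∧ δ f ∈ S) ∧
      -- the formula for `δ G^f(k_1, …, k_r)`; the list `ks` is indexed from `0`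
      (∀ ks : List ℕ+,
        δ (eis ks) =
          -((1 / 2 : ℚ) • if ks[0]? = some 2 then eis (ks.drop 1) else 0)
          + ((1 / 4 : ℚ) • if ks[0]? = some 1 ∧ ks[1]? = some 1 then eis (ks.drop 2) else 0)
          + (1 / 2 : ℚ) • ∑ j ∈ Finset.range (ks.length - 1),
              (if ks[j]? = some 1 ∧ 1 < ks.getD (j + 1) 1 then
                eis (ks.take j ++ (ks.getD (j + 1) 1 - 1) :: ks.drop (j + 2)) else 0)
          - (1 / 2 : ℚ) • ∑ j ∈ Finset.Ico 1 ks.length,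
              (if ks[j]? = some 1 ∧ 1 < ks.getD (j - 1) 1 then
                eis (ks.take (j - 1) ++ (ks.getD (j - 1) 1 - 1) :: ks.drop (j + 1)) else 0)) ∧
      -- the formula for `D G^f(k_1, …, k_r)`
      (∀ ks : List ℕ+,
        D (eis ks) = eisLin (word [2] * word ks - shuffleH1 (word [2]) (word ks))) := by
  refine ⟨fmesD, fmesW, fmesDelta, fun u => ?_, fun u => ?_, fun u => ?_, lie_fmesW_fmesD,
    lie_fmesW_fmesDelta, lie_fmesDelta_fmesD, ⟨eisHom.range, toSubmodule_range_eisHom,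
      fun f hf => ⟨fmesD_mem hf, fmesW_mem hf, fmesDelta_mem hf⟩⟩, fmesDelta_eis, fun ks => ?_⟩
  · rw [fmesD_proj, onWords_opD]
  · rw [fmesW_proj, onWords_opW]
  · rw [fmesDelta_proj, onWords_opDelta]
  · rw [← fmesD_eisLin, eisLin, wordLift_word]
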